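/- Let $n\ge 2$, let $\Omega\subset\mathbb R^n$ be a bounded domain (no regularity of $\partial\Omega$ is needed), let $\gamma,\beta\in C^1(\bar\Omega)$ with $\gamma(x)\ge 1$ and $\beta(x)\ge 1$ on $\Omega$, and let $\theta:\Omega\to[1,\infty)$ be measurable and essentially bounded with $\theta(x)\ge\gamma(x)+\beta(x)+\varepsilon_0$ for a.e. $x\in\Omega$ and some $\varepsilon_0>0$. Functions equal a.e. are identified. For a measurable essentially bounded exponent $p\ge 1$ let $L^{p(x)}(\Omega)$ be the set of measurable $u:\Omega\to\mathbb R$ with $\int_\Omega|u|^{p(x)}dx<\infty$, with the Luxemburg norm $\|u\|_{L^{p(x)}}=\inf\{\lambda>0:\int_\Omega|u/\lambda|^{p(x)}dx\le 1\}$. Put $$\varphi(x,t)=|t|^{\gamma(x)/\beta(x)}t,\qquad \varphi'_t(x,t)=\Big(\frac{\gamma(x)}{\beta(x)}+1\Big)|t|^{\gamma(x)/\beta(x)},\qquad \psi(x)=\frac{\theta(x)\beta(x)}{\gamma(x)+\beta(x)},$$ and write $\varphi(u)(x)=\varphi(x,u(x))$, $\varphi'_t(u)(x)=\varphi'_t(x,u(x))$.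 For $u\in L^1(\Omega)$, $D_iu$ denotes the measurable function (unique a.e., if it exists) such that for every $\varepsilon>0$ the function $\operatorname{sign}(u)(|u|-\varepsilon)^+$ has a weak derivative in $L^1_{loc}(\Omega)$ in direction $i$, equal to $D_iu$ a.e. on $\{|u|>\varepsilon\}$ and to $0$ a.e. elsewhere, and $D_iu=0$ a.e. on $\{u=0\}$. (If $u$ has a weak derivative in $L^1_{loc}(\Omega)$ in direction $i$, this is that weak derivative.) Let $S=S_{1,\gamma(x),\beta(x),\theta(x)}(\Omega)$ be the set of all $u\in L^1(\Omega)\cap L^{\theta(x)}(\Omega)$ for which $D_1u,\dots,D_nu$ exist and $$\int_\Omega|u|^{\gamma(x)+\beta(x)}dx+\sum_{i=1}^n\int_\Omega|u|^{\gamma(x)}|D_iu|^{\beta(x)}dx<\infty ,$$ and for $u,v\in S$ let $$d_{S_1}(u,v)=\|\varphi(u)-\varphi(v)\|_{L^{\psi(x)}}+\sum_{i=1}^n\|\varphi'_t(u)D_iu-\varphi'_t(v)D_iv\|_{L^{\beta(x)}} .$$ Let $L^{1,\beta(x)}(\Omega)$ be the set of $v\in L^1(\Omega)$ whose weak derivatives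 $D_iv$ exist and belong to $L^{\beta(x)}(\Omega)$, $i=1,\dots,n$, and equip $V=L^{1,\beta(x)}(\Omega)\cap L^{\psi(x)}(\Omega)$ with the norm $\|v\|_{L^1}+\sum_{i=1}^n\|D_iv\|_{L^{\beta(x)}}+\|v\|_{L^{\psi(x)}}$. Then $d_{S_1}$ is a metric on $S$, the distance defined by this norm is a metric on $V$, and $u\mapsto\varphi(u)$ is a homeomorphism of $(S,d_{S_1})$ onto $V$. -/

import Mathlib

open MeasureTheory Set
open scoped ContDiff

noncomputable section

namespace VarExp

/-- Euclidean space `ℝⁿ`. -/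
abbrev E (n : ℕ) : Type := EuclideanSpace ℝ (Fin n)

variable {n : ℕ}

/-- Lebesgue measure on `Ω`. -/
abbrev vol (Ω : Set (E n)) : Measure (E n) := volume.restrict Ω

/-- Classes of real measurable functions on `Ω`, modulo equality almost everywhere. -/
abbrev Fun (Ω : Set (E n)) : Type := E n →ₘ[vol Ω] ℝ

/-! ### Exponents and variable exponent Lebesgue spaces -/

/-- The class `M₀(Ω)`: measurable exponents with `1 ≤ p⁻ ≤ p(x) ≤ p⁺ < ∞` for a.e. `x ∈ Ω`. -/
def MemM0 (Ω : Set (E n)) (p : E n → ℝ) : Prop :=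
  AEMeasurable p (vol Ω) ∧ (∀ᵐ x ∂(vol Ω), 1 ≤ p x) ∧ ∃ M : ℝ, ∀ᵐ x ∂(vol Ω), p x ≤ M

/-- `f ∈ C¹(Ω̄)`: `f` is `C¹` in the open set `Ω`, and `f` and its derivative extend continuously
from `Ω` to the closure of `Ω`. Only the values of `f` on `Ω` matter. -/
def IsC1Closure (Ω : Set (E n)) (f : E n → ℝ) : Prop :=
  ContDiffOn ℝ 1 f Ω ∧
    (∃ F : E n → ℝ, ContinuousOn F (closure Ω) ∧ EqOn F f Ω) ∧
    ∃ F' : E n → (E n →L[ℝ] ℝ), ContinuousOn F' (closure Ω) ∧ EqOn F' (fderiv ℝ f) Ω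

/-- The modular `σ_p(u) = ∫_Ω |u|^{p(x)} dx`, with values in `[0, ∞]`. -/
def modular (Ω : Set (E n)) (p u : E n → ℝ) : ENNReal :=
  ∫⁻ x in Ω, ENNReal.ofReal (|u x| ^ p x)

/-- `u ∈ L^{p(x)}(Ω)`. -/
def MemLvar (Ω : Set (E n)) (p u : E n → ℝ) : Prop :=
  AEStronglyMeasurable u (vol Ω) ∧ modular Ω p u < ⊤

/-- The Luxemburg norm of `L^{p(x)}(Ω)`. -/
def luxNorm (Ω : Set (E n)) (p u : E n → ℝ) : ℝ :=
  sInf {l : ℝ | 0 < l ∧ modular Ω p (fun x => u x / l) ≤ 1}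

/-! ### Weak derivatives -/

/-- `g` is the weak (distributional) derivative `D_i w` on `Ω`; both functions are locally
integrable in `Ω`. -/
def HasWeakDeriv (Ω : Set (E n)) (i : Fin n) (w g : E n → ℝ) : Prop :=
  LocallyIntegrableOn w Ω volume ∧ LocallyIntegrableOn g Ω volume ∧
    ∀ η : E n → ℝ, ContDiff ℝ ∞ η → HasCompactSupport η → tsupport η ⊆ Ω →
      ∫ x in Ω, w x * fderiv ℝ η x (EuclideanSpace.single i 1) = - ∫ x in Ω, g x * η x

open Classical in
/-- The weak derivative `D_i w` (unique up to a null set), and `0` if there is none. -/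
def weakDeriv (Ω : Set (E n)) (i : Fin n) (w : E n → ℝ) : E n → ℝ :=
  if h : ∃ g, HasWeakDeriv Ω i w g then h.choose else 0

/-- Removal of the values of modulus at most `ε`: `cut ε t = sign(t) (|t| - ε)⁺`. -/
def cut (ε t : ℝ) : ℝ := t - max (-ε) (min t ε)

/-- `g` is the derivative `D_i u` in the sense of truncations: for every `ε > 0` the function
`sign(u) (|u| - ε)⁺` is weakly differentiable and its weak derivative is `g` where `|u| > ε` and
`0` elsewhere; and `g = 0` a.e. where `u = 0`. If `u` is weakly differentiable this is the weak
derivative; in general `g` need not be locally integrable near the zero set of `u`, where the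
weight `|u|^γ` degenerates. -/
def HasTruncDeriv (Ω : Set (E n)) (i : Fin n) (u g : E n → ℝ) : Prop :=
  AEStronglyMeasurable g (vol Ω) ∧ (∀ᵐ x ∂(vol Ω), u x = 0 → g x = 0) ∧
    ∀ ε : ℝ, 0 < ε →
      HasWeakDeriv Ω i (fun x => cut ε (u x)) (indicator {x | ε < |u x|} g)

open Classical in
/-- The derivative `D_i u` in the sense of truncations (unique up to a null set), and `0` if there
is none. -/
def truncDeriv (Ω : Set (E n)) (i : Fin n) (u : E n → ℝ) : E n → ℝ :=
  if h : ∃ g, HasTruncDeriv Ω i u g then h.choose else 0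

/-! ### The nonlinear space `S_{1,γ(x),β(x),θ(x)}(Ω)` and its metric -/

/-- `u ∈ S_{1,γ(x),β(x)}(Ω)`: `u ∈ L¹(Ω)` and
`∫_Ω |u|^{γ+β} dx + ∑ᵢ ∫_Ω |u|^γ |D_i u|^β dx < ∞`. -/
def MemS (Ω : Set (E n)) (γ β : E n → ℝ) (u : Fun Ω) : Prop :=
  Integrable u (vol Ω) ∧ (∀ i, ∃ g, HasTruncDeriv Ω i u g) ∧
    modular Ω (fun x => γ x + β x) u +
      ∑ i, ∫⁻ x in Ω, ENNReal.ofReal (|u x| ^ γ x * |truncDeriv Ω i u x| ^ β x) < ⊤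

/-- The space `S_{1,γ(x),β(x),θ(x)}(Ω) = S_{1,γ(x),β(x)}(Ω) ∩ L^{θ(x)}(Ω)`. -/
def SSpace (Ω : Set (E n)) (γ β θ : E n → ℝ) : Type :=
  {u : Fun Ω // MemS Ω γ β u ∧ MemLvar Ω θ u}

/-- `φ(x, t) = |t|^{γ(x)/β(x)} t`. -/
def phi (γ β : E n → ℝ) (x : E n) (t : ℝ) : ℝ := |t| ^ (γ x / β x) * t

/-- `φ'_t(x, t) = (γ(x)/β(x) + 1) |t|^{γ(x)/β(x)}`. -/
def phiDeriv (γ β : E n → ℝ) (x : E n) (t : ℝ) : ℝ := (γ x / β x + 1) * |t| ^ (γ x / β x)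

/-- The exponent `ψ = θ β / (γ + β)`. -/
def psi (γ β θ : E n → ℝ) (x : E n) : ℝ := θ x * β x / (γ x + β x)

/-- `d_{S₁}(u,v) = ‖φ(u) - φ(v)‖_{L^ψ} + ∑ᵢ ‖φ'_t(u) D_i u - φ'_t(v) D_i v‖_{L^β}`. -/
def distS (Ω : Set (E n)) (γ β θ : E n → ℝ) (u v : SSpace Ω γ β θ) : ℝ :=
  luxNorm Ω (psi γ β θ) (fun x => phi γ β x (u.1 x) - phi γ β x (v.1 x)) +
    ∑ i, luxNorm Ω β (fun x =>
      phiDeriv γ β x (u.1 x) * truncDeriv Ω i u.1 x -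
        phiDeriv γ β x (v.1 x) * truncDeriv Ω i v.1 x)

/-! ### The space `L^{1,β(x)}(Ω) ∩ L^{ψ(x)}(Ω)` -/

/-- `v ∈ L^{1,β(x)}(Ω)`: `v ∈ L¹(Ω)` has weak derivatives `D_i v ∈ L^{β(x)}(Ω)`. -/
def MemL1 (Ω : Set (E n)) (β : E n → ℝ) (v : Fun Ω) : Prop :=
  Integrable v (vol Ω) ∧
    ∀ i, (∃ g, HasWeakDeriv Ω i v g) ∧ MemLvar Ω β (weakDeriv Ω i v)

/-- The space `L^{1,β(x)}(Ω) ∩ L^{q(x)}(Ω)`. -/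
def VSpace (Ω : Set (E n)) (β q : E n → ℝ) : Type :=
  {v : Fun Ω // MemL1 Ω β v ∧ MemLvar Ω q v}

/-- The norm `‖w‖_{L¹} + ∑ᵢ ‖D_i w‖_{L^β} + ‖w‖_{L^q}` of the intersection. -/
def normV (Ω : Set (E n)) (β q : E n → ℝ) (w : Fun Ω) : ℝ :=
  (∫ x in Ω, |w x|) + ∑ i, luxNorm Ω β (weakDeriv Ω i w) + luxNorm Ω q w

end VarExp

end

/-! Write `a = γ/β` and `v = φ(u) = |u|^a u`. Since `(a + 1) ψ = θ`, pointwise `|v|^ψ = |u|^θ`; and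
`t ↦ |t|^a t` is inverted by `s ↦ |s|^b s` with `(a + 1)(b + 1) = 1`. So at the level of functions
`φ` is a bijection of `L^θ` onto `L^ψ` which preserves the modular. The issue is the derivatives. As
`a` depends on `x`, the chain rule produces a logarithmic term: `D_i v = φ'_t(u) D_i u + (∂_i a / (a
+ 1)) v log |v|`, with a bounded coefficient. Everything thus depends on the superposition operator
`v ↦ v log |v|` from `L^ψ` to `L^β`. The gap between `θ` and `γ + β` gives `ψ ≥ β + ε` for some `ε >
0`, which leaves room for the logarithm: the operator is well defined and continuous
(`abs_mul_log_sub_rpow_le`, `luxNorm_mul_log_sub_le`).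

Consequently `D_i v ∈ L^β` exactly when `φ'_t(u) D_i u ∈ L^β`, which matches the two spaces
(`Admissible.memL1_phi`, `Admissible.memS_invExp`). Up to a constant factor, each of the two
distances is at most the other plus the `L^β` distance of the logarithmic terms
(`Admissible.exists_comparison`). Both distances control the `L^ψ` distance of the images, hence by
continuity of the operator at a fixed point also the logarithmic distance. This gives continuity in
both directions; the `L¹` part of the norm is absorbed by the `L^ψ` part because `Ω` is bounded.

The derivative formula rests on a chain rule for `F(x, w)` with `F` of class `C¹`
(`HasWeakDeriv.comp`), proved by mollifying `w` when `F` is bounded, and then by composing `F` with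
a bounded clamp and dominated convergence. A function `u` of the first space is only differentiable
after truncation, so `HasTruncDeriv.hasWeakDeriv_spow` applies the rule to the truncations and lets
their level tend to zero. The inverse power has a negative exponent and is singular at zero;
`HasWeakDeriv.hasTruncDeriv_spow` first composes it with a `C¹` cut-off that vanishes near zero. -/

namespace VarExp

section

variable {n : ℕ} {Ω : Set (E n)} {p q f g : E n → ℝ}

/-! ### Modulars and Luxemburg norms -/

theorem aemeasurable_ofReal_abs_rpow (hp : AEMeasurable p (vol Ω))
    (hf : AEStronglyMeasurable f (vol Ω)) :
    AEMeasurable (fun x => ENNReal.ofReal (|f x| ^ p x)) (vol Ω) :=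
  ((continuous_abs.measurable.comp_aemeasurable hf.aemeasurable).pow hp).ennreal_ofReal

theorem modular_congr (h : f =ᵐ[vol Ω] g) : modular Ω p f = modular Ω p g :=
  lintegral_congr_ae (h.mono fun x hx => by simp only [hx])

theorem modular_neg (f : E n → ℝ) : modular Ω p (fun x => -f x) = modular Ω p f := by
  simp only [modular, abs_neg]

theorem modular_le_mul {C : ℝ} (h : ∀ᵐ x ∂vol Ω, |f x| ^ p x ≤ C * |g x| ^ p x) :
    modular Ω p f ≤ ENNReal.ofReal C * modular Ω p g := by
  rw [modular, modular, ← lintegral_const_mul' _ _ ENNReal.ofReal_ne_top]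
  refine lintegral_mono_ae (h.mono fun x hx => ?_)
  rw [← ENNReal.ofReal_mul' (by positivity)]
  exact ENNReal.ofReal_le_ofReal hx

/-- Here `c ^ p ≤ c` because `c ≤ 1 ≤ p`. This one-sided estimate replaces the homogeneity that the
modular lacks for a variable exponent. -/
theorem modular_const_mul_le (hp : ∀ᵐ x ∂vol Ω, 1 ≤ p x) {c : ℝ} (hc : 0 < c) (hc1 : c ≤ 1) :
    modular Ω p (fun x => c * f x) ≤ ENNReal.ofReal c * modular Ω p f := by
  refine modular_le_mul (hp.mono fun x hx => ?_)
  rw [abs_mul, abs_of_pos hc, Real.mul_rpow hc.le (abs_nonneg _)]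
  gcongr
  simpa using Real.rpow_le_rpow_of_exponent_ge hc hc1 hx

theorem modular_mul_le {M C : ℝ} (hp : ∀ᵐ x ∂vol Ω, 1 ≤ p x) (hM : ∀ᵐ x ∂vol Ω, p x ≤ M)
    (hC : 1 ≤ C) {b : E n → ℝ} (hb : ∀ᵐ x ∂vol Ω, |b x| ≤ C) :
    modular Ω p (fun x => b x * f x) ≤ ENNReal.ofReal (C ^ M) * modular Ω p f := by
  refine modular_le_mul ?_
  filter_upwards [hp, hM, hb] with x h1 h2 h3
  rw [abs_mul, Real.mul_rpow (abs_nonneg _) (abs_nonneg _)]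
  gcongr
  exact (Real.rpow_le_rpow (abs_nonneg _) h3 (by linarith)).trans
    (Real.rpow_le_rpow_of_exponent_le hC h2)

theorem abs_add_rpow_le {p M : ℝ} (hp : 0 ≤ p) (hM : p ≤ M) (s t : ℝ) :
    |s + t| ^ p ≤ 2 ^ M * (|s| ^ p + |t| ^ p) := by
  have h2 : (2 : ℝ) ^ p ≤ 2 ^ M := Real.rpow_le_rpow_of_exponent_le (by norm_num) hM
  have hm : |s + t| ≤ 2 * max |s| |t| := by
    linarith [abs_add_le s t, le_max_left |s| |t|, le_max_right |s| |t|]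
  have hmax : (max |s| |t|) ^ p ≤ |s| ^ p + |t| ^ p := by
    rcases max_choice |s| |t| with h | h <;> rw [h]
    · linarith [Real.rpow_nonneg (abs_nonneg t) p]
    · linarith [Real.rpow_nonneg (abs_nonneg s) p]
  calc |s + t| ^ p ≤ (2 * max |s| |t|) ^ p := Real.rpow_le_rpow (abs_nonneg _) hm hp
    _ = 2 ^ p * (max |s| |t|) ^ p := Real.mul_rpow (by norm_num) (by positivity)
    _ ≤ 2 ^ M * (|s| ^ p + |t| ^ p) := by gcongr

theorem modular_add_le {M : ℝ} (hpm : AEMeasurable p (vol Ω)) (hp : ∀ᵐ x ∂vol Ω, 1 ≤ p x)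
    (hM : ∀ᵐ x ∂vol Ω, p x ≤ M) (hf : AEStronglyMeasurable f (vol Ω)) :
    modular Ω p (fun x => f x + g x) ≤
      ENNReal.ofReal (2 ^ M) * (modular Ω p f + modular Ω p g) := by
  rw [modular, modular, modular, ← lintegral_add_left' (aemeasurable_ofReal_abs_rpow hpm hf),
    ← lintegral_const_mul' _ _ ENNReal.ofReal_ne_top]
  refine lintegral_mono_ae ?_
  filter_upwards [hp, hM] with x h1 h2
  rw [← ENNReal.ofReal_add (by positivity) (by positivity), ← ENNReal.ofReal_mul (by positivity)]
  exact ENNReal.ofReal_le_ofReal (abs_add_rpow_le (by linarith) h2 _ _)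

/-- Pointwise convexity of `t ↦ t ^ p`; it is the source of the triangle inequality for the
Luxemburg norm. -/
theorem modular_convex (hpm : AEMeasurable p (vol Ω)) (hp : ∀ᵐ x ∂vol Ω, 1 ≤ p x)
    (hf : AEStronglyMeasurable f (vol Ω)) {a b : ℝ} (ha : 0 ≤ a) (hb : 0 ≤ b) (hab : a + b = 1) :
    modular Ω p (fun x => a * f x + b * g x) ≤
      ENNReal.ofReal a * modular Ω p f + ENNReal.ofReal b * modular Ω p g := by
  rw [modular, modular, modular, ← lintegral_const_mul' _ _ ENNReal.ofReal_ne_top,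
    ← lintegral_const_mul' _ _ ENNReal.ofReal_ne_top,
    ← lintegral_add_left' ((aemeasurable_ofReal_abs_rpow hpm hf).const_mul _)]
  refine lintegral_mono_ae ?_
  filter_upwards [hp] with x h1
  rw [← ENNReal.ofReal_mul ha, ← ENNReal.ofReal_mul hb,
    ← ENNReal.ofReal_add (by positivity) (by positivity)]
  refine ENNReal.ofReal_le_ofReal ?_
  have hle : |a * f x + b * g x| ≤ a * |f x| + b * |g x| := by
    refine (abs_add_le _ _).trans_eq ?_
    rw [abs_mul, abs_mul, abs_of_nonneg ha, abs_of_nonneg hb]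
  refine (Real.rpow_le_rpow (abs_nonneg _) hle (by linarith)).trans ?_
  exact (convexOn_rpow h1).2 (abs_nonneg (f x)) (abs_nonneg (g x)) ha hb hab

theorem MemLvar.congr (hf : MemLvar Ω p f) (h : f =ᵐ[vol Ω] g) : MemLvar Ω p g :=
  ⟨hf.1.congr h, by rw [← modular_congr h]; exact hf.2⟩

theorem MemLvar.neg (hf : MemLvar Ω p f) : MemLvar Ω p (fun x => -f x) :=
  ⟨hf.1.neg, by rw [modular_neg]; exact hf.2⟩

theorem MemLvar.add (hp : MemM0 Ω p) (hf : MemLvar Ω p f) (hg : MemLvar Ω p g) :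
    MemLvar Ω p (fun x => f x + g x) := by
  obtain ⟨hm, h1, M, hM⟩ := hp
  exact ⟨hf.1.add hg.1, (modular_add_le hm h1 hM hf.1).trans_lt
    (ENNReal.mul_lt_top ENNReal.ofReal_lt_top (ENNReal.add_lt_top.2 ⟨hf.2, hg.2⟩))⟩

theorem MemLvar.sub (hp : MemM0 Ω p) (hf : MemLvar Ω p f) (hg : MemLvar Ω p g) :
    MemLvar Ω p (fun x => f x - g x) := by
  simpa only [sub_eq_add_neg] using hf.add hp hg.neg

theorem MemLvar.bdd_mul (hp : MemM0 Ω p) (hf : MemLvar Ω p f) {b : E n → ℝ}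
    (hbm : AEStronglyMeasurable b (vol Ω)) {C : ℝ} (hb : ∀ᵐ x ∂vol Ω, |b x| ≤ C) :
    MemLvar Ω p (fun x => b x * f x) := by
  obtain ⟨hm, h1, M, hM⟩ := hp
  refine ⟨hbm.mul hf.1, (modular_mul_le h1 hM (le_max_right C 1) (hb.mono fun x hx =>
    hx.trans (le_max_left C 1))).trans_lt (ENNReal.mul_lt_top ENNReal.ofReal_lt_top hf.2)⟩

theorem modular_zero (hp : ∀ᵐ x ∂vol Ω, 1 ≤ p x) : modular Ω p (fun _ => 0) = 0 := by
  rw [modular, lintegral_eq_zero_of_ae_eq_zero]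
  filter_upwards [hp] with x hx
  simp [Real.zero_rpow (show p x ≠ 0 by linarith)]

theorem luxNorm_nonneg : 0 ≤ luxNorm Ω p f := Real.sInf_nonneg fun _ h => h.1.le

theorem luxNorm_congr (h : f =ᵐ[vol Ω] g) : luxNorm Ω p f = luxNorm Ω p g := by
  unfold luxNorm
  congr 1
  ext l
  have : (fun x => f x / l) =ᵐ[vol Ω] fun x => g x / l := h.mono fun x hx => by simp only [hx]
  simp only [mem_ofPred_eq, modular_congr this]

theorem luxNorm_neg (f : E n → ℝ) : luxNorm Ω p (fun x => -f x) = luxNorm Ω p f := by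
  simp only [luxNorm, neg_div, modular_neg]

theorem luxNorm_sub_comm (f g : E n → ℝ) :
    luxNorm Ω p (fun x => f x - g x) = luxNorm Ω p (fun x => g x - f x) := by
  rw [← luxNorm_neg]
  simp only [neg_sub]

theorem luxNorm_le {l : ℝ} (hl : 0 < l) (h : modular Ω p (fun x => f x / l) ≤ 1) :
    luxNorm Ω p f ≤ l := csInf_le ⟨0, fun _ h => h.1.le⟩ ⟨hl, h⟩

theorem exists_modular_div_le_one (hp : ∀ᵐ x ∂vol Ω, 1 ≤ p x) (hf : modular Ω p f < ⊤) :
    ∃ l, 0 < l ∧ modular Ω p (fun x => f x / l) ≤ 1 := by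
  set m := (modular Ω p f).toReal
  have hm : 0 ≤ m := ENNReal.toReal_nonneg
  -- Contraction by `(m + 1)⁻¹ ≤ 1` brings the modular `m` down to at most `m / (m + 1)`.
  refine ⟨m + 1, by positivity, ?_⟩
  have h : (fun x => f x / (m + 1)) = fun x => (m + 1)⁻¹ * f x := by
    ext x; rw [div_eq_inv_mul]
  rw [h]
  refine (modular_const_mul_le hp (by positivity) (inv_le_one_of_one_le₀ (by linarith))).trans ?_
  rw [← ENNReal.ofReal_toReal hf.ne, ← ENNReal.ofReal_mul (by positivity), ENNReal.ofReal_le_one,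
    ← div_eq_inv_mul, div_le_one (by positivity)]
  change m ≤ m + 1
  linarith

/-- No attainment of the infimum is needed: some admissible `m` lies below `l`, and passing from `m`
to `l` is a contraction by `m / l`. -/
theorem modular_div_le_one_of_luxNorm_lt (hp : ∀ᵐ x ∂vol Ω, 1 ≤ p x) (hf : modular Ω p f < ⊤)
    {l : ℝ} (hl : luxNorm Ω p f < l) : modular Ω p (fun x => f x / l) ≤ 1 := by
  obtain ⟨m, ⟨hm0, hm⟩, hml⟩ := exists_lt_of_csInf_lt (exists_modular_div_le_one hp hf) hl
  have h : (fun x => f x / l) = fun x => (m / l) * (f x / m) := by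
    ext x; field_simp
  have hl0 : 0 < l := hm0.trans hml
  rw [h]
  refine (modular_const_mul_le hp (by positivity) ((div_le_one hl0).2 hml.le)).trans ?_
  refine (mul_le_mul' ?_ hm).trans_eq (one_mul 1)
  rw [ENNReal.ofReal_le_one]
  exact (div_le_one hl0).2 hml.le

theorem modular_le_of_luxNorm_lt (hp : ∀ᵐ x ∂vol Ω, 1 ≤ p x) (hf : modular Ω p f < ⊤)
    {l : ℝ} (hl : luxNorm Ω p f < l) (hl1 : l ≤ 1) : modular Ω p f ≤ ENNReal.ofReal l := by
  have hl0 : 0 < l := luxNorm_nonneg.trans_lt hl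
  have h : f = fun x => l * (f x / l) := by ext x; field_simp
  conv_lhs => rw [h]
  refine (modular_const_mul_le hp hl0 hl1).trans ?_
  exact (mul_le_mul' le_rfl (modular_div_le_one_of_luxNorm_lt hp hf hl)).trans_eq (mul_one _)

/-- Dividing by `l ≤ 1` raises the modular by at most `l⁻¹ ^ M`, where the upper bound of the
exponent enters. Together with `modular_le_of_luxNorm_lt`, smallness of the norm and of the modular
become interchangeable. -/
theorem luxNorm_le_of_modular_le {M : ℝ} (hp : ∀ᵐ x ∂vol Ω, 1 ≤ p x) (hM : ∀ᵐ x ∂vol Ω, p x ≤ M)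
    {l : ℝ} (hl : 0 < l) (hl1 : l ≤ 1) (h : modular Ω p f ≤ ENNReal.ofReal (l ^ M)) :
    luxNorm Ω p f ≤ l := by
  refine luxNorm_le hl ?_
  have h' : (fun x => f x / l) = fun x => l⁻¹ * f x := by ext x; rw [div_eq_inv_mul]
  rw [h']
  refine (modular_mul_le hp hM (C := l⁻¹) ((one_le_inv₀ hl).2 hl1)
    (Filter.Eventually.of_forall fun x => (abs_of_pos (inv_pos.2 hl)).le)).trans ?_
  refine (mul_le_mul' le_rfl h).trans ?_
  rw [← ENNReal.ofReal_mul (by positivity), ENNReal.ofReal_le_one, Real.inv_rpow hl.le,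
    inv_mul_cancel₀ (by positivity)]

theorem luxNorm_zero (hp : ∀ᵐ x ∂vol Ω, 1 ≤ p x) : luxNorm Ω p (fun _ => 0) = 0 := by
  refine le_antisymm (le_of_forall_pos_le_add fun ε hε => ?_) luxNorm_nonneg
  rw [zero_add]
  refine luxNorm_le hε ?_
  simp [modular_zero hp]

theorem luxNorm_eq_zero (hp : MemM0 Ω p) (hf : MemLvar Ω p f) (h : luxNorm Ω p f = 0) :
    f =ᵐ[vol Ω] 0 := by
  obtain ⟨hm, h1, -⟩ := hp
  have h0 : modular Ω p f = 0 := by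
    refine le_antisymm (ENNReal.le_of_forall_pos_le_add fun ε hε _ => ?_) (zero_le)
    rw [zero_add]
    have := modular_le_of_luxNorm_lt h1 hf.2 (l := min (ε : ℝ) 1)
      (by rw [h]; positivity) (min_le_right _ _)
    refine this.trans ?_
    rw [← ENNReal.ofReal_coe_nnreal]
    exact ENNReal.ofReal_le_ofReal (min_le_left _ _)
  rw [modular, lintegral_eq_zero_iff' (aemeasurable_ofReal_abs_rpow hm hf.1)] at h0
  filter_upwards [h0, h1] with x hx h1x
  simp only [Pi.zero_apply, ENNReal.ofReal_eq_zero] at hx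
  have := (Real.rpow_eq_zero (abs_nonneg (f x)) (by linarith)).1
    (le_antisymm hx (by positivity))
  simpa using this

theorem luxNorm_add_le (hp : MemM0 Ω p) (hf : MemLvar Ω p f) (hg : MemLvar Ω p g) :
    luxNorm Ω p (fun x => f x + g x) ≤ luxNorm Ω p f + luxNorm Ω p g := by
  obtain ⟨hm, h1, -⟩ := hp
  refine le_of_forall_pos_le_add fun ε hε => ?_
  -- The margin `ε / 2` makes `a` and `b` positive and strictly larger than the norms. Then `(f + g)
  -- / (a + b)` is the convex combination of `f / a` and `g / b` with weights `a / (a + b)` and `b /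
  -- (a + b)`.
  set a := luxNorm Ω p f + ε / 2 with ha
  set b := luxNorm Ω p g + ε / 2 with hb
  have hf0 : 0 ≤ luxNorm Ω p f := luxNorm_nonneg
  have hg0 : 0 ≤ luxNorm Ω p g := luxNorm_nonneg
  have ha0 : 0 < a := by positivity
  have hb0 : 0 < b := by positivity
  have hab : luxNorm Ω p f + luxNorm Ω p g + ε = a + b := by rw [ha, hb]; ring
  rw [hab]
  refine luxNorm_le (by positivity) ?_
  have he : (fun x => (f x + g x) / (a + b)) =
      fun x => (a / (a + b)) * (f x / a) + (b / (a + b)) * (g x / b) := by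
    ext x; field_simp
  rw [he]
  refine (modular_convex hm h1 (hf.1.aemeasurable.div_const a |>.aestronglyMeasurable) (by positivity) (by positivity)
    (by field_simp)).trans ?_
  refine (add_le_add (mul_le_mul' le_rfl
    (modular_div_le_one_of_luxNorm_lt h1 hf.2 (show _ < a by linarith)))
    (mul_le_mul' le_rfl (modular_div_le_one_of_luxNorm_lt h1 hg.2
      (show _ < b by linarith)))).trans_eq ?_
  rw [mul_one, mul_one, ← ENNReal.ofReal_add (by positivity) (by positivity)]
  rw [show a / (a + b) + b / (a + b) = 1 by field_simp, ENNReal.ofReal_one]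

theorem luxNorm_sub_le (hp : MemM0 Ω p) {u v w : E n → ℝ} (hu : MemLvar Ω p u)
    (hv : MemLvar Ω p v) (hw : MemLvar Ω p w) :
    luxNorm Ω p (fun x => u x - w x) ≤
      luxNorm Ω p (fun x => u x - v x) + luxNorm Ω p (fun x => v x - w x) := by
  have := luxNorm_add_le hp (hu.sub hp hv) (hv.sub hp hw)
  simpa using this

/-! ### Comparison of exponents, and with `L¹`, on bounded sets -/

theorem volume_lt_top_of_isBounded (hb : Bornology.IsBounded Ω) : vol Ω univ < ⊤ := by
  rw [Measure.restrict_apply_univ]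
  exact hb.measure_lt_top

theorem MemLvar.mono_exponent (hb : Bornology.IsBounded Ω) (hp : ∀ᵐ x ∂vol Ω, 1 ≤ p x)
    (hpq : ∀ᵐ x ∂vol Ω, p x ≤ q x)
    (hf : MemLvar Ω q f) : MemLvar Ω p f := by
  refine ⟨hf.1, ?_⟩
  calc modular Ω p f ≤ ∫⁻ x in Ω, (1 + ENNReal.ofReal (|f x| ^ q x)) := by
        refine lintegral_mono_ae ?_
        filter_upwards [hp, hpq] with x h1 h2
        rw [← ENNReal.ofReal_one, ← ENNReal.ofReal_add zero_le_one (by positivity)]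
        refine ENNReal.ofReal_le_ofReal ?_
        rcases le_total |f x| 1 with h | h
        · linarith [Real.rpow_le_one (abs_nonneg (f x)) h (by linarith : 0 ≤ p x),
            Real.rpow_nonneg (abs_nonneg (f x)) (q x)]
        · linarith [Real.rpow_le_rpow_of_exponent_le h h2]
    _ = vol Ω univ + modular Ω q f := by
        rw [lintegral_add_left measurable_const, lintegral_one]; rfl
    _ < ⊤ := ENNReal.add_lt_top.2 ⟨volume_lt_top_of_isBounded hb, hf.2⟩

theorem modular_one (f : E n → ℝ) : modular Ω (fun _ => 1) f = ∫⁻ x in Ω, ‖f x‖ₑ := by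
  simp [modular, Real.enorm_eq_ofReal_abs]

theorem MemLvar.integrable (hb : Bornology.IsBounded Ω) (hp : ∀ᵐ x ∂vol Ω, 1 ≤ p x)
    (hf : MemLvar Ω p f) : Integrable f (vol Ω) := by
  have h := hf.mono_exponent hb (p := fun _ => 1) (by simp) hp
  exact ⟨h.1, by rw [HasFiniteIntegral, ← modular_one]; exact h.2⟩

theorem lintegral_enorm_le_add_modular (hp : ∀ᵐ x ∂vol Ω, 1 ≤ p x) :
    ∫⁻ x in Ω, ‖f x‖ₑ ≤ vol Ω univ + modular Ω p f := by
  calc ∫⁻ x in Ω, ‖f x‖ₑ ≤ ∫⁻ x in Ω, (1 + ENNReal.ofReal (|f x| ^ p x)) := by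
        refine lintegral_mono_ae ?_
        filter_upwards [hp] with x h1
        rw [← ENNReal.ofReal_one, ← ENNReal.ofReal_add zero_le_one (by positivity),
          Real.enorm_eq_ofReal_abs]
        refine ENNReal.ofReal_le_ofReal ?_
        rcases le_total |f x| 1 with h | h
        · linarith [Real.rpow_nonneg (abs_nonneg (f x)) (p x)]
        · have := Real.rpow_le_rpow_of_exponent_le h h1
          rw [Real.rpow_one] at this
          linarith
    _ = vol Ω univ + modular Ω p f := by
        rw [lintegral_add_left measurable_const, lintegral_one]; rfl

/-- Integrating `|t| ≤ 1 + |t| ^ p` with `t = f / l` gives at most `|Ω| + 1` whenever `l` exceeds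
the norm of `f`; then `l` tends to the norm. -/
theorem integral_abs_le_mul_luxNorm (hb : Bornology.IsBounded Ω) (hp : ∀ᵐ x ∂vol Ω, 1 ≤ p x)
    (hf : MemLvar Ω p f) :
    ∫ x in Ω, |f x| ≤ ((vol Ω univ).toReal + 1) * luxNorm Ω p f := by
  have hV := volume_lt_top_of_isBounded hb
  have key : ∀ l, luxNorm Ω p f < l → ∫ x in Ω, |f x| ≤ ((vol Ω univ).toReal + 1) * l := by
    intro l hl
    have hl0 : 0 < l := luxNorm_nonneg.trans_lt hl
    have h1 : ∫⁻ x in Ω, ‖f x / l‖ₑ ≤ vol Ω univ + 1 :=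
      (lintegral_enorm_le_add_modular hp).trans
        (add_le_add le_rfl (modular_div_le_one_of_luxNorm_lt hp hf.2 hl))
    have h2 : ∫ x in Ω, |f x / l| = (∫⁻ x in Ω, ‖f x / l‖ₑ).toReal := by
      simpa only [Real.norm_eq_abs] using integral_norm_eq_lintegral_enorm (hf.1.aemeasurable.div_const l |>.aestronglyMeasurable)
    have h3 : ∫ x in Ω, |f x / l| ≤ (vol Ω univ).toReal + 1 := by
      rw [h2]
      refine (ENNReal.toReal_mono (ENNReal.add_lt_top.2 ⟨hV, ENNReal.one_lt_top⟩).ne h1).trans ?_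
      rw [ENNReal.toReal_add hV.ne ENNReal.one_ne_top, ENNReal.toReal_one]
    simp only [abs_div, abs_of_pos hl0, integral_div] at h3
    rwa [div_le_iff₀ hl0] at h3
  have hC : 0 < (vol Ω univ).toReal + 1 := by positivity
  rw [← div_le_iff₀' hC]
  refine le_of_forall_gt_imp_ge_of_dense fun l hl => ?_
  rw [div_le_iff₀' hC]
  exact key l hl

end

section

variable {n : ℕ} {Ω : Set (E n)} {i : Fin n} {w w' g g' : E n → ℝ}

/-! ### Weak derivatives -/

/-- The integration by parts formula in the definition of the weak derivative. -/
def IntegratesByParts (Ω : Set (E n)) (i : Fin n) (w g : E n → ℝ) : Prop :=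
  ∀ η : E n → ℝ, ContDiff ℝ ∞ η → HasCompactSupport η → tsupport η ⊆ Ω →
    ∫ x in Ω, w x * fderiv ℝ η x (EuclideanSpace.single i 1) = - ∫ x in Ω, g x * η x

/-- Local integrability gives integrability on compact subsets only, so integrals against test
functions are moved from `Ω` to a compact support before they are split. -/
theorem integral_test_eq {K : Set (E n)} (hΩ : IsOpen Ω) (hK : K ⊆ Ω) {f η : E n → ℝ}
    (hη : ∀ x, x ∉ K → η x = 0) : ∫ x in Ω, f x * η x = ∫ x in K, f x * η x :=
  setIntegral_eq_of_subset_of_forall_sdiff_eq_zero hΩ.measurableSet hK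
    fun x hx => by rw [hη x hx.2, mul_zero]

theorem fderiv_eq_zero_of_notMem_tsupport {η : E n → ℝ} {x v : E n} (hx : x ∉ tsupport η) :
    fderiv ℝ η x v = 0 := by
  rw [fderiv_of_notMem_tsupport ℝ hx]; rfl

theorem exists_bound_of_test {η : E n → ℝ} (hη : ContDiff ℝ ∞ η) (hc : HasCompactSupport η)
    (v : E n) : ∃ C, 0 ≤ C ∧ (∀ x, |η x| ≤ C) ∧ ∀ x, |fderiv ℝ η x v| ≤ C := by
  obtain ⟨A, hA⟩ := hc.exists_bound_of_continuous hη.continuous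
  obtain ⟨B, hB⟩ := (hc.fderiv_apply (𝕜 := ℝ) v).exists_bound_of_continuous
    ((hη.continuous_fderiv (by simp)).clm_apply continuous_const)
  refine ⟨max (max A B) 0, le_max_right _ _, fun x => ?_, fun x => ?_⟩
  · exact (hA x).trans ((le_max_left _ _).trans (le_max_left _ _))
  · exact (hB x).trans ((le_max_right _ _).trans (le_max_left _ _))

theorem continuous_fderiv_test {η : E n → ℝ} (hη : ContDiff ℝ ∞ η) (v : E n) :
    Continuous fun x => fderiv ℝ η x v :=
  (hη.continuous_fderiv (by simp)).clm_apply continuous_const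

theorem integrableOn_mul_test {K : Set (E n)} {f ζ : E n → ℝ} (hf : IntegrableOn f K)
    (hζ : Continuous ζ) {C : ℝ} (hC : ∀ x, |ζ x| ≤ C) : IntegrableOn (fun x => f x * ζ x) K :=
  Integrable.mul_bdd hf hζ.aestronglyMeasurable (Filter.Eventually.of_forall hC)

theorem IntegratesByParts.congr (h : IntegratesByParts Ω i w g) (hw : w =ᵐ[vol Ω] w')
    (hg : g =ᵐ[vol Ω] g') : IntegratesByParts Ω i w' g' := by
  intro η h1 h2 h3
  have e := h η h1 h2 h3
  rw [integral_congr_ae (hw.mono fun x hx => by simp only [hx] :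
      (fun x => w x * fderiv ℝ η x (EuclideanSpace.single i 1)) =ᵐ[vol Ω]
        fun x => w' x * fderiv ℝ η x (EuclideanSpace.single i 1)),
    integral_congr_ae (hg.mono fun x hx => by simp only [hx] :
      (fun x => g x * η x) =ᵐ[vol Ω] fun x => g' x * η x)] at e
  exact e

theorem HasWeakDeriv.congr (h : HasWeakDeriv Ω i w g) (hw : w =ᵐ[vol Ω] w')
    (hg : g =ᵐ[vol Ω] g') : HasWeakDeriv Ω i w' g' :=
  ⟨h.1.congr hw, h.2.1.congr hg, IntegratesByParts.congr h.2.2 hw hg⟩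

theorem HasWeakDeriv.add (hΩ : IsOpen Ω) (h : HasWeakDeriv Ω i w g) (h' : HasWeakDeriv Ω i w' g') :
    HasWeakDeriv Ω i (fun x => w x + w' x) (fun x => g x + g' x) := by
  refine ⟨h.1.add h'.1, h.2.1.add h'.2.1, fun η h1 h2 h3 => ?_⟩
  obtain ⟨C, -, hC, hC'⟩ := exists_bound_of_test h1 h2 (EuclideanSpace.single i 1)
  have hd : ∀ x, x ∉ tsupport η → fderiv ℝ η x (EuclideanSpace.single i 1) = 0 :=
    fun x hx => fderiv_eq_zero_of_notMem_tsupport hx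
  have hη : ∀ x, x ∉ tsupport η → η x = 0 := fun x hx => image_eq_zero_of_notMem_tsupport hx
  have e1 := h.2.2 η h1 h2 h3
  have e2 := h'.2.2 η h1 h2 h3
  rw [integral_test_eq hΩ h3 hd, integral_test_eq hΩ h3 hη] at e1 e2 ⊢
  simp only [add_mul]
  have I : ∀ {f : E n → ℝ}, LocallyIntegrableOn f Ω volume → IntegrableOn f (tsupport η) :=
    fun hf => hf.integrableOn_compact_subset h3 h2
  rw [integral_add (integrableOn_mul_test (I h.1) (continuous_fderiv_test h1 _) hC')
    (integrableOn_mul_test (I h'.1) (continuous_fderiv_test h1 _) hC'),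
    integral_add (integrableOn_mul_test (I h.2.1) h1.continuous hC)
    (integrableOn_mul_test (I h'.2.1) h1.continuous hC), e1, e2]
  ring

theorem HasWeakDeriv.neg (h : HasWeakDeriv Ω i w g) :
    HasWeakDeriv Ω i (fun x => -w x) (fun x => -g x) := by
  refine ⟨h.1.neg, h.2.1.neg, fun η h1 h2 h3 => ?_⟩
  simp only [neg_mul, integral_neg]
  rw [h.2.2 η h1 h2 h3]

theorem HasWeakDeriv.sub (hΩ : IsOpen Ω) (h : HasWeakDeriv Ω i w g) (h' : HasWeakDeriv Ω i w' g') :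
    HasWeakDeriv Ω i (fun x => w x - w' x) (fun x => g x - g' x) := by
  simpa only [sub_eq_add_neg] using h.add hΩ h'.neg

/-- The difference of two weak derivatives is a weak derivative of zero, so it is annihilated by all
test functions and the fundamental lemma of the calculus of variations applies. -/
theorem HasWeakDeriv.unique (hΩ : IsOpen Ω) (h : HasWeakDeriv Ω i w g)
    (h' : HasWeakDeriv Ω i w g') : g =ᵐ[vol Ω] g' := by
  have h0 := h.sub hΩ h'
  simp only [sub_self] at h0
  have := hΩ.ae_eq_zero_of_integral_contDiff_smul_eq_zero h0.2.1 fun η h1 h2 h3 => by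
    have e := h0.2.2 η h1 h2 h3
    simp only [zero_mul, integral_zero] at e
    rw [← setIntegral_eq_integral_of_forall_compl_eq_zero (s := Ω)]
    · simp only [smul_eq_mul, mul_comm (η _)]
      linarith
    · intro x hx
      rw [image_eq_zero_of_notMem_tsupport fun hx' => hx (h3 hx'), zero_smul]
  rw [Filter.EventuallyEq, vol, ae_restrict_iff' hΩ.measurableSet]
  exact this.mono fun x hx hxΩ => sub_eq_zero.1 (hx hxΩ)

theorem weakDeriv_spec (h : ∃ g, HasWeakDeriv Ω i w g) :
    HasWeakDeriv Ω i w (weakDeriv Ω i w) := by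
  rw [weakDeriv, dif_pos h]
  exact h.choose_spec

theorem HasWeakDeriv.weakDeriv_eq (hΩ : IsOpen Ω) (h : HasWeakDeriv Ω i w g) :
    weakDeriv Ω i w =ᵐ[vol Ω] g := (weakDeriv_spec ⟨g, h⟩).unique hΩ h

theorem truncDeriv_spec (h : ∃ g, HasTruncDeriv Ω i w g) :
    HasTruncDeriv Ω i w (truncDeriv Ω i w) := by
  rw [truncDeriv, dif_pos h]
  exact h.choose_spec

/-- Truncation at level `1 / (k + 1)` determines the derivative where `|w| > 1 / (k + 1)`. These
sets exhaust `{w ≠ 0}`, and on `{w = 0}` the derivative vanishes by definition. -/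
theorem HasTruncDeriv.unique (hΩ : IsOpen Ω) (h : HasTruncDeriv Ω i w g)
    (h' : HasTruncDeriv Ω i w g') : g =ᵐ[vol Ω] g' := by
  have key : ∀ k : ℕ, indicator {x | (1 / ((k : ℝ) + 1)) < |w x|} g =ᵐ[vol Ω]
      indicator {x | (1 / ((k : ℝ) + 1)) < |w x|} g' := fun k =>
    (h.2.2 _ (by positivity)).unique hΩ (h'.2.2 _ (by positivity))
  filter_upwards [h.2.1, h'.2.1, ae_all_iff.2 key] with x h1 h2 h3
  by_cases hx : w x = 0
  · rw [h1 hx, h2 hx]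
  · obtain ⟨k, hk⟩ := exists_nat_one_div_lt (abs_pos.2 hx)
    have := h3 k
    rwa [indicator_of_mem (by exact hk), indicator_of_mem (by exact hk)] at this

theorem HasTruncDeriv.truncDeriv_eq (hΩ : IsOpen Ω) (h : HasTruncDeriv Ω i w g) :
    truncDeriv Ω i w =ᵐ[vol Ω] g := (truncDeriv_spec ⟨g, h⟩).unique hΩ h

theorem HasTruncDeriv.congr (h : HasTruncDeriv Ω i w g) (hw : w =ᵐ[vol Ω] w') :
    HasTruncDeriv Ω i w' g := by
  refine ⟨h.1, ?_, fun ε hε => (h.2.2 ε hε).congr ?_ ?_⟩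
  · filter_upwards [h.2.1, hw] with x h1 h2 h3
    exact h1 (h2.trans h3)
  · exact hw.mono fun x hx => by simp only [hx]
  · exact hw.mono fun x hx => by simp only [indicator, mem_ofPred_eq, hx]

/-- The weak derivative is closed under dominated almost everywhere convergence. -/
theorem hasWeakDeriv_of_dominated (hΩ : IsOpen Ω) {W G : ℕ → E n → ℝ} {B : E n → ℝ}
    (hW : ∀ k, AEStronglyMeasurable (W k) (vol Ω)) (hG : ∀ k, AEStronglyMeasurable (G k) (vol Ω))
    (hB : LocallyIntegrableOn B Ω volume)
    (hWB : ∀ k, ∀ᵐ x ∂vol Ω, |W k x| ≤ B x) (hGB : ∀ k, ∀ᵐ x ∂vol Ω, |G k x| ≤ B x)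
    (hWw : ∀ᵐ x ∂vol Ω, Filter.Tendsto (fun k => W k x) Filter.atTop (nhds (w x)))
    (hGg : ∀ᵐ x ∂vol Ω, Filter.Tendsto (fun k => G k x) Filter.atTop (nhds (g x)))
    (h : ∀ k, IntegratesByParts Ω i (W k) (G k)) : HasWeakDeriv Ω i w g := by
  have li : ∀ {F : ℕ → E n → ℝ} {f : E n → ℝ}, (∀ k, AEStronglyMeasurable (F k) (vol Ω)) →
      (∀ k, ∀ᵐ x ∂vol Ω, |F k x| ≤ B x) →
      (∀ᵐ x ∂vol Ω, Filter.Tendsto (fun k => F k x) Filter.atTop (nhds (f x))) →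
      LocallyIntegrableOn f Ω volume := by
    intro F f h1 h2 h3
    have hm : AEStronglyMeasurable f (vol Ω) := aestronglyMeasurable_of_tendsto_ae _ h1 h3
    rw [locallyIntegrableOn_iff hΩ.isLocallyClosed]
    intro K hK hKc
    refine (hB.integrableOn_compact_subset hK hKc).mono' (hm.mono_measure
      (Measure.restrict_mono hK le_rfl)) (ae_restrict_of_ae_restrict_of_subset hK ?_)
    filter_upwards [ae_all_iff.2 h2, h3] with x h4 h5
    exact le_of_tendsto h5.abs (Filter.Eventually.of_forall h4)
  refine ⟨li hW hWB hWw, li hG hGB hGg, fun η h1 h2 h3 => ?_⟩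
  obtain ⟨C, hC0, hC, hC'⟩ := exists_bound_of_test h1 h2 (EuclideanSpace.single i 1)
  have hd : ∀ x, x ∉ tsupport η → fderiv ℝ η x (EuclideanSpace.single i 1) = 0 :=
    fun x hx => fderiv_eq_zero_of_notMem_tsupport hx
  have hη : ∀ x, x ∉ tsupport η → η x = 0 := fun x hx => image_eq_zero_of_notMem_tsupport hx
  have BI : IntegrableOn B (tsupport η) := hB.integrableOn_compact_subset h3 h2
  have lim : ∀ {F : ℕ → E n → ℝ} {f ζ : E n → ℝ}, (∀ k, AEStronglyMeasurable (F k) (vol Ω)) →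
      (∀ k, ∀ᵐ x ∂vol Ω, |F k x| ≤ B x) →
      (∀ᵐ x ∂vol Ω, Filter.Tendsto (fun k => F k x) Filter.atTop (nhds (f x))) →
      Continuous ζ → (∀ x, |ζ x| ≤ C) →
      Filter.Tendsto (fun k => ∫ x in tsupport η, F k x * ζ x) Filter.atTop
        (nhds (∫ x in tsupport η, f x * ζ x)) := by
    intro F f ζ h4 h5 h6 h7 h8
    refine tendsto_integral_of_dominated_convergence (fun x => B x * C) (fun k => ?_)
      (BI.mul_const C) (fun k => ?_) ?_
    · exact ((h4 k).mono_measure (Measure.restrict_mono h3 le_rfl)).mul h7.aestronglyMeasurable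
    · refine ae_restrict_of_ae_restrict_of_subset h3 ((h5 k).mono fun x hx => ?_)
      rw [Real.norm_eq_abs, abs_mul]
      exact mul_le_mul hx (h8 x) (abs_nonneg _) ((abs_nonneg _).trans hx)
    · exact ae_restrict_of_ae_restrict_of_subset h3 (h6.mono fun x hx => hx.mul_const _)
  have l1 := lim hW hWB hWw (continuous_fderiv_test h1 (EuclideanSpace.single i 1)) hC'
  have l2 := lim hG hGB hGg h1.continuous hC
  rw [integral_test_eq hΩ h3 hd, integral_test_eq hΩ h3 hη]
  refine tendsto_nhds_unique l1 ?_
  refine l2.neg.congr fun k => ?_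
  have := h k η h1 h2 h3
  rw [integral_test_eq hΩ h3 hd, integral_test_eq hΩ h3 hη] at this
  exact this.symm

end

section

variable {n : ℕ} {Ω : Set (E n)} {i : Fin n} {w g : E n → ℝ}

/-! ### Mollification -/

/-- The mollification of `f` by a normalized bump function. -/
noncomputable def mollify (ρ : ContDiffBump (0 : E n)) (f : E n → ℝ) : E n → ℝ :=
  convolution (ρ.normed volume) f (ContinuousLinearMap.lsmul ℝ ℝ) volume

theorem continuous_mollify (ρ : ContDiffBump (0 : E n)) {f : E n → ℝ}
    (hf : LocallyIntegrable f) : Continuous (mollify ρ f) :=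
  (ρ.hasCompactSupport_normed (μ := volume)).continuous_convolution_left _ ρ.continuous_normed hf

/-- Pointwise `|ρ * f| ≤ ρ * |f|`, and convolution with a kernel of mass one preserves the integral.
-/
theorem integral_abs_mollify_le (ρ : ContDiffBump (0 : E n)) {f : E n → ℝ} (hf : Integrable f) :
    Integrable (mollify ρ f) ∧ ∫ x, |mollify ρ f x| ≤ ∫ x, |f x| := by
  have hρ : Integrable (ρ.normed volume) := ρ.integrable_normed
  have h1 : Integrable (mollify ρ f) := hρ.integrable_convolution _ hf
  have h2 : Integrable (mollify ρ fun x => |f x|) := hρ.integrable_convolution _ hf.abs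
  refine ⟨h1, (integral_mono h1.abs h2 fun x => ?_).trans_eq ?_⟩
  · simp only [mollify, convolution_def, ContinuousLinearMap.lsmul_apply, smul_eq_mul]
    refine (abs_integral_le_integral_abs).trans_eq (integral_congr_ae ?_)
    refine Filter.Eventually.of_forall fun t => ?_
    simp only [abs_mul, abs_of_nonneg (ρ.nonneg_normed t)]
  · have := integral_convolution (ContinuousLinearMap.lsmul ℝ ℝ) hρ hf.abs
    rw [ρ.integral_normed] at this
    simpa [mollify] using this

/-- Almost everywhere convergence together with non-increasing `L¹` norms forces convergence in
`L¹`. With `f_k` the mollification, `D k = |f| + |f_k| - |f_k - f|` lies between `0` and `2 |f|` and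
tends to `2 |f|`, so dominated convergence applies although `f_k` itself has no integrable majorant
at hand. -/
theorem tendsto_integral_abs_mollify_sub {ρ : ℕ → ContDiffBump (0 : E n)} {f : E n → ℝ}
    (hf : Integrable f)
    (hae : ∀ᵐ x, Filter.Tendsto (fun k => mollify (ρ k) f x) Filter.atTop (nhds (f x))) :
    Filter.Tendsto (fun k => ∫ x, |mollify (ρ k) f x - f x|) Filter.atTop (nhds 0) := by
  set D : ℕ → E n → ℝ := fun k x => |f x| + |mollify (ρ k) f x| - |mollify (ρ k) f x - f x|
  have hi : ∀ k, Integrable (mollify (ρ k) f) := fun k => (integral_abs_mollify_le (ρ k) hf).1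
  have hD : Filter.Tendsto (fun k => ∫ x, D k x) Filter.atTop (nhds (∫ x, 2 * |f x|)) := by
    refine tendsto_integral_of_dominated_convergence (fun x => 2 * |f x|) (fun k => ?_)
      (hf.abs.const_mul 2) (fun k => Filter.Eventually.of_forall fun x => ?_) ?_
    · exact ((hf.abs.add (hi k).abs).sub ((hi k).sub hf).abs).aestronglyMeasurable
    · simp only [D, Real.norm_eq_abs]
      rw [abs_le]
      have h1 := abs_sub_abs_le_abs_sub (mollify (ρ k) f x) (f x)
      have h2 := abs_sub (mollify (ρ k) f x) (f x)
      constructor <;> linarith [abs_nonneg (f x)]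
    · filter_upwards [hae] with x hx
      have := ((hx.abs).const_add |f x|).sub ((hx.sub_const (f x)).abs)
      simpa [D, two_mul] using this
  have hb : ∀ k, ∫ x, |mollify (ρ k) f x - f x| ≤ (∫ x, 2 * |f x|) - ∫ x, D k x := by
    intro k
    have h1 : ∫ x, D k x = (∫ x, |f x|) + (∫ x, |mollify (ρ k) f x|) -
        ∫ x, |mollify (ρ k) f x - f x| := by
      have h2 := integral_sub (hf.abs.add (hi k).abs) ((hi k).sub hf).abs
      have h3 := integral_add hf.abs (hi k).abs
      exact h2.trans (congrArg (· - ∫ x, |mollify (ρ k) f x - f x|) h3)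
    rw [h1, integral_const_mul]
    linarith [(integral_abs_mollify_le (ρ k) hf).2]
  refine tendsto_of_tendsto_of_tendsto_of_le_of_le tendsto_const_nhds ?_
    (fun k => integral_nonneg fun x => abs_nonneg _) hb
  simpa using hD.const_sub (∫ x, 2 * |f x|)

/-- The derivative falls on the kernel. Since the ball of radius `ρ.rOut` about `x` lies in `K`, the
function `t ↦ ρ (x - t)` is a test function on `Ω`, and the definition of the weak derivative moves
the derivative onto `w`. The indicator of `K` makes the data globally integrable without changing
these values. -/
theorem hasFDerivAt_mollify (hΩ : IsOpen Ω) (h : HasWeakDeriv Ω i w g) {K : Set (E n)}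
    (hK : IsCompact K) (hKΩ : K ⊆ Ω) (ρ : ContDiffBump (0 : E n)) {x : E n}
    (hx : Metric.closedBall x ρ.rOut ⊆ K) :
    DifferentiableAt ℝ (mollify ρ (indicator K w)) x ∧
      fderiv ℝ (mollify ρ (indicator K w)) x (EuclideanSpace.single i 1) =
        mollify ρ (indicator K g) x := by
  have hwi : Integrable (indicator K w) :=
    (integrable_indicator_iff hK.measurableSet).2 (h.1.integrableOn_compact_subset hKΩ hK)
  have hd := (ρ.hasCompactSupport_normed (μ := volume)).hasFDerivAt_convolution_left
    (ContinuousLinearMap.lsmul ℝ ℝ) (ρ.contDiff_normed (n := 1)) hwi.locallyIntegrable x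
  refine ⟨hd.differentiableAt, ?_⟩
  rw [show fderiv ℝ (mollify ρ (indicator K w)) x = _ from hd.fderiv]
  set η : E n → ℝ := fun t => ρ.normed volume (x - t) with hη
  have hηc : ContDiff ℝ ∞ η := (ρ.contDiff_normed (n := ⊤)).comp (contDiff_const.sub contDiff_id)
  have hηs : Function.support η ⊆ Metric.closedBall x ρ.rOut := by
    intro t ht
    have : x - t ∈ Function.support (ρ.normed volume) := ht
    rw [ρ.support_normed_eq, mem_ball_zero_iff] at this
    rw [Metric.mem_closedBall, dist_comm, dist_eq_norm]
    exact this.le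
  have hηt : tsupport η ⊆ Metric.closedBall x ρ.rOut :=
    closure_minimal hηs Metric.isClosed_closedBall
  have hηcs : HasCompactSupport η :=
    (isCompact_closedBall x ρ.rOut).of_isClosed_subset (isClosed_tsupport _) hηt
  have hfd : ∀ t, fderiv ℝ η t = -fderiv ℝ (ρ.normed volume) (x - t) := by
    intro t
    have h1 : HasFDerivAt (ρ.normed volume) (fderiv ℝ (ρ.normed volume) (x - t)) (x - t) :=
      ((ρ.contDiff_normed (n := 1)).differentiable (by simp) _).hasFDerivAt
    have h2 : HasFDerivAt (fun t : E n => x - t) (-ContinuousLinearMap.id ℝ (E n)) t :=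
      (hasFDerivAt_id t).const_sub x
    have := h1.comp t h2
    rw [show fderiv ℝ η t = _ from this.fderiv]
    ext v; simp
  have hint : ∀ {f ζ : E n → ℝ}, (∀ t, t ∉ tsupport η → ζ t = 0) →
      ∫ t, ζ t * indicator K f t = ∫ t in Ω, f t * ζ t := by
    intro f ζ hζ
    rw [integral_test_eq (f := f) (η := ζ) hΩ hKΩ fun t ht => hζ t fun h' => ht (hx (hηt h')),
      ← integral_indicator hK.measurableSet]
    congr 1
    ext t
    by_cases ht : t ∈ K
    · simp [ht, mul_comm]
    · simp [ht]
  have e := h.2.2 η hηc hηcs (hηt.trans (hx.trans hKΩ))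
  rw [← hint (fun t ht => fderiv_eq_zero_of_notMem_tsupport ht),
    ← hint (fun t ht => image_eq_zero_of_notMem_tsupport ht)] at e
  have hce : ConvolutionExistsAt (fderiv ℝ (ρ.normed volume)) (indicator K w) x
      (ContinuousLinearMap.precompL (E n) (ContinuousLinearMap.lsmul ℝ ℝ)) volume :=
    ((ρ.hasCompactSupport_normed (μ := volume)).fderiv (𝕜 := ℝ)).convolutionExists_left _
      ((ρ.contDiff_normed (n := 1)).continuous_fderiv (by simp)) hwi.locallyIntegrable x
  rw [convolution_eq_swap, ContinuousLinearMap.integral_apply hce.integrable_swap]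
  simp only [ContinuousLinearMap.precompL_apply, ContinuousLinearMap.lsmul_apply, smul_eq_mul]
  rw [mollify, convolution_eq_swap]
  simp only [ContinuousLinearMap.lsmul_apply, smul_eq_mul]
  simp only [hfd, neg_apply, neg_mul, integral_neg, neg_inj] at e
  exact e

theorem exists_smooth_approximation (hΩ : IsOpen Ω) (h : HasWeakDeriv Ω i w g) {K : Set (E n)}
    (hK : IsCompact K) (hKΩ : K ⊆ Ω) :
    ∃ W G : ℕ → E n → ℝ, (∀ k, Continuous (W k)) ∧ (∀ k, Continuous (G k)) ∧
      (∀ k, ∀ x ∈ K, DifferentiableAt ℝ (W k) x ∧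
        fderiv ℝ (W k) x (EuclideanSpace.single i 1) = G k x) ∧
      (∀ᵐ x ∂volume.restrict K, Filter.Tendsto (fun k => W k x) Filter.atTop (nhds (w x))) ∧
      Filter.Tendsto (fun k => ∫ x in K, |G k x - g x|) Filter.atTop (nhds 0) := by
  obtain ⟨δ, hδ, hsub⟩ := hK.exists_cthickening_subset_open hΩ hKΩ
  set K' := Metric.cthickening δ K
  have hK' : IsCompact K' := hK.cthickening
  have hKK' : K ⊆ K' := Metric.self_subset_cthickening K
  -- Outer radii at most `δ` keep all balls centred in `K` inside `K'`. The bounded ratio of outer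
  -- to inner radius is what the Lebesgue differentiation argument for almost everywhere convergence
  -- needs.
  set ρ : ℕ → ContDiffBump (0 : E n) := fun k =>
    ⟨δ / (k + 1) / 2, δ / (k + 1), by positivity, half_lt_self (by positivity)⟩ with hρ
  have hρt : Filter.Tendsto (fun k => (ρ k).rOut) Filter.atTop (nhds 0) := by
    have := (tendsto_one_div_add_atTop_nhds_zero_nat (𝕜 := ℝ)).const_mul δ
    simpa [hρ, div_eq_mul_inv] using this
  have hρr : ∀ᶠ k in Filter.atTop, (ρ k).rOut ≤ 2 * (ρ k).rIn :=
    Filter.Eventually.of_forall fun k => by simp only [hρ]; linarith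
  have hi : ∀ {f : E n → ℝ}, LocallyIntegrableOn f Ω volume → Integrable (indicator K' f) :=
    fun hf => (integrable_indicator_iff hK'.measurableSet).2 (hf.integrableOn_compact_subset hsub hK')
  have hae : ∀ {f : E n → ℝ}, LocallyIntegrableOn f Ω volume → ∀ᵐ x : E n,
      Filter.Tendsto (fun k => mollify (ρ k) (indicator K' f) x) Filter.atTop
        (nhds (indicator K' f x)) := fun hf =>
    ContDiffBump.ae_convolution_tendsto_right_of_locallyIntegrable hρt hρr (hi hf).locallyIntegrable
  refine ⟨fun k => mollify (ρ k) (indicator K' w), fun k => mollify (ρ k) (indicator K' g),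
    fun k => continuous_mollify _ (hi h.1).locallyIntegrable,
    fun k => continuous_mollify _ (hi h.2.1).locallyIntegrable, fun k x hx =>
    hasFDerivAt_mollify hΩ h hK' hsub (ρ k) ?_, ?_, ?_⟩
  · refine (Metric.closedBall_subset_closedBall ?_).trans
      (Metric.closedBall_subset_cthickening hx δ)
    exact div_le_self hδ.le (by linarith [(Nat.cast_nonneg k : (0 : ℝ) ≤ k)])
  · rw [ae_restrict_iff' hK.measurableSet]
    filter_upwards [hae h.1] with x hx hxK
    rwa [indicator_of_mem (hKK' hxK)] at hx
  · refine tendsto_of_tendsto_of_tendsto_of_le_of_le tendsto_const_nhds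
      (tendsto_integral_abs_mollify_sub (hi h.2.1) (hae h.2.1))
      (fun k => integral_nonneg fun x => abs_nonneg _) fun k => ?_
    have h1 : Integrable fun x => |mollify (ρ k) (indicator K' g) x - indicator K' g x| :=
      ((integral_abs_mollify_le (ρ k) (hi h.2.1)).1.sub (hi h.2.1)).abs
    refine le_trans (le_of_eq ?_) (setIntegral_le_integral (s := K) h1
      (Filter.Eventually.of_forall fun x => abs_nonneg _))
    refine setIntegral_congr_fun hK.measurableSet fun x hx => ?_
    simp only [indicator_of_mem (hKK' hx)]

end

section

variable {n : ℕ} {Ω : Set (E n)} {i : Fin n} {w g : E n → ℝ}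

/-! ### The chain rule -/

/-- `F(x, t)` has the partial derivatives `F₁`, `F₂`, and they are jointly continuous, for
`x ∈ Ω` and `t ∈ ℝ`. -/
structure IsC1Param (Ω : Set (E n)) (F : E n → ℝ → ℝ) (F₁ : E n → ℝ → E n →L[ℝ] ℝ)
    (F₂ : E n → ℝ → ℝ) : Prop where
  hasFDerivAt : ∀ x ∈ Ω, ∀ t, HasFDerivAt (fun y => F y t) (F₁ x t) x
  hasDerivAt : ∀ x ∈ Ω, ∀ t, HasDerivAt (F x) (F₂ x t) t
  continuousOn_fst : ContinuousOn (Function.uncurry F₁) (Ω ×ˢ univ)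
  continuousOn_snd : ContinuousOn (Function.uncurry F₂) (Ω ×ˢ univ)

variable {F : E n → ℝ → ℝ} {F₁ : E n → ℝ → E n →L[ℝ] ℝ} {F₂ : E n → ℝ → ℝ}

theorem IsC1Param.hasFDerivAt_uncurry (hΩ : IsOpen Ω) (hF : IsC1Param Ω F F₁ F₂) {x : E n}
    (hx : x ∈ Ω) (t : ℝ) : HasFDerivAt (Function.uncurry F)
      ((F₁ x t).coprod (ContinuousLinearMap.toSpanSingleton ℝ (F₂ x t))) (x, t) := by
  have hU : Ω ×ˢ (univ : Set ℝ) ∈ nhds (x, t) := (hΩ.prod isOpen_univ).mem_nhds ⟨hx, mem_univ t⟩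
  refine (hasStrictFDerivAt_uncurry_coprod (𝕜 := ℝ) (u := (x, t)) (f := F) (f₁ := F₁)
    (f₂ := fun x t => ContinuousLinearMap.toSpanSingleton ℝ (F₂ x t)) ?_ ?_ ?_ ?_).hasFDerivAt
  · filter_upwards [hU] with v hv using hF.hasFDerivAt v.1 hv.1 v.2
  · filter_upwards [hU] with v hv using (hF.hasDerivAt v.1 hv.1 v.2).hasFDerivAt
  · exact hF.continuousOn_fst.continuousAt hU
  · have h := hF.continuousOn_snd.continuousAt hU
    exact (ContinuousLinearMap.toSpanSingletonCLE (𝕜 := ℝ) (E := ℝ)).continuous.continuousAt.comp h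

theorem IsC1Param.continuousOn (hΩ : IsOpen Ω) (hF : IsC1Param Ω F F₁ F₂) :
    ContinuousOn (Function.uncurry F) (Ω ×ˢ univ) := fun p hp =>
  (hF.hasFDerivAt_uncurry hΩ (x := p.1) hp.1 p.2).continuousAt.continuousWithinAt

theorem aestronglyMeasurable_comp_of_continuousOn (hΩ : IsOpen Ω) {H : E n → ℝ → ℝ}
    (hH : ContinuousOn (Function.uncurry H) (Ω ×ˢ univ)) (hw : AEStronglyMeasurable w (vol Ω)) :
    AEStronglyMeasurable (fun x => H x (w x)) (vol Ω) := by
  have hm : Measurable (indicator (Ω ×ˢ (univ : Set ℝ)) (Function.uncurry H)) := by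
    classical
    rw [← piecewise_eq_indicator]
    exact hH.measurable_piecewise continuousOn_const
      (hΩ.prod isOpen_univ).measurableSet
  have h1 : AEMeasurable (fun x => (x, w x)) (vol Ω) := aemeasurable_id.prodMk hw.aemeasurable
  refine (hm.comp_aemeasurable h1).aestronglyMeasurable.congr ?_
  rw [Filter.EventuallyEq, vol, ae_restrict_iff' hΩ.measurableSet]
  refine Filter.Eventually.of_forall fun x hx => ?_
  simp [Function.uncurry, indicator, hx]

theorem tendsto_comp_of_continuousOn (hΩ : IsOpen Ω) {H : E n → ℝ → ℝ}
    (hH : ContinuousOn (Function.uncurry H) (Ω ×ˢ univ)) {x : E n} (hx : x ∈ Ω) {s : ℕ → ℝ} {t : ℝ}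
    (hs : Filter.Tendsto s Filter.atTop (nhds t)) :
    Filter.Tendsto (fun k => H x (s k)) Filter.atTop (nhds (H x t)) := by
  have hU : Ω ×ˢ (univ : Set ℝ) ∈ nhds (x, t) := (hΩ.prod isOpen_univ).mem_nhds ⟨hx, mem_univ t⟩
  have h : ContinuousAt (Function.uncurry H) (x, t) := hH.continuousAt hU
  exact h.tendsto.comp (tendsto_const_nhds.prodMk_nhds hs)

theorem IsC1Param.continuousOn_apply (hF : IsC1Param Ω F F₁ F₂) (v : E n) :
    ContinuousOn (Function.uncurry fun x t => F₁ x t v) (Ω ×ˢ univ) :=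
  hF.continuousOn_fst.clm_apply continuousOn_const

theorem integratesByParts_comp_smooth (hΩ : IsOpen Ω) (hF : IsC1Param Ω F F₁ F₂)
    {W : E n → ℝ} (hW : Continuous W) {G : E n → ℝ} (hG : Continuous G) {η : E n → ℝ}
    (h1 : ContDiff ℝ ∞ η) (h2 : HasCompactSupport η) (h3 : tsupport η ⊆ Ω)
    (hWG : ∀ x ∈ tsupport η, DifferentiableAt ℝ W x ∧
      fderiv ℝ W x (EuclideanSpace.single i 1) = G x) :
    ∫ x in tsupport η, F x (W x) * fderiv ℝ η x (EuclideanSpace.single i 1) =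
      -∫ x in tsupport η, (F₁ x (W x) (EuclideanSpace.single i 1) + F₂ x (W x) * G x) * η x := by
  set e : E n := EuclideanSpace.single i 1
  have hd : ∀ x, x ∉ tsupport η → fderiv ℝ η x e = 0 :=
    fun x hx => fderiv_eq_zero_of_notMem_tsupport hx
  have hη : ∀ x, x ∉ tsupport η → η x = 0 := fun x hx => image_eq_zero_of_notMem_tsupport hx
  have hder : ∀ x ∈ tsupport η, HasFDerivAt (fun y => F y (W y))
      (((F₁ x (W x)).coprod (ContinuousLinearMap.toSpanSingleton ℝ (F₂ x (W x)))).comp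
        ((ContinuousLinearMap.id ℝ (E n)).prod (fderiv ℝ W x))) x := fun x hx =>
    HasFDerivAt.comp (g := Function.uncurry F) x (hF.hasFDerivAt_uncurry hΩ (h3 hx) (W x))
      ((hasFDerivAt_id x).prodMk (hWG x hx).1.hasFDerivAt)
  have hval : ∀ x ∈ tsupport η, fderiv ℝ (fun y => F y (W y)) x e =
      F₁ x (W x) e + F₂ x (W x) * G x := by
    intro x hx
    rw [(hder x hx).fderiv]
    simp [(hWG x hx).2, mul_comm, e]
  have hcomp : ∀ {H : E n → ℝ → ℝ}, ContinuousOn (Function.uncurry H) (Ω ×ˢ univ) →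
      ContinuousOn (fun x => H x (W x)) (tsupport η) := by
    intro H hH
    exact hH.comp (f := fun x => (x, W x)) (by fun_prop) fun x hx => ⟨h3 hx, mem_univ _⟩
  have c0 := hcomp (hF.continuousOn hΩ)
  have c1 : ContinuousOn (fun x => F₁ x (W x) e + F₂ x (W x) * G x) (tsupport η) :=
    (hcomp (hF.continuousOn_apply e)).add
      ((hcomp hF.continuousOn_snd).mul hG.continuousOn)
  have hint : ∀ {f : E n → ℝ}, ContinuousOn f (tsupport η) → (∀ x, x ∉ tsupport η → f x = 0) →
      Integrable f := fun hf h0 =>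
    (hf.integrableOn_compact h2).integrable_of_forall_notMem_eq_zero h0
  -- Off the support of `η` nothing is known about the derivative of `F y (W y)`, but there the
  -- factor `η` vanishes.
  have e1 : (fun x => fderiv ℝ (fun y => F y (W y)) x e * η x) =
      fun x => (F₁ x (W x) e + F₂ x (W x) * G x) * η x := by
    ext x
    by_cases hx : x ∈ tsupport η
    · rw [hval x hx]
    · rw [hη x hx, mul_zero, mul_zero]
  have key := integral_mul_fderiv_eq_neg_fderiv_mul_of_integrable (μ := volume) (v := e)
    (f := fun y => F y (W y)) (g := η)
    (by
      rw [e1]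
      exact hint (c1.mul h1.continuous.continuousOn) fun x hx => by rw [hη x hx, mul_zero])
    (hint (c0.mul (continuous_fderiv_test h1 e).continuousOn)
      fun x hx => by rw [hd x hx, mul_zero])
    (hint (c0.mul h1.continuous.continuousOn) fun x hx => by rw [hη x hx, mul_zero])
    (fun x hx => (hder x hx).differentiableAt)
    (fun x _ => h1.differentiable (by simp) x)
  rw [e1] at key
  rw [setIntegral_eq_integral_of_forall_compl_eq_zero fun x hx => by rw [hd x hx, mul_zero],
    setIntegral_eq_integral_of_forall_compl_eq_zero fun x hx => by rw [hη x hx, mul_zero]]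
  exact key

/-- The classical formula holds for smooth approximations `W k` of `w`. Boundedness of `F` and its
partial derivatives, uniformly in `t`, lets all terms pass to the limit although `W k` converges
only almost everywhere and `G k` only in `L¹`. -/
theorem HasWeakDeriv.integratesByParts_comp_of_bounded (hΩ : IsOpen Ω)
    (hF : IsC1Param Ω F F₁ F₂) (h : HasWeakDeriv Ω i w g)
    (hb : ∀ K ⊆ Ω, IsCompact K → ∃ C, ∀ x ∈ K, ∀ t,
      |F x t| ≤ C ∧ |F₁ x t (EuclideanSpace.single i 1)| ≤ C ∧ |F₂ x t| ≤ C) :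
    IntegratesByParts Ω i (fun x => F x (w x))
      (fun x => F₁ x (w x) (EuclideanSpace.single i 1) + F₂ x (w x) * g x) := by
  intro η h1 h2 h3
  set e : E n := EuclideanSpace.single i 1
  have hd : ∀ x, x ∉ tsupport η → fderiv ℝ η x e = 0 :=
    fun x hx => fderiv_eq_zero_of_notMem_tsupport hx
  have hη : ∀ x, x ∉ tsupport η → η x = 0 := fun x hx => image_eq_zero_of_notMem_tsupport hx
  obtain ⟨A, hA0, hA, hA'⟩ := exists_bound_of_test h1 h2 e
  obtain ⟨C, hC⟩ := hb _ h3 h2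
  obtain ⟨W, G, hWc, hGc, hWG, hWw, hGg⟩ := exists_smooth_approximation hΩ h h2 h3
  have hKm : MeasurableSet (tsupport η) := (isClosed_tsupport η).measurableSet
  have hfin : IsFiniteMeasure (volume.restrict (tsupport η)) :=
    ⟨by rw [Measure.restrict_apply_univ]; exact IsCompact.measure_lt_top h2⟩
  have hae : ∀ᵐ x ∂volume.restrict (tsupport η), x ∈ tsupport η := ae_restrict_mem hKm
  have gi : IntegrableOn g (tsupport η) := h.2.1.integrableOn_compact_subset h3 h2
  rw [integral_test_eq hΩ h3 hd, integral_test_eq hΩ h3 hη]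
  have hmW : ∀ {H : E n → ℝ → ℝ}, ContinuousOn (Function.uncurry H) (Ω ×ˢ univ) →
      ∀ {u : E n → ℝ}, AEStronglyMeasurable u (vol Ω) →
      AEStronglyMeasurable (fun x => H x (u x)) (volume.restrict (tsupport η)) := fun hH _ hu =>
    (aestronglyMeasurable_comp_of_continuousOn hΩ hH hu).mono_measure
      (Measure.restrict_mono h3 le_rfl)
  have c0 := hF.continuousOn hΩ
  have c1 := hF.continuousOn_apply e
  have c2 := hF.continuousOn_snd
  have lim : ∀ {H : E n → ℝ → ℝ} {f ζ : E n → ℝ}, ContinuousOn (Function.uncurry H) (Ω ×ˢ univ) →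
      (∀ x ∈ tsupport η, ∀ t, |H x t| ≤ C) → IntegrableOn f (tsupport η) →
      Continuous ζ → (∀ x, |ζ x| ≤ A) →
      Filter.Tendsto (fun k => ∫ x in tsupport η, H x (W k x) * f x * ζ x) Filter.atTop
        (nhds (∫ x in tsupport η, H x (w x) * f x * ζ x)) := by
    intro H f ζ hH hHC hf hζ hζA
    refine tendsto_integral_of_dominated_convergence (fun x => C * |f x| * A) (fun k => ?_)
      ((hf.abs.const_mul C).mul_const A) (fun k => ?_) ?_
    · exact ((hmW hH (hWc k).aestronglyMeasurable).mul hf.aestronglyMeasurable).mul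
        hζ.aestronglyMeasurable
    · filter_upwards [hae] with x hx
      rw [Real.norm_eq_abs, abs_mul, abs_mul]
      have hC0 : 0 ≤ C := (abs_nonneg _).trans (hHC x hx 0)
      have := hHC x hx (W k x)
      have := hζA x
      gcongr
    · filter_upwards [hae, hWw] with x hx hx'
      exact ((tendsto_comp_of_continuousOn hΩ hH (h3 hx) hx').mul_const _).mul_const _
  have l0 := lim (f := fun _ => 1) c0 (fun x hx t => (hC x hx t).1) (integrable_const 1)
    (continuous_fderiv_test h1 e) hA'
  have l1 := lim (f := fun _ => 1) c1 (fun x hx t => (hC x hx t).2.1) (integrable_const 1)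
    h1.continuous hA
  have l2 := lim c2 (fun x hx t => (hC x hx t).2.2) gi h1.continuous hA
  have Gi : ∀ k, IntegrableOn (G k) (tsupport η) := fun k =>
    (hGc k).continuousOn.integrableOn_compact h2
  have hi : ∀ {H : E n → ℝ → ℝ} {f u : E n → ℝ}, ContinuousOn (Function.uncurry H) (Ω ×ˢ univ) →
      (∀ x ∈ tsupport η, ∀ t, |H x t| ≤ C) → IntegrableOn f (tsupport η) →
      AEStronglyMeasurable u (vol Ω) →
      IntegrableOn (fun x => H x (u x) * f x * η x) (tsupport η) := by
    intro H f u hH hHC hf hu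
    refine integrableOn_mul_test ?_ h1.continuous hA
    exact hf.bdd_mul (c := C) (hmW hH hu) (hae.mono fun x hx => hHC x hx _)
  -- In `F₂ x (W k x) * G k x` both factors vary with `k`. Replacing `G k` by `g` costs at most `C *
  -- A` times the `L¹` distance of `G k` and `g`; the term with `g` is handled by dominated
  -- convergence in `l2`.
  have l3 : Filter.Tendsto (fun k => ∫ x in tsupport η, F₂ x (W k x) * (G k x - g x) * η x)
      Filter.atTop (nhds 0) := by
    have h0 : Filter.Tendsto (fun k => (C * A) * ∫ x in tsupport η, |G k x - g x|)
        Filter.atTop (nhds 0) := by simpa using hGg.const_mul (C * A)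
    refine squeeze_zero_norm (fun k => ?_) h0
    rw [← integral_const_mul]
    refine norm_integral_le_of_norm_le ((((Gi k).sub gi).abs).const_mul _) ?_
    filter_upwards [hae] with x hx
    rw [Real.norm_eq_abs, abs_mul, abs_mul]
    have hC0 : 0 ≤ C := (abs_nonneg _).trans (hC x hx 0).1
    calc |F₂ x (W k x)| * |G k x - g x| * |η x| ≤ C * |G k x - g x| * A := by
          have := (hC x hx (W k x)).2.2
          have := hA x
          gcongr
      _ = C * A * |G k x - g x| := by ring
  have wm : AEStronglyMeasurable w (vol Ω) := h.1.aestronglyMeasurable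
  have hsplit : ∫ x in tsupport η, (F₁ x (w x) e + F₂ x (w x) * g x) * η x =
      (∫ x in tsupport η, F₁ x (w x) e * 1 * η x) +
        ∫ x in tsupport η, F₂ x (w x) * g x * η x := by
    rw [← integral_add (hi (f := fun _ => 1) c1 (fun x hx t => (hC x hx t).2.1)
      (integrable_const 1) wm) (hi c2 (fun x hx t => (hC x hx t).2.2) gi wm)]
    congr 1
    ext x; ring
  have hsplitk : ∀ k, ∫ x in tsupport η, (F₁ x (W k x) e + F₂ x (W k x) * G k x) * η x =
      (∫ x in tsupport η, F₁ x (W k x) e * 1 * η x) +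
        ((∫ x in tsupport η, F₂ x (W k x) * g x * η x) +
        ∫ x in tsupport η, F₂ x (W k x) * (G k x - g x) * η x) := by
    intro k
    have Wm : AEStronglyMeasurable (W k) (vol Ω) := (hWc k).aestronglyMeasurable
    have i1 := hi (f := fun _ => 1) c1 (fun x hx t => (hC x hx t).2.1) (integrable_const 1) Wm
    have i2 := hi c2 (fun x hx t => (hC x hx t).2.2) gi Wm
    have i3 := hi c2 (fun x hx t => (hC x hx t).2.2) ((Gi k).sub gi) Wm
    simp only [Pi.sub_apply] at i3
    refine Eq.trans ?_ ((integral_add i1 (i2.add i3)).trans (congrArg _ (integral_add i2 i3)))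
    congr 1
    ext x
    simp only [Pi.add_apply]
    ring
  simp only [mul_one] at l0 l1 hsplit hsplitk
  rw [hsplit]
  refine tendsto_nhds_unique l0 ?_
  have l4 := (l1.add (l2.add l3)).neg
  rw [add_zero] at l4
  refine l4.congr fun k => ?_
  rw [integratesByParts_comp_smooth hΩ hF (hWc k) (hGc k) h1 h2 h3 (hWG k), hsplitk k]

/-- A smooth bounded increasing function with slope at most one, which approximates the identity
when `N` is large. -/
noncomputable def softClamp (N t : ℝ) : ℝ := N * Real.arctan (t / N)

theorem hasDerivAt_softClamp {N : ℝ} (hN : 0 < N) (t : ℝ) :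
    HasDerivAt (softClamp N) (1 / (1 + (t / N) ^ 2)) t := by
  have := (((hasDerivAt_id t).div_const N).arctan).const_mul N
  refine this.congr_deriv ?_
  have := hN.ne'
  simp only [id_eq]
  field_simp

theorem abs_softClamp_le {N : ℝ} (hN : 0 < N) (t : ℝ) : |softClamp N t| ≤ |t| := by
  have h : ∀ s : ℝ, 0 ≤ s → softClamp N s ≤ s := by
    intro s hs
    have : Real.arctan (s / N) ≤ s / N := by
      have h1 := Real.le_tan (Real.arctan_nonneg.2 (by positivity : 0 ≤ s / N))
        (Real.arctan_lt_pi_div_two _)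
      rwa [Real.tan_arctan] at h1
    calc softClamp N s ≤ N * (s / N) := mul_le_mul_of_nonneg_left this hN.le
      _ = s := by field_simp
  have h0 : ∀ s : ℝ, 0 ≤ s → 0 ≤ softClamp N s := fun s hs =>
    mul_nonneg hN.le (Real.arctan_nonneg.2 (by positivity))
  have hneg : softClamp N (-t) = -softClamp N t := by
    simp [softClamp, neg_div, Real.arctan_neg]
  rcases le_total 0 t with ht | ht
  · rw [abs_of_nonneg ht, abs_of_nonneg (h0 t ht)]
    exact h t ht
  · rw [← abs_neg, ← hneg, abs_of_nonneg (h0 _ (by linarith)), abs_of_nonpos ht]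
    exact h _ (by linarith)

theorem abs_softClamp_le_two_mul {N : ℝ} (hN : 0 < N) (t : ℝ) : |softClamp N t| ≤ 2 * N := by
  rw [softClamp, abs_mul, abs_of_pos hN, mul_comm]
  refine mul_le_mul_of_nonneg_right ?_ hN.le
  rw [abs_le]
  constructor <;> linarith [Real.neg_pi_div_two_lt_arctan (t / N), Real.arctan_lt_pi_div_two (t / N),
    Real.pi_le_four]

theorem tendsto_deriv_softClamp (t : ℝ) :
    Filter.Tendsto (fun k : ℕ => 1 / (1 + (t / ((k : ℝ) + 1)) ^ 2)) Filter.atTop (nhds 1) := by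
  have h1 : Filter.Tendsto (fun k : ℕ => t / ((k : ℝ) + 1)) Filter.atTop (nhds 0) := by
    simpa [div_eq_mul_inv] using (tendsto_one_div_add_atTop_nhds_zero_nat (𝕜 := ℝ)).const_mul t
  have h2 := ((h1.pow 2).const_add 1).inv₀ (by norm_num)
  simpa using h2

/-- With `s = 1 / (k + 1)` the clamp is the difference quotient at `0` of `s ↦ arctan (s t)`, whose
derivative there is `t`. -/
theorem tendsto_softClamp (t : ℝ) :
    Filter.Tendsto (fun k : ℕ => softClamp ((k : ℝ) + 1) t) Filter.atTop (nhds t) := by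
  have h1 : Filter.Tendsto (fun k : ℕ => 1 / ((k : ℝ) + 1)) Filter.atTop (nhds 0) :=
    tendsto_one_div_add_atTop_nhds_zero_nat
  have h2 : HasDerivAt (fun s => Real.arctan (s * t)) t 0 := by
    have := ((hasDerivAt_id (0 : ℝ)).mul_const t).arctan
    simpa using this
  have h3 := h2.tendsto_slope_zero
  have h4 : Filter.Tendsto (fun k : ℕ => 1 / ((k : ℝ) + 1)) Filter.atTop (nhdsWithin 0 {0}ᶜ) :=
    tendsto_nhdsWithin_iff.2 ⟨h1, Filter.Eventually.of_forall fun k => by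
      have : (0 : ℝ) < 1 / ((k : ℝ) + 1) := by positivity
      exact this.ne'⟩
  refine (h3.comp h4).congr fun k => ?_
  simp [softClamp, div_eq_inv_mul]

/-- The chain rule for the weak derivative: `F(x, w)` has the weak derivative
`(∂ᵢF)(x, w) + (∂ₜF)(x, w) Dᵢw`, when these functions have a locally integrable bound which is
uniform in the values of smaller modulus. -/
theorem HasWeakDeriv.comp (hΩ : IsOpen Ω) (hF : IsC1Param Ω F F₁ F₂) (h : HasWeakDeriv Ω i w g)
    {B : E n → ℝ} (hB : LocallyIntegrableOn B Ω volume)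
    (hb : ∀ᵐ x ∂vol Ω, ∀ t, |t| ≤ |w x| → |F x t| ≤ B x ∧
      |F₁ x t (EuclideanSpace.single i 1)| + |F₂ x t * g x| ≤ B x) :
    HasWeakDeriv Ω i (fun x => F x (w x))
      (fun x => F₁ x (w x) (EuclideanSpace.single i 1) + F₂ x (w x) * g x) := by
  set e : E n := EuclideanSpace.single i 1
  set T : ℕ → ℝ → ℝ := fun k => softClamp ((k : ℝ) + 1) with hT
  set T' : ℕ → ℝ → ℝ := fun k t => 1 / (1 + (t / ((k : ℝ) + 1)) ^ 2) with hT'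
  have hpos : ∀ k : ℕ, (0 : ℝ) < (k : ℝ) + 1 := fun k => by positivity
  have hTd : ∀ k t, HasDerivAt (T k) (T' k t) t := fun k t => hasDerivAt_softClamp (hpos k) t
  have hTc : ∀ k, Continuous (T k) := fun k =>
    continuous_iff_continuousAt.2 fun t => (hTd k t).continuousAt
  have hT'c : ∀ k, Continuous (T' k) := fun k => by
    refine continuous_const.div (by fun_prop) fun t => by positivity
  have hT'1 : ∀ k t, |T' k t| ≤ 1 := fun k t => by
    rw [abs_of_nonneg (by positivity)]
    exact div_le_one_of_le₀ (by linarith [sq_nonneg (t / ((k : ℝ) + 1))]) (by positivity)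
  have cc : ∀ k, ContinuousOn (fun p : E n × ℝ => (p.1, T k p.2)) (Ω ×ˢ univ) := fun k =>
    (continuous_fst.prodMk ((hTc k).comp continuous_snd)).continuousOn
  have cm : ∀ k, MapsTo (fun p : E n × ℝ => (p.1, T k p.2)) (Ω ×ˢ univ) (Ω ×ˢ univ) :=
    fun k p hp => ⟨hp.1, mem_univ _⟩
  -- The clamp has bounded range, so `F x (T k t)` and its partial derivatives are bounded for `x`
  -- in a compact set and all `t`. Since `|T k t| ≤ |t|` and `|T' k t| ≤ 1`, the bound `B` serves
  -- for every `k`.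
  have hFk : ∀ k, IsC1Param Ω (fun x t => F x (T k t)) (fun x t => F₁ x (T k t))
      (fun x t => F₂ x (T k t) * T' k t) := fun k =>
    ⟨fun x hx t => hF.hasFDerivAt x hx _, fun x hx t => (hF.hasDerivAt x hx _).comp t (hTd k t),
      hF.continuousOn_fst.comp (cc k) (cm k),
      (hF.continuousOn_snd.comp (cc k) (cm k)).mul
        ((hT'c k).comp continuous_snd).continuousOn⟩
  have wm : AEStronglyMeasurable w (vol Ω) := h.1.aestronglyMeasurable
  have gm : AEStronglyMeasurable g (vol Ω) := h.2.1.aestronglyMeasurable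
  have hle : ∀ k t, |T k t| ≤ |t| := fun k t => abs_softClamp_le (hpos k) t
  refine hasWeakDeriv_of_dominated hΩ (B := B)
    (W := fun k x => F x (T k (w x)))
    (G := fun k x => F₁ x (T k (w x)) e + F₂ x (T k (w x)) * T' k (w x) * g x)
    (fun k => aestronglyMeasurable_comp_of_continuousOn hΩ
      (H := fun x t => F x (T k t)) ((hFk k).continuousOn hΩ) wm)
    (fun k => (aestronglyMeasurable_comp_of_continuousOn hΩ
      (H := fun x t => F₁ x (T k t) e) ((hFk k).continuousOn_apply e) wm).add
      ((aestronglyMeasurable_comp_of_continuousOn hΩ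
      (H := fun x t => F₂ x (T k t) * T' k t) (hFk k).continuousOn_snd wm).mul gm))
    hB (fun k => hb.mono fun x hx => (hx _ (hle k _)).1) (fun k => hb.mono fun x hx => ?_)
    ?_ ?_ (fun k => h.integratesByParts_comp_of_bounded hΩ (hFk k) ?_)
  · refine ((abs_add_le _ _).trans ?_).trans (hx _ (hle k (w x))).2
    have : |F₂ x (T k (w x)) * T' k (w x) * g x| ≤ |F₂ x (T k (w x)) * g x| := by
      rw [abs_mul, abs_mul, abs_mul, mul_right_comm]
      exact mul_le_of_le_one_right (by positivity) (hT'1 _ _)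
    linarith
  · filter_upwards [ae_restrict_mem hΩ.measurableSet] with x hx
    exact tendsto_comp_of_continuousOn hΩ (hF.continuousOn hΩ) hx (tendsto_softClamp _)
  · filter_upwards [ae_restrict_mem hΩ.measurableSet] with x hx
    have l1 := tendsto_comp_of_continuousOn hΩ (hF.continuousOn_apply e) hx (tendsto_softClamp (w x))
    have l2 := tendsto_comp_of_continuousOn hΩ hF.continuousOn_snd hx (tendsto_softClamp (w x))
    have := l1.add ((l2.mul (tendsto_deriv_softClamp (w x))).mul_const (g x))
    rwa [mul_one] at this
  · intro K hK hKc
    have hcomp : IsCompact (K ×ˢ Icc (-(2 * ((k : ℝ) + 1))) (2 * ((k : ℝ) + 1))) :=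
      hKc.prod isCompact_Icc
    have hsub : K ×ˢ Icc (-(2 * ((k : ℝ) + 1))) (2 * ((k : ℝ) + 1)) ⊆ Ω ×ˢ univ :=
      prod_mono hK (subset_univ _)
    obtain ⟨C0, h0⟩ := hcomp.exists_bound_of_continuousOn ((hF.continuousOn hΩ).mono hsub)
    obtain ⟨C1, h1⟩ := hcomp.exists_bound_of_continuousOn ((hF.continuousOn_apply e).mono hsub)
    obtain ⟨C2, h2⟩ := hcomp.exists_bound_of_continuousOn (hF.continuousOn_snd.mono hsub)
    refine ⟨max C0 (max C1 C2), fun x hx t => ?_⟩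
    have hm : (x, T k t) ∈ K ×ˢ Icc (-(2 * ((k : ℝ) + 1))) (2 * ((k : ℝ) + 1)) :=
      ⟨hx, abs_le.1 (abs_softClamp_le_two_mul (hpos k) t)⟩
    refine ⟨(h0 _ hm).trans (le_max_left _ _),
      (h1 _ hm).trans ((le_max_left _ _).trans (le_max_right _ _)), ?_⟩
    rw [abs_mul]
    refine (mul_le_of_le_one_right (abs_nonneg _) (hT'1 _ _)).trans ?_
    exact (h2 _ hm).trans ((le_max_right _ _).trans (le_max_right _ _))

end

section

variable {n : ℕ} {Ω : Set (E n)} {i : Fin n}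

/-! ### Signed powers -/

/-- The signed power `|t|^a t`. -/
noncomputable def spow (a t : ℝ) : ℝ := |t| ^ a * t

@[simp] theorem spow_zero (a : ℝ) : spow a 0 = 0 := by simp [spow]

theorem abs_spow {a : ℝ} (ha : -1 < a) (t : ℝ) : |spow a t| = |t| ^ (a + 1) := by
  rw [spow, abs_mul, abs_of_nonneg (by positivity), Real.rpow_add_one' (abs_nonneg t) (by linarith)]

theorem spow_eq_zero {a : ℝ} (ha : -1 < a) {t : ℝ} : spow a t = 0 ↔ t = 0 := by
  rw [← abs_eq_zero, abs_spow ha, Real.rpow_eq_zero (abs_nonneg t) (by linarith), abs_eq_zero]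

/-- The hypothesis on the exponents is equivalent to `(a + 1) * b + a = 0`, so the powers of `|t|`
cancel. -/
theorem spow_spow {a b : ℝ} (ha : -1 < a) (hab : (a + 1) * (b + 1) = 1) (t : ℝ) :
    spow b (spow a t) = t := by
  by_cases ht : t = 0
  · simp [ht]
  · have hpos : 0 < |t| := abs_pos.2 ht
    rw [spow, abs_spow ha, ← Real.rpow_mul hpos.le, spow, ← mul_assoc, ← Real.rpow_add hpos,
      show (a + 1) * b + a = 0 by linarith, Real.rpow_zero, one_mul]

theorem hasDerivAt_spow {a t : ℝ} (ht : t ≠ 0) : HasDerivAt (spow a) ((a + 1) * |t| ^ a) t := by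
  have hpos : 0 < |t| := abs_pos.2 ht
  have h := ((hasDerivAt_abs ht).rpow_const (p := a) (Or.inl hpos.ne')).mul (hasDerivAt_id t)
  refine h.congr_deriv ?_
  simp only [id_eq]
  have h1 : (SignType.sign t : ℝ) * t = |t| := sign_mul_self t
  have h2 : |t| ^ (a - 1) * |t| = |t| ^ a := by
    rw [← Real.rpow_add_one hpos.ne', sub_add_cancel]
  calc (SignType.sign t : ℝ) * a * |t| ^ (a - 1) * t + |t| ^ a * 1
      = a * (|t| ^ (a - 1) * (SignType.sign t * t)) + |t| ^ a := by ring
    _ = (a + 1) * |t| ^ a := by rw [h1, h2]; ring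

theorem hasDerivAt_spow_of_pos {a : ℝ} (ha : 0 < a) (t : ℝ) :
    HasDerivAt (spow a) ((a + 1) * |t| ^ a) t := by
  by_cases ht : t = 0
  · subst ht
    rw [abs_zero, Real.zero_rpow ha.ne', mul_zero, hasDerivAt_iff_tendsto_slope]
    have hc : Filter.Tendsto (fun s : ℝ => |s| ^ a) (nhdsWithin 0 {0}ᶜ) (nhds 0) := by
      have : ContinuousAt (fun s : ℝ => |s| ^ a) 0 :=
        continuous_abs.continuousAt.rpow_const (Or.inr ha.le)
      simpa [ContinuousAt, Real.zero_rpow ha.ne'] using this.tendsto.mono_left nhdsWithin_le_nhds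
    refine hc.congr' ?_
    filter_upwards [self_mem_nhdsWithin] with s hs
    have hs : s ≠ 0 := hs
    simp [slope, spow, mul_comm, hs]
  · exact hasDerivAt_spow ht

/-- `Real.log t` stands for `log |t|`, and at `t = 0` both sides vanish. This derivative is the
origin of the logarithmic term in the chain rule. -/
theorem hasDerivAt_spow_exponent (a t : ℝ) :
    HasDerivAt (fun a => spow a t) (spow a t * Real.log t) a := by
  by_cases ht : t = 0
  · subst ht; simpa using hasDerivAt_const a (0 : ℝ)
  · have h := ((Real.hasStrictDerivAt_const_rpow (abs_pos.2 ht) a).hasDerivAt).mul_const t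
    refine h.congr_deriv ?_
    rw [Real.log_abs, spow]; ring

theorem continuousAt_abs_rpow {a t : ℝ} (h : t ≠ 0 ∨ 0 < a) :
    ContinuousAt (fun p : ℝ × ℝ => |p.2| ^ p.1) (a, t) :=
  ContinuousAt.rpow continuous_snd.abs.continuousAt continuous_fst.continuousAt
    (h.imp_left fun h => by simpa using h)

theorem continuousAt_spow {a : ℝ} (ha : -1 < a) (t : ℝ) :
    ContinuousAt (fun p : ℝ × ℝ => spow p.1 p.2) (a, t) := by
  by_cases ht : t = 0
  · subst ht
    have h1 : ContinuousAt (fun p : ℝ × ℝ => |p.2| ^ (p.1 + 1)) (a, 0) :=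
      ContinuousAt.rpow continuous_snd.abs.continuousAt (by fun_prop)
        (Or.inr (by simp; linarith))
    have h2 : Filter.Tendsto (fun p : ℝ × ℝ => |p.2| ^ (p.1 + 1)) (nhds (a, 0)) (nhds 0) := by
      have := h1.tendsto
      simpa [Real.zero_rpow (show a + 1 ≠ 0 by linarith)] using this
    rw [ContinuousAt, spow_zero]
    refine squeeze_zero_norm' ?_ h2
    have : ∀ᶠ p : ℝ × ℝ in nhds (a, 0), -1 < p.1 :=
      continuous_fst.continuousAt.eventually (lt_mem_nhds ha)
    filter_upwards [this] with p hp
    rw [Real.norm_eq_abs, abs_spow hp]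
  · exact (continuousAt_abs_rpow (Or.inl ht)).mul continuous_snd.continuousAt

/-- Grouping the product as `|t| ^ a * (t log |t|)` lets the continuity of `t log |t|` absorb the
singularity of the logarithm at zero. -/
theorem continuousAt_spow_mul_log {a : ℝ} {t : ℝ} (h : t ≠ 0 ∨ 0 < a) :
    ContinuousAt (fun p : ℝ × ℝ => spow p.1 p.2 * Real.log p.2) (a, t) := by
  have h1 : ContinuousAt (fun p : ℝ × ℝ => |p.2| ^ p.1 * (p.2 * Real.log p.2)) (a, t) :=
    (continuousAt_abs_rpow h).mul
      (Real.continuous_mul_log.comp continuous_snd).continuousAt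
  simpa only [spow, mul_assoc] using h1

theorem isC1Param_spow (hΩ : IsOpen Ω) {a : E n → ℝ} (ha : ContDiffOn ℝ 1 a Ω)
    (ha0 : ∀ x ∈ Ω, 0 < a x) :
    IsC1Param Ω (fun x t => spow (a x) t) (fun x t => (spow (a x) t * Real.log t) • fderiv ℝ a x)
      (fun x t => (a x + 1) * |t| ^ a x) := by
  have hac : ContinuousOn (fun p : E n × ℝ => a p.1) (Ω ×ˢ univ) :=
    ha.continuousOn.comp continuousOn_fst fun p hp => hp.1
  have had : ContinuousOn (fun p : E n × ℝ => fderiv ℝ a p.1) (Ω ×ˢ univ) :=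
    (ha.continuousOn_fderiv_of_isOpen hΩ le_rfl).comp continuousOn_fst fun p hp => hp.1
  have hpair : ContinuousOn (fun p : E n × ℝ => (a p.1, p.2)) (Ω ×ˢ univ) :=
    hac.prodMk continuousOn_snd
  refine ⟨fun x hx t => ?_, fun x hx t => hasDerivAt_spow_of_pos (ha0 x hx) t, ?_, ?_⟩
  · have hd : HasFDerivAt a (fderiv ℝ a x) x :=
      ((ha.differentiableOn one_ne_zero).differentiableAt (hΩ.mem_nhds hx)).hasFDerivAt
    exact (hasDerivAt_spow_exponent (a x) t).comp_hasFDerivAt x hd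
  · refine ContinuousOn.smul (f := fun p : E n × ℝ => spow (a p.1) p.2 * Real.log p.2)
      (fun p hp => ?_) had
    exact ContinuousAt.comp_continuousWithinAt
      (g := fun p : ℝ × ℝ => spow p.1 p.2 * Real.log p.2) (f := fun p : E n × ℝ => (a p.1, p.2))
      (continuousAt_spow_mul_log (Or.inr (ha0 p.1 hp.1))) (hpair p hp)
  · refine (hac.add continuousOn_const).mul fun p hp => ?_
    exact ContinuousAt.comp_continuousWithinAt (g := fun p : ℝ × ℝ => |p.2| ^ p.1)
      (f := fun p : E n × ℝ => (a p.1, p.2))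
      (continuousAt_abs_rpow (Or.inr (ha0 p.1 hp.1))) (hpair p hp)

/-! ### Smooth cut-offs near zero -/

theorem cut_of_abs_le {ε t : ℝ} (h : |t| ≤ ε) : cut ε t = 0 := by
  obtain ⟨h1, h2⟩ := abs_le.1 h
  rw [cut, min_eq_left h2, max_eq_right h1, sub_self]

theorem cut_of_lt {ε t : ℝ} (hε : 0 ≤ ε) (h : ε < t) : cut ε t = t - ε := by
  rw [cut, min_eq_right h.le, max_eq_right (by linarith)]

theorem cut_of_lt_neg {ε t : ℝ} (hε : 0 ≤ ε) (h : t < -ε) : cut ε t = t + ε := by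
  rw [cut, min_eq_left (by linarith), max_eq_left h.le]
  ring

theorem abs_cut_le {ε : ℝ} (hε : 0 ≤ ε) (t : ℝ) : |cut ε t| ≤ |t| := by
  rcases le_or_gt |t| ε with h | h
  · rw [cut_of_abs_le h]; simp
  · rcases lt_abs.1 h with h | h
    · rw [cut_of_lt hε h, abs_of_nonneg (by linarith), abs_of_nonneg (by linarith)]; linarith
    · rw [cut_of_lt_neg hε (by linarith), abs_of_nonpos (by linarith), abs_of_nonpos (by linarith)]
      linarith

/-- `cut ε` is 1-Lipschitz and vanishes at `t`. This makes `smoothCut` quadratically small near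
`[-ε, ε]`, hence differentiable at the corner points. -/
theorem abs_cut_le_abs_sub {ε s t : ℝ} (hε : 0 ≤ ε) (ht : |t| ≤ ε) : |cut ε s| ≤ |s - t| := by
  obtain ⟨h1, h2⟩ := abs_le.1 ht
  rcases le_or_gt |s| ε with h | h
  · rw [cut_of_abs_le h]; simp
  · rcases lt_abs.1 h with h | h
    · rw [cut_of_lt hε h, abs_of_nonneg (by linarith), abs_of_nonneg (by linarith)]; linarith
    · rw [cut_of_lt_neg hε (by linarith), abs_of_nonpos (by linarith), abs_of_nonpos (by linarith)]
      linarith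

theorem abs_cut_sub_le {ε : ℝ} (hε : 0 ≤ ε) (t : ℝ) : |cut ε t - t| ≤ ε := by
  rw [cut, abs_le]
  constructor
  · have : max (-ε) (min t ε) ≤ ε := max_le (by linarith) (min_le_right _ _)
    linarith
  · have : -ε ≤ max (-ε) (min t ε) := le_max_left _ _
    linarith

/-- A continuously differentiable approximation of `cut ε`, for small `δ > 0`. -/
noncomputable def smoothCut (ε δ t : ℝ) : ℝ := cut ε t * |cut ε t| / (|cut ε t| + δ)

/-- The derivative of `smoothCut ε δ`. -/
noncomputable def smoothCutDeriv (ε δ t : ℝ) : ℝ := 1 - (δ / (|cut ε t| + δ)) ^ 2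

theorem smoothCut_of_abs_le {ε δ t : ℝ} (h : |t| ≤ ε) : smoothCut ε δ t = 0 := by
  simp [smoothCut, cut_of_abs_le h]

theorem smoothCutDeriv_of_abs_le {ε δ t : ℝ} (hδ : 0 < δ) (h : |t| ≤ ε) :
    smoothCutDeriv ε δ t = 0 := by
  simp [smoothCutDeriv, cut_of_abs_le h, hδ.ne']

theorem abs_smoothCut_le_cut {ε δ : ℝ} (hδ : 0 < δ) (t : ℝ) : |smoothCut ε δ t| ≤ |cut ε t| := by
  rw [smoothCut, mul_div_assoc, abs_mul, abs_of_nonneg (by positivity : 0 ≤ |cut ε t| / _)]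
  refine mul_le_of_le_one_right (abs_nonneg _) (div_le_one_of_le₀ (by linarith) (by positivity))

theorem abs_smoothCutDeriv_le {ε δ : ℝ} (hδ : 0 < δ) (t : ℝ) : |smoothCutDeriv ε δ t| ≤ 1 := by
  have h0 : 0 ≤ δ / (|cut ε t| + δ) := by positivity
  have h1 : δ / (|cut ε t| + δ) ≤ 1 :=
    div_le_one_of_le₀ (by linarith [abs_nonneg (cut ε t)]) (by positivity)
  rw [smoothCutDeriv, abs_le]
  constructor <;> nlinarith

theorem continuous_cut (ε : ℝ) : Continuous (cut ε) := by
  unfold cut; fun_prop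

theorem continuous_smoothCutDeriv {ε δ : ℝ} (hδ : 0 < δ) : Continuous (smoothCutDeriv ε δ) := by
  refine continuous_const.sub ((continuous_const.div ((continuous_cut ε).abs.add continuous_const)
    fun t => ?_).pow 2)
  exact (add_pos_of_nonneg_of_pos (abs_nonneg _) hδ).ne'

theorem hasDerivAt_smoothCut {ε δ : ℝ} (hε : 0 < ε) (hδ : 0 < δ) (t : ℝ) :
    HasDerivAt (smoothCut ε δ) (smoothCutDeriv ε δ t) t := by
  rcases le_or_gt |t| ε with h | h
  · rw [smoothCutDeriv_of_abs_le hδ h]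
    -- `|smoothCut ε δ s|` is at most `|cut ε s| ^ 2 / δ`, and `|cut ε s| ≤ |s - t|`; a function of
    -- quadratic order at `t` has derivative zero there.
    have hO : (smoothCut ε δ) =O[nhds t] fun s => ‖s - t‖ ^ 2 := by
      refine Asymptotics.IsBigO.of_bound (1 / δ) (Filter.Eventually.of_forall fun s => ?_)
      have h1 := abs_cut_le_abs_sub (s := s) hε.le h
      rw [Real.norm_eq_abs, Real.norm_eq_abs, Real.norm_eq_abs, abs_pow, abs_abs, smoothCut,
        abs_div, abs_mul, abs_abs, abs_of_pos (by positivity : 0 < |cut ε s| + δ), ← sq,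
        one_div_mul_eq_div]
      gcongr
      linarith [abs_nonneg (cut ε s)]
    have h2 : HasFDerivAt (smoothCut ε δ) (0 : ℝ →L[ℝ] ℝ) t := hO.hasFDerivAt (by norm_num)
    simpa using h2.hasDerivAt
  · rcases lt_abs.1 h with h' | h'
    · have he : smoothCut ε δ =ᶠ[nhds t] fun s => (s - ε) * (s - ε) / (s - ε + δ) := by
        filter_upwards [lt_mem_nhds h'] with s hs
        rw [smoothCut, cut_of_lt hε.le hs, abs_of_pos (by linarith)]
      refine HasDerivAt.congr_of_eventuallyEq ?_ he
      have hd : HasDerivAt (fun s : ℝ => s - ε) 1 t := (hasDerivAt_id t).sub_const ε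
      have hne : t - ε + δ ≠ 0 := by linarith
      refine ((hd.mul hd).div (hd.add_const δ) hne).congr_deriv ?_
      rw [smoothCutDeriv, cut_of_lt hε.le h', abs_of_pos (by linarith)]
      simp only [Pi.mul_apply]
      field_simp
      ring
    · have h'' : t < -ε := by linarith
      have he : smoothCut ε δ =ᶠ[nhds t] fun s => (s + ε) * (-(s + ε)) / (-(s + ε) + δ) := by
        filter_upwards [gt_mem_nhds h''] with s hs
        rw [smoothCut, cut_of_lt_neg hε.le hs, abs_of_neg (by linarith)]
      refine HasDerivAt.congr_of_eventuallyEq ?_ he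
      have hd : HasDerivAt (fun s : ℝ => s + ε) 1 t := (hasDerivAt_id t).add_const ε
      have hne : -(t + ε) + δ ≠ 0 := by linarith
      refine ((hd.mul hd.neg).div (hd.neg.add_const δ) hne).congr_deriv ?_
      rw [smoothCutDeriv, cut_of_lt_neg hε.le h'', abs_of_neg (by linarith)]
      simp only [Pi.mul_apply, Pi.neg_apply]
      field_simp
      ring

theorem tendsto_smoothCut (ε t : ℝ) :
    Filter.Tendsto (fun k : ℕ => smoothCut ε (1 / ((k : ℝ) + 1)) t) Filter.atTop
      (nhds (cut ε t)) := by
  by_cases h : cut ε t = 0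
  · simp [smoothCut, h]
  · have h1 := (tendsto_one_div_add_atTop_nhds_zero_nat (𝕜 := ℝ)).const_add |cut ε t|
    rw [add_zero] at h1
    have h2 := (tendsto_const_nhds (x := cut ε t * |cut ε t|)).div h1 (abs_ne_zero.2 h)
    rwa [mul_div_assoc, div_self (abs_ne_zero.2 h), mul_one] at h2

theorem tendsto_smoothCutDeriv {ε t : ℝ} (hε : 0 ≤ ε) (h : ε < |t|) :
    Filter.Tendsto (fun k : ℕ => smoothCutDeriv ε (1 / ((k : ℝ) + 1)) t) Filter.atTop
      (nhds 1) := by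
  have hne : cut ε t ≠ 0 := by
    rcases lt_abs.1 h with h | h
    · rw [cut_of_lt hε h]; linarith
    · rw [cut_of_lt_neg hε (by linarith)]; linarith
  have h0 := tendsto_one_div_add_atTop_nhds_zero_nat (𝕜 := ℝ)
  have h1 := h0.const_add |cut ε t|
  rw [add_zero] at h1
  have h2 := ((h0.div h1 (abs_ne_zero.2 hne)).pow 2).const_sub 1
  simpa [smoothCutDeriv] using h2

/-- For a negative exponent `|t| ^ b` is singular at `t = 0`. The cut-off removes the singularity:
the composition vanishes wherever `|spow (b x) t| < ε`, which is a neighbourhood of every `(x, 0)`.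
-/
theorem isC1Param_smoothCut_spow (hΩ : IsOpen Ω) {b : E n → ℝ} (hb : ContDiffOn ℝ 1 b Ω)
    (hb0 : ∀ x ∈ Ω, -1 < b x) {ε δ : ℝ} (hε : 0 < ε) (hδ : 0 < δ) :
    IsC1Param Ω (fun x t => smoothCut ε δ (spow (b x) t))
      (fun x t => (smoothCutDeriv ε δ (spow (b x) t) * (spow (b x) t * Real.log t)) • fderiv ℝ b x)
      (fun x t => smoothCutDeriv ε δ (spow (b x) t) * ((b x + 1) * |t| ^ b x)) := by
  have hbc : ContinuousOn (fun p : E n × ℝ => b p.1) (Ω ×ˢ univ) :=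
    hb.continuousOn.comp continuousOn_fst fun p hp => hp.1
  have hbd : ContinuousOn (fun p : E n × ℝ => fderiv ℝ b p.1) (Ω ×ˢ univ) :=
    (hb.continuousOn_fderiv_of_isOpen hΩ le_rfl).comp continuousOn_fst fun p hp => hp.1
  have hpair : ContinuousOn (fun p : E n × ℝ => (b p.1, p.2)) (Ω ×ˢ univ) :=
    hbc.prodMk continuousOn_snd
  have hsp : ContinuousOn (fun p : E n × ℝ => spow (b p.1) p.2) (Ω ×ˢ univ) := fun p hp =>
    ContinuousAt.comp_continuousWithinAt (g := fun p : ℝ × ℝ => spow p.1 p.2)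
      (f := fun p : E n × ℝ => (b p.1, p.2))
      (continuousAt_spow (hb0 p.1 hp.1) p.2) (hpair p hp)
  have hdc : ContinuousOn (fun p : E n × ℝ => smoothCutDeriv ε δ (spow (b p.1) p.2)) (Ω ×ˢ univ) :=
    (continuous_smoothCutDeriv hδ).comp_continuousOn hsp
  have hsmall : ∀ p ∈ Ω ×ˢ (univ : Set ℝ), p.2 = 0 →
      ∀ᶠ q in nhdsWithin p (Ω ×ˢ univ), |spow (b q.1) q.2| < ε := by
    intro p hp h0
    refine (hsp p hp).abs.eventually (gt_mem_nhds ?_)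
    simpa [h0] using hε
  -- Any factor `H` continuous off `t = 0` becomes continuous after multiplication by the derivative
  -- of the cut-off. It is used for both partial derivatives.
  have hgen : ∀ H : ℝ × ℝ → ℝ, (∀ q : ℝ × ℝ, q.2 ≠ 0 → ContinuousAt H q) →
      ContinuousOn (fun p : E n × ℝ => smoothCutDeriv ε δ (spow (b p.1) p.2) * H (b p.1, p.2))
        (Ω ×ˢ univ) := by
    intro H hH p hp
    by_cases h0 : p.2 = 0
    · refine ContinuousWithinAt.congr_of_eventuallyEq (f := fun _ => (0 : ℝ))
        continuousWithinAt_const ?_ ?_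
      · filter_upwards [hsmall p hp h0] with q hq
        rw [smoothCutDeriv_of_abs_le hδ hq.le, zero_mul]
      · rw [smoothCutDeriv_of_abs_le hδ (by simpa [h0] using hε.le), zero_mul]
    · exact (hdc p hp).mul (ContinuousAt.comp_continuousWithinAt (g := H)
        (f := fun p : E n × ℝ => (b p.1, p.2)) (hH _ h0) (hpair p hp))
  refine ⟨fun x hx t => ?_, fun x hx t => ?_, ?_, ?_⟩
  · have hd : HasFDerivAt b (fderiv ℝ b x) x :=
      ((hb.differentiableOn one_ne_zero).differentiableAt (hΩ.mem_nhds hx)).hasFDerivAt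
    have h1 : HasDerivAt (fun a => smoothCut ε δ (spow a t))
        (smoothCutDeriv ε δ (spow (b x) t) * (spow (b x) t * Real.log t)) (b x) :=
      HasDerivAt.comp (h₂ := smoothCut ε δ) (b x) (hasDerivAt_smoothCut hε hδ _)
        (hasDerivAt_spow_exponent (b x) t)
    exact h1.comp_hasFDerivAt x hd
  · by_cases h0 : t = 0
    · subst h0
      rw [spow_zero, smoothCutDeriv_of_abs_le hδ (by simpa using hε.le), zero_mul]
      refine HasDerivAt.congr_of_eventuallyEq (f := fun _ => (0 : ℝ)) (hasDerivAt_const _ _) ?_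
      have hc : ContinuousAt (fun t => spow (b x) t) 0 :=
        ContinuousAt.comp (g := fun p : ℝ × ℝ => spow p.1 p.2) (f := fun t : ℝ => (b x, t))
          (continuousAt_spow (hb0 x hx) 0) (by fun_prop)
      have : ∀ᶠ t in nhds 0, |spow (b x) t| < ε :=
        hc.abs.eventually (gt_mem_nhds (by simpa using hε))
      filter_upwards [this] with s hs
      exact smoothCut_of_abs_le hs.le
    · exact (hasDerivAt_smoothCut hε hδ _).comp t (hasDerivAt_spow h0)
  · refine ContinuousOn.smul (hgen (fun q => spow q.1 q.2 * Real.log q.2) fun q hq =>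
      continuousAt_spow_mul_log (Or.inl hq)) hbd
  · refine hgen (fun q => (q.1 + 1) * |q.2| ^ q.1) fun q hq => ?_
    exact (continuous_fst.add continuous_const).continuousAt.mul (continuousAt_abs_rpow (Or.inl hq))

end

section

variable {n : ℕ} {Ω : Set (E n)} {p q f g : E n → ℝ}

/-! ### The superposition operator of `t log |t|` -/

theorem abs_mul_log_le_one {t : ℝ} (h : |t| ≤ 1) : |t * Real.log t| ≤ 1 := by
  by_cases h0 : t = 0
  · simp [h0]
  · have := Real.abs_log_mul_self_lt |t| (abs_pos.2 h0) h
    rw [abs_mul, Real.log_abs, abs_abs] at this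
    rw [abs_mul, mul_comm]
    exact this.le

theorem abs_log_le_abs_log {s t : ℝ} (hs : 1 ≤ |s|) (hst : |s| ≤ |t|) :
    |Real.log s| ≤ |Real.log t| := by
  rw [← Real.log_abs s, ← Real.log_abs t, abs_of_nonneg (Real.log_nonneg hs),
    abs_of_nonneg (Real.log_nonneg (hs.trans hst))]
  exact Real.log_le_log (by linarith) hst

theorem abs_mul_log_le_rpow {κ m r : ℝ} (hκ : 0 < κ) (hm : 1 ≤ m) (hr : |r| ≤ m) :
    |r * Real.log r| ≤ (1 + 1 / κ) * m ^ (1 + κ) := by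
  have hm1 : 1 ≤ m ^ (1 + κ) := Real.one_le_rpow hm (by linarith)
  rcases le_total |r| 1 with h | h
  · refine (abs_mul_log_le_one h).trans ?_
    have : 0 < 1 / κ := by positivity
    nlinarith
  · have h1 : |Real.log r| ≤ m ^ κ / κ := by
      rw [← Real.log_abs, abs_of_nonneg (Real.log_nonneg h)]
      exact (Real.log_le_log (by linarith) hr).trans (Real.log_le_rpow_div (by linarith) hκ)
    calc |r * Real.log r| = |r| * |Real.log r| := abs_mul _ _
      _ ≤ m * (m ^ κ / κ) := by gcongr
      _ = (1 / κ) * m ^ (1 + κ) := by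
        rw [Real.rpow_add (by linarith), Real.rpow_one]; ring
      _ ≤ _ := by nlinarith

/-- For exponents `q ≥ b + ε₁` the increments of `t log |t|` are small in the power `b` when
those of `t` are small in the power `q`, with constants which are uniform in the exponents. -/
theorem abs_mul_log_sub_rpow_le {ε₁ M : ℝ} (hε₁ : 0 < ε₁) {η : ℝ} (hη : 0 < η) :
    ∃ C, 0 ≤ C ∧ ∀ b q s t : ℝ, 1 ≤ b → b + ε₁ ≤ q → q ≤ M →
      |s * Real.log s - t * Real.log t| ^ b ≤ η * (1 + |t| ^ q) + C * |s - t| ^ q := by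
  -- If `M < 1`, no exponents satisfy `1 ≤ b` and `b + ε₁ ≤ q ≤ M`, and the claim is vacuous.
  by_cases hM : 1 ≤ M
  swap
  · exact ⟨0, le_rfl, fun b q s t h1 h2 h3 => absurd (by linarith) hM⟩
  -- The logarithm is estimated by a power `κ` so small that `κ b ≤ ε₁ / 2`, whence `(m ^ (1 + κ)) ^
  -- b ≤ m ^ (q - ε₁ / 2)` for `m ≥ 1`. The remaining decay `m ^ (-ε₁ / 2)` makes the contribution
  -- of values above a large `R` small.
  set κ := ε₁ / (2 * M) with hκ
  have hκ0 : 0 < κ := by positivity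
  set L := 2 * (1 + 1 / κ) with hL
  have hL1 : 1 ≤ L := by
    have : 0 < 1 / κ := by positivity
    linarith
  have htend : Filter.Tendsto (fun R : ℝ => L ^ M * R ^ (-(ε₁ / 2))) Filter.atTop (nhds 0) := by
    simpa using (tendsto_rpow_neg_atTop (by positivity : 0 < ε₁ / 2)).const_mul (L ^ M)
  obtain ⟨R, hR1, hR⟩ : ∃ R : ℝ, 1 ≤ R ∧ L ^ M * R ^ (-(ε₁ / 2)) ≤ η / 2 ^ M := by
    have h1 := htend.eventually (gt_mem_nhds (by positivity : 0 < η / 2 ^ M))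
    obtain ⟨R, hR, hR'⟩ := (h1.and (Filter.eventually_ge_atTop (1 : ℝ))).exists
    exact ⟨R, hR', hR.le⟩
  have huc := (isCompact_Icc (a := -R) (b := R)).uniformContinuousOn_of_continuous
    (f := fun t : ℝ => t * Real.log t) Real.continuous_mul_log.continuousOn
  rw [Metric.uniformContinuousOn_iff] at huc
  -- Increments below `1` only decrease when raised to a power `b ≥ 1`; similarly `δ ≤ 1` below
  -- gives `δ ^ M ≤ δ ^ q`. Both make the estimate uniform in the exponents.
  obtain ⟨δ₀, hδ₀, hδ'⟩ := huc (min η 1) (by positivity)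
  set δ := min δ₀ 1 with hδ
  have hδ0 : 0 < δ := by positivity
  set D := L * R ^ (1 + κ) with hD
  have hD1 : 1 ≤ D := by
    have : 1 ≤ R ^ (1 + κ) := Real.one_le_rpow hR1 (by linarith)
    nlinarith
  have hsup : ∀ m s t : ℝ, 1 ≤ m → |s| ≤ m → |t| ≤ m →
      |s * Real.log s - t * Real.log t| ≤ L * m ^ (1 + κ) := by
    intro m s t hm hs ht
    refine (abs_sub _ _).trans ?_
    have h1 := abs_mul_log_le_rpow hκ0 hm hs
    have h2 := abs_mul_log_le_rpow hκ0 hm ht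
    rw [hL]; linarith
  -- The first summand serves for bounded values with `|s - t| ≥ δ`, the second for values above
  -- `R`.
  refine ⟨D ^ M / δ ^ M + η, by positivity, fun b q s t hb hbq hq => ?_⟩
  have hq0 : 0 ≤ q := by linarith
  have hst0 : 0 ≤ |s - t| ^ q := by positivity
  have ht0 : 0 ≤ |t| ^ q := by positivity
  have hDM : 0 ≤ D ^ M / δ ^ M := by positivity
  rcases le_total (max |s| |t|) R with hmR | hmR
  · have hs : |s| ≤ R := (le_max_left _ _).trans hmR
    have ht : |t| ≤ R := (le_max_right _ _).trans hmR
    rcases lt_or_ge |s - t| δ with hlt | hge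
    · have h1 : |s * Real.log s - t * Real.log t| < min η 1 :=
        hδ' s (abs_le.1 hs) t (abs_le.1 ht) (hlt.trans_le (min_le_left _ _))
      have h2 : |s * Real.log s - t * Real.log t| ^ b ≤ η := by
        refine (Real.rpow_le_rpow_of_exponent_ge_of_imp (abs_nonneg _)
          (h1.le.trans (min_le_right _ _)) hb (fun _ h => by linarith)).trans ?_
        rw [Real.rpow_one]
        exact h1.le.trans (min_le_left _ _)
      have : 0 ≤ η * |t| ^ q := by positivity
      have : 0 ≤ (D ^ M / δ ^ M + η) * |s - t| ^ q := by positivity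
      linarith
    · have h1 : |s * Real.log s - t * Real.log t| ^ b ≤ D ^ M :=
        (Real.rpow_le_rpow (abs_nonneg _) (hsup R s t hR1 hs ht) (by linarith)).trans
          (Real.rpow_le_rpow_of_exponent_le hD1 (by linarith))
      have h2 : δ ^ M ≤ |s - t| ^ q :=
        (Real.rpow_le_rpow_of_exponent_ge hδ0 (min_le_right _ _) hq).trans
          (Real.rpow_le_rpow hδ0.le hge hq0)
      have h3 : D ^ M ≤ D ^ M / δ ^ M * |s - t| ^ q := by
        rw [div_mul_eq_mul_div, le_div_iff₀ (by positivity)]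
        gcongr
      have : 0 ≤ η * (1 + |t| ^ q) := by positivity
      have : 0 ≤ η * |s - t| ^ q := by positivity
      linarith [add_mul (D ^ M / δ ^ M) η (|s - t| ^ q)]
  -- Large values: the `b`-th power is at most a small multiple of `m ^ q`, and `m ≤ |t| + |s - t|`
  -- splits it into the two allowed terms.
  · set m := max |s| |t| with hm
    have hm1 : 1 ≤ m := hR1.trans hmR
    have hm0 : 0 < m := by linarith
    have h1 : |s * Real.log s - t * Real.log t| ^ b ≤ (L * m ^ (1 + κ)) ^ b :=
      Real.rpow_le_rpow (abs_nonneg _) (hsup m s t hm1 (le_max_left _ _) (le_max_right _ _))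
        (by linarith)
    have hκb : κ * b ≤ ε₁ / 2 := by
      rw [hκ, div_mul_eq_mul_div, div_le_div_iff₀ (by positivity) (by norm_num)]
      nlinarith
    have h2 : (L * m ^ (1 + κ)) ^ b ≤ η / 2 ^ M * m ^ q := by
      rw [Real.mul_rpow (by positivity) (by positivity), ← Real.rpow_mul hm0.le]
      calc L ^ b * m ^ ((1 + κ) * b) ≤ L ^ M * m ^ (q + -(ε₁ / 2)) := by
            gcongr
            · linarith
            · nlinarith
        _ = L ^ M * m ^ (-(ε₁ / 2)) * m ^ q := by rw [Real.rpow_add hm0]; ring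
        _ ≤ L ^ M * R ^ (-(ε₁ / 2)) * m ^ q := by
            gcongr ?_ * ?_ * ?_
            exact Real.rpow_le_rpow_of_nonpos (by linarith) hmR (by linarith)
        _ ≤ _ := by gcongr
    have h3 : m ^ q ≤ 2 ^ M * (|t| ^ q + |s - t| ^ q) := by
      have h4 : m ≤ |(|t| + |s - t|)| := by
        rw [abs_of_nonneg (by positivity)]
        refine max_le ?_ (by linarith [abs_nonneg (s - t)])
        have := abs_add_le t (s - t)
        rwa [add_sub_cancel] at this
      have := abs_add_rpow_le hq0 hq |t| |s - t|
      simp only [abs_abs] at this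
      exact (Real.rpow_le_rpow hm0.le h4 hq0).trans this
    have h5 : η / 2 ^ M * m ^ q ≤ η * (|t| ^ q + |s - t| ^ q) := by
      calc η / 2 ^ M * m ^ q ≤ η / 2 ^ M * (2 ^ M * (|t| ^ q + |s - t| ^ q)) := by gcongr
        _ = _ := by field_simp
    have : 0 ≤ D ^ M / δ ^ M * |s - t| ^ q := by positivity
    linarith [add_mul (D ^ M / δ ^ M) η (|s - t| ^ q)]

theorem modular_mul_log_sub_le {ε₁ M : ℝ} (hε₁ : 0 < ε₁)
    (hqm : AEMeasurable q (vol Ω)) (hp : ∀ᵐ x ∂vol Ω, 1 ≤ p x)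
    (hpq : ∀ᵐ x ∂vol Ω, p x + ε₁ ≤ q x) (hq : ∀ᵐ x ∂vol Ω, q x ≤ M) {η : ℝ} (hη : 0 < η) :
    ∃ C, 0 ≤ C ∧ ∀ f g : E n → ℝ, AEStronglyMeasurable f (vol Ω) → AEStronglyMeasurable g (vol Ω) →
      modular Ω p (fun x => f x * Real.log (f x) - g x * Real.log (g x)) ≤
        ENNReal.ofReal η * (vol Ω univ + modular Ω q g) +
          ENNReal.ofReal C * modular Ω q (fun x => f x - g x) := by
  obtain ⟨C, hC0, hC⟩ := abs_mul_log_sub_rpow_le (M := M) hε₁ hη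
  refine ⟨C, hC0, fun f g hf hg => ?_⟩
  calc modular Ω p (fun x => f x * Real.log (f x) - g x * Real.log (g x))
      ≤ ∫⁻ x in Ω, (ENNReal.ofReal η * (1 + ENNReal.ofReal (|g x| ^ q x)) +
          ENNReal.ofReal C * ENNReal.ofReal (|f x - g x| ^ q x)) := by
        refine lintegral_mono_ae ?_
        filter_upwards [hp, hpq, hq] with x h1 h2 h3
        rw [← ENNReal.ofReal_one, ← ENNReal.ofReal_add zero_le_one (by positivity),
          ← ENNReal.ofReal_mul hη.le, ← ENNReal.ofReal_mul hC0,
          ← ENNReal.ofReal_add (by positivity) (by positivity)]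
        exact ENNReal.ofReal_le_ofReal (hC _ _ _ _ h1 h2 h3)
    _ = _ := by
        have hm : AEMeasurable (fun x => ENNReal.ofReal η * (1 + ENNReal.ofReal (|g x| ^ q x)))
            (vol Ω) :=
          (aemeasurable_const.add (aemeasurable_ofReal_abs_rpow hqm hg)).const_mul _
        rw [lintegral_add_left' hm,
          lintegral_const_mul' _ _ ENNReal.ofReal_ne_top,
          lintegral_const_mul' _ _ ENNReal.ofReal_ne_top, lintegral_add_left measurable_const,
          lintegral_one]
        rfl

theorem aestronglyMeasurable_mul_log (hf : AEStronglyMeasurable f (vol Ω)) :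
    AEStronglyMeasurable (fun x => f x * Real.log (f x)) (vol Ω) :=
  Real.continuous_mul_log.comp_aestronglyMeasurable hf

theorem memLvar_mul_log (hb : Bornology.IsBounded Ω) {ε₁ : ℝ} (hε₁ : 0 < ε₁) (hq : MemM0 Ω q)
    (hp : ∀ᵐ x ∂vol Ω, 1 ≤ p x) (hpq : ∀ᵐ x ∂vol Ω, p x + ε₁ ≤ q x) (hf : MemLvar Ω q f) :
    MemLvar Ω p (fun x => f x * Real.log (f x)) := by
  obtain ⟨hqm, hq1, M, hM⟩ := hq
  refine ⟨aestronglyMeasurable_mul_log hf.1, ?_⟩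
  obtain ⟨C, hC0, hC⟩ := modular_mul_log_sub_le hε₁ hqm hp hpq hM one_pos
  -- Membership is the increment estimate against the zero function, since `0 log 0 = 0`.
  have h := hC f (fun _ => 0) hf.1 aestronglyMeasurable_const
  simp only [zero_mul, sub_zero, modular_zero hq1, add_zero] at h
  exact h.trans_lt (ENNReal.add_lt_top.2
    ⟨ENNReal.mul_lt_top ENNReal.ofReal_lt_top (volume_lt_top_of_isBounded hb),
      ENNReal.mul_lt_top ENNReal.ofReal_lt_top hf.2⟩)

theorem luxNorm_mul_log_sub_le (hb : Bornology.IsBounded Ω) {ε₁ : ℝ} (hε₁ : 0 < ε₁)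
    (hq : MemM0 Ω q) (hp : MemM0 Ω p) (hpq : ∀ᵐ x ∂vol Ω, p x + ε₁ ≤ q x)
    (hg : MemLvar Ω q g) {e : ℝ} (he : 0 < e) :
    ∃ d, 0 < d ∧ ∀ f, MemLvar Ω q f → luxNorm Ω q (fun x => f x - g x) < d →
      luxNorm Ω p (fun x => f x * Real.log (f x) - g x * Real.log (g x)) ≤ e := by
  obtain ⟨hpm, hp1, P, hP⟩ := hp
  obtain ⟨hqm, hq1, M, hM⟩ := id hq
  set l := min e 1 with hl
  have hl0 : 0 < l := by positivity
  set A := (vol Ω univ + modular Ω q g).toReal with hA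
  have hAtop : vol Ω univ + modular Ω q g ≠ ⊤ :=
    (ENNReal.add_lt_top.2 ⟨volume_lt_top_of_isBounded hb, hg.2⟩).ne
  have hA0 : 0 ≤ A := ENNReal.toReal_nonneg
  -- The target is a modular of at most `l ^ P`. This `η` keeps the term with `g` below one half of
  -- it, and the choice of `d` below does the same for the term with `f - g`. As `A` involves `g`,
  -- the continuity obtained is at a fixed `g`.
  obtain ⟨C, hC0, hC⟩ := modular_mul_log_sub_le (η := l ^ P / 2 / (A + 1)) hε₁ hqm hp1 hpq hM
    (by positivity)
  refine ⟨min 1 (l ^ P / 2 / (C + 1)), by positivity, fun f hf hd => ?_⟩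
  refine (luxNorm_le_of_modular_le hp1 hP hl0 (min_le_right _ _) ?_).trans (min_le_left _ _)
  refine (hC f g hf.1 hg.1).trans ?_
  have h1 := modular_le_of_luxNorm_lt hq1 (hf.sub hq hg).2 hd (min_le_left _ _)
  have h2 : ENNReal.ofReal C * modular Ω q (fun x => f x - g x) ≤ ENNReal.ofReal (l ^ P / 2) := by
    refine (mul_le_mul' le_rfl h1).trans ?_
    rw [← ENNReal.ofReal_mul hC0]
    refine ENNReal.ofReal_le_ofReal ?_
    calc C * min 1 (l ^ P / 2 / (C + 1)) ≤ (C + 1) * (l ^ P / 2 / (C + 1)) := by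
          gcongr
          · linarith
          · exact min_le_right _ _
      _ = l ^ P / 2 := by field_simp
  have h3 : ENNReal.ofReal (l ^ P / 2 / (A + 1)) * (vol Ω univ + modular Ω q g) ≤
      ENNReal.ofReal (l ^ P / 2) := by
    rw [← ENNReal.ofReal_toReal hAtop, ← ENNReal.ofReal_mul (by positivity)]
    refine ENNReal.ofReal_le_ofReal ?_
    calc l ^ P / 2 / (A + 1) * A ≤ l ^ P / 2 / (A + 1) * (A + 1) := by gcongr; linarith
      _ = l ^ P / 2 := by field_simp
  refine (add_le_add h3 h2).trans_eq ?_
  rw [← ENNReal.ofReal_add (by positivity) (by positivity), add_halves]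

end

section

variable {n : ℕ} {Ω : Set (E n)} {i : Fin n}

/-! ### Weak derivatives of signed powers with variable exponents -/

/-- The function increases with `|s|` beyond `1` and is bounded by `1` before, so one bound serves
for all values of smaller modulus, as the hypothesis of `HasWeakDeriv.comp` requires. -/
theorem abs_spow_mul_log_le {a s t : ℝ} (ha : 0 ≤ a) (hst : |s| ≤ |t|) :
    |spow a s * Real.log s| ≤ 1 + |spow a t * Real.log t| := by
  rcases le_total |s| 1 with h | h
  · have h1 : |spow a s * Real.log s| ≤ 1 := by
      rw [spow, mul_assoc, abs_mul, abs_of_nonneg (by positivity)]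
      exact mul_le_one₀ (Real.rpow_le_one (abs_nonneg s) h ha) (abs_nonneg _)
        (abs_mul_log_le_one h)
    linarith [abs_nonneg (spow a t * Real.log t)]
  · have : |spow a s * Real.log s| ≤ |spow a t * Real.log t| := by
      rw [abs_mul, abs_mul, abs_spow (by linarith), abs_spow (by linarith)]
      have := abs_log_le_abs_log h hst
      gcongr
    linarith

/-- For `|s| ≤ 1` the singularity costs `1 / (b + 1)`; for larger `|s|` the exponent `b + 1 ≤ 1`
gives `|s| ^ (b + 1) ≤ |s|`. -/
theorem abs_spow_mul_log_le' {b s t : ℝ} (hb : -1 < b) (hb0 : b ≤ 0) (hst : |s| ≤ |t|) :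
    |spow b s * Real.log s| ≤ 1 / (b + 1) + |t * Real.log t| := by
  have hb1 : 0 < b + 1 := by linarith
  have hpos : 0 < 1 / (b + 1) := by positivity
  rcases le_total |s| 1 with h | h
  · have h1 : |spow b s * Real.log s| ≤ 1 / (b + 1) := by
      by_cases hs : s = 0
      · simp [hs, hb1.le]
      · have := Real.abs_log_mul_self_rpow_lt |s| (b + 1) (abs_pos.2 hs) h hb1
        rw [abs_mul, Real.log_abs, abs_of_nonneg (by positivity : 0 ≤ |s| ^ (b + 1))] at this
        rw [abs_mul, abs_spow hb, mul_comm]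
        exact this.le
    linarith [abs_nonneg (t * Real.log t)]
  · have : |spow b s * Real.log s| ≤ |t * Real.log t| := by
      rw [abs_mul, abs_mul, abs_spow hb]
      have h1 := abs_log_le_abs_log h hst
      have h2 : |s| ^ (b + 1) ≤ |t| := by
        refine le_trans ?_ hst
        simpa using Real.rpow_le_rpow_of_exponent_le h (by linarith : b + 1 ≤ 1)
      gcongr
    linarith

theorem abs_spow_le {a s t : ℝ} (ha : -1 < a) (hst : |s| ≤ |t|) : |spow a s| ≤ |spow a t| := by
  rw [abs_spow ha, abs_spow ha]
  exact Real.rpow_le_rpow (abs_nonneg _) hst (by linarith)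

theorem measurable_fderiv_coord (a : E n → ℝ) (i : Fin n) :
    Measurable fun x => fderiv ℝ a x (EuclideanSpace.single i 1) :=
  measurable_fderiv_apply_const ℝ a _

/-- The weak derivative of `|u|^a u` for a function `u` with a derivative in the sense of
truncations. -/
theorem HasTruncDeriv.hasWeakDeriv_spow (hΩ : IsOpen Ω) {a : E n → ℝ} (ha : ContDiffOn ℝ 1 a Ω)
    (ha0 : ∀ x ∈ Ω, 0 < a x) {C : ℝ}
    (hC : ∀ x ∈ Ω, |fderiv ℝ a x (EuclideanSpace.single i 1)| ≤ C) {u g : E n → ℝ}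
    (h : HasTruncDeriv Ω i u g)
    (h1 : LocallyIntegrableOn (fun x => spow (a x) (u x)) Ω volume)
    (h2 : LocallyIntegrableOn (fun x => spow (a x) (u x) * Real.log (u x)) Ω volume)
    (h3 : LocallyIntegrableOn (fun x => (a x + 1) * |u x| ^ a x * g x) Ω volume) :
    HasWeakDeriv Ω i (fun x => spow (a x) (u x))
      (fun x => spow (a x) (u x) * Real.log (u x) * fderiv ℝ a x (EuclideanSpace.single i 1) +
        (a x + 1) * |u x| ^ a x * g x) := by
  set e : E n := EuclideanSpace.single i 1
  have hF := isC1Param_spow hΩ ha ha0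
  have c0 := hF.continuousOn hΩ
  have c1 := hF.continuousOn_apply e
  have c2 := hF.continuousOn_snd
  have hmem : ∀ᵐ x ∂vol Ω, x ∈ Ω := ae_restrict_mem hΩ.measurableSet
  set B : E n → ℝ := fun x => |spow (a x) (u x)| +
    (C * (1 + |spow (a x) (u x) * Real.log (u x)|) + |(a x + 1) * |u x| ^ a x * g x|) with hBdef
  have hB : LocallyIntegrableOn B Ω volume := by
    have hc : LocallyIntegrableOn (fun _ : E n => (1 : ℝ)) Ω volume :=
      (continuous_const.locallyIntegrable).locallyIntegrableOn Ω
    have e2 : LocallyIntegrableOn (fun x => C * (1 + |spow (a x) (u x) * Real.log (u x)|)) Ω :=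
      (hc.add h2.norm).continuousOn_mul (g := fun _ => C) continuousOn_const hΩ.isLocallyClosed
    exact h1.norm.add (e2.add h3.norm)
  have hbound : ∀ᵐ x ∂vol Ω, ∀ t, |t| ≤ |u x| → |spow (a x) t| ≤ B x ∧
      |spow (a x) t * Real.log t * fderiv ℝ a x e| + |(a x + 1) * |t| ^ a x * g x| ≤ B x := by
    filter_upwards [hmem] with x hx t ht
    have ha' := ha0 x hx
    have hC0 : 0 ≤ C := (abs_nonneg _).trans (hC x hx)
    have b1 := abs_spow_le (a := a x) (by linarith) ht
    have b2 : |spow (a x) t * Real.log t * fderiv ℝ a x e| ≤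
        C * (1 + |spow (a x) (u x) * Real.log (u x)|) := by
      rw [abs_mul, mul_comm]
      exact mul_le_mul (hC x hx) (abs_spow_mul_log_le ha'.le ht) (abs_nonneg _) hC0
    have b3 : |(a x + 1) * |t| ^ a x * g x| ≤ |(a x + 1) * |u x| ^ a x * g x| := by
      rw [abs_mul, abs_mul _ (g x)]
      refine mul_le_mul_of_nonneg_right ?_ (abs_nonneg _)
      rw [abs_of_nonneg (by positivity : 0 ≤ (a x + 1) * |t| ^ a x),
        abs_of_nonneg (by positivity : 0 ≤ (a x + 1) * |u x| ^ a x)]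
      gcongr
    have p1 : 0 ≤ C * (1 + |spow (a x) (u x) * Real.log (u x)|) := by positivity
    simp only [hBdef]
    constructor <;> linarith [abs_nonneg ((a x + 1) * |u x| ^ a x * g x),
      abs_nonneg (spow (a x) (u x))]
  set ε : ℕ → ℝ := fun k => 1 / ((k : ℝ) + 1)
  have hε : ∀ k, 0 < ε k := fun k => by positivity
  set w : ℕ → E n → ℝ := fun k x => cut (ε k) (u x)
  set γ : ℕ → E n → ℝ := fun k => indicator {x | ε k < |u x|} g
  have hwu : ∀ k x, |w k x| ≤ |u x| := fun k x => abs_cut_le (hε k).le _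
  have hγ : ∀ k x, |γ k x| ≤ |g x| := fun k x => by
    by_cases hx : ε k < |u x|
    · simp only [γ]; rw [indicator_of_mem (by exact hx)]
    · simp only [γ]; rw [indicator_of_notMem (by exact hx), abs_zero]; exact abs_nonneg _
  have hbk : ∀ k, ∀ᵐ x ∂vol Ω, ∀ t, |t| ≤ |w k x| → |spow (a x) t| ≤ B x ∧
      |((spow (a x) t * Real.log t) • fderiv ℝ a x) e| + |(a x + 1) * |t| ^ a x * γ k x| ≤ B x := by
    intro k
    filter_upwards [hbound] with x hx t ht
    obtain ⟨b1, b2⟩ := hx t (ht.trans (hwu k x))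
    refine ⟨b1, le_trans (add_le_add le_rfl ?_) b2⟩
    rw [abs_mul, abs_mul _ (g x)]
    exact mul_le_mul_of_nonneg_left (hγ k x) (abs_nonneg _)
  -- The truncations `w k` are weakly differentiable. Since `|w k| ≤ |u|` and `|γ k| ≤ |g|`, the
  -- bound `B` built from `u` and `g` dominates all of them.
  have hk : ∀ k, HasWeakDeriv Ω i (fun x => spow (a x) (w k x))
      (fun x => ((spow (a x) (w k x) * Real.log (w k x)) • fderiv ℝ a x) e +
        (a x + 1) * |w k x| ^ a x * γ k x) := fun k =>
    (h.2.2 (ε k) (hε k)).comp hΩ hF hB (hbk k)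
  have ht0 : Filter.Tendsto ε Filter.atTop (nhds 0) := tendsto_one_div_add_atTop_nhds_zero_nat
  have hwt : ∀ x, Filter.Tendsto (fun k => w k x) Filter.atTop (nhds (u x)) := by
    intro x
    rw [tendsto_iff_dist_tendsto_zero]
    exact squeeze_zero (fun _ => dist_nonneg) (fun k => abs_cut_sub_le (hε k).le (u x)) ht0
  refine hasWeakDeriv_of_dominated hΩ (fun k => (hk k).1.aestronglyMeasurable)
    (fun k => (hk k).2.1.aestronglyMeasurable) hB
    (fun k => (hbk k).mono fun x hx => (hx _ le_rfl).1)
    (fun k => (hbk k).mono fun x hx => (abs_add_le _ _).trans (hx _ le_rfl).2) ?_ ?_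
    fun k => (hk k).2.2
  · filter_upwards [hmem] with x hx
    exact tendsto_comp_of_continuousOn hΩ c0 hx (hwt x)
  · filter_upwards [hmem, h.2.1] with x hx hg0
    have l1 := tendsto_comp_of_continuousOn hΩ c1 hx (hwt x)
    have l2 := tendsto_comp_of_continuousOn hΩ c2 hx (hwt x)
    -- Where `u ≠ 0` the sequence is eventually equal to `g x`; where `u = 0` it is zero, and so is
    -- `g` by the definition of the truncated derivative.
    have l3 : Filter.Tendsto (fun k => γ k x) Filter.atTop (nhds (g x)) := by
      by_cases hu0 : u x = 0
      · have : ∀ k, γ k x = 0 := fun k => by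
          have := hγ k x
          rw [hg0 hu0, abs_zero] at this
          exact abs_nonpos_iff.1 this
        simp only [this, hg0 hu0]
        exact tendsto_const_nhds
      · refine tendsto_const_nhds.congr' ?_
        filter_upwards [ht0.eventually (gt_mem_nhds (abs_pos.2 hu0))] with k hk
        exact (indicator_of_mem (show x ∈ {x | ε k < |u x|} from hk) g).symm
    exact l1.add (l2.mul l3)

/-- The derivative in the sense of truncations of `|v|^b v`, `-1 < b < 0`, for a weakly
differentiable function `v`. -/
theorem HasWeakDeriv.hasTruncDeriv_spow (hΩ : IsOpen Ω) {b : E n → ℝ} (hb : ContDiffOn ℝ 1 b Ω)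
    {A : ℝ} (hb0 : ∀ x ∈ Ω, -1 < b x) (hb1 : ∀ x ∈ Ω, b x ≤ 0)
    (hA : ∀ x ∈ Ω, 1 / (b x + 1) ≤ A) {C : ℝ}
    (hC : ∀ x ∈ Ω, |fderiv ℝ b x (EuclideanSpace.single i 1)| ≤ C) {v g : E n → ℝ}
    (h : HasWeakDeriv Ω i v g)
    (h2 : LocallyIntegrableOn (fun x => v x * Real.log (v x)) Ω volume) :
    HasTruncDeriv Ω i (fun x => spow (b x) (v x)) (fun x => if v x = 0 then 0 else
      spow (b x) (v x) * Real.log (v x) * fderiv ℝ b x (EuclideanSpace.single i 1) +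
        (b x + 1) * |v x| ^ b x * g x) := by
  set e : E n := EuclideanSpace.single i 1
  have hmem : ∀ᵐ x ∂vol Ω, x ∈ Ω := ae_restrict_mem hΩ.measurableSet
  have vm : AEMeasurable v (vol Ω) := h.1.aestronglyMeasurable.aemeasurable
  have gm : AEMeasurable g (vol Ω) := h.2.1.aestronglyMeasurable.aemeasurable
  have bm : AEMeasurable b (vol Ω) := hb.continuousOn.aemeasurable hΩ.measurableSet
  have spm : AEMeasurable (fun x => spow (b x) (v x)) (vol Ω) :=
    ((continuous_abs.measurable.comp_aemeasurable vm).pow bm).mul vm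
  set G : E n → ℝ := fun x => spow (b x) (v x) * Real.log (v x) * fderiv ℝ b x e +
        (b x + 1) * |v x| ^ b x * g x with hGdef
  have Gm : AEMeasurable G (vol Ω) :=
    ((spm.mul (Real.measurable_log.comp_aemeasurable vm)).mul
      (measurable_fderiv_coord b i).aemeasurable).add
      (((bm.add_const 1).mul ((continuous_abs.measurable.comp_aemeasurable vm).pow bm)).mul gm)
  refine ⟨?_, ?_, fun ε hε => ?_⟩
  · have hset : NullMeasurableSet {x | v x = 0} (vol Ω) :=
      vm.nullMeasurableSet_preimage (measurableSet_singleton 0)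
    have := (Gm.indicator₀ hset.compl).aestronglyMeasurable
    refine this.congr (Filter.Eventually.of_forall fun x => ?_)
    by_cases hx : v x = 0
    · simp [indicator, hx]
    · simp [indicator, hx, hGdef]
  · filter_upwards [hmem] with x hx h0
    rw [if_pos ((spow_eq_zero (hb0 x hx)).1 h0)]
  -- With `r = -b / (b + 1) ≤ A` one has `|t| ^ b = ((|t| ^ (b + 1))⁻¹) ^ r`, and the base is at
  -- most `ε⁻¹` where `|spow b t| > ε`. So `K` bounds the singular factor, uniformly in `x`,
  -- wherever the cut-off does not vanish.
  set K := max 1 ε⁻¹ ^ A with hK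
  set B : E n → ℝ := fun x => (1 + |v x|) + (C * (A + |v x * Real.log (v x)|) + K * |g x|) with hBdef
  have hB : LocallyIntegrableOn B Ω volume := by
    have hc : ∀ c : ℝ, LocallyIntegrableOn (fun _ : E n => c) Ω volume := fun c =>
      (continuous_const.locallyIntegrable).locallyIntegrableOn Ω
    have e2 : LocallyIntegrableOn (fun x => C * (A + |v x * Real.log (v x)|)) Ω :=
      ((hc A).add h2.norm).continuousOn_mul (g := fun _ => C) continuousOn_const hΩ.isLocallyClosed
    have e3 : LocallyIntegrableOn (fun x => K * |g x|) Ω :=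
      h.2.1.norm.continuousOn_mul (g := fun _ => K) continuousOn_const hΩ.isLocallyClosed
    exact ((hc 1).add h.1.norm).add (e2.add e3)
  have hpow : ∀ x ∈ Ω, ∀ t : ℝ, ε < |spow (b x) t| → (b x + 1) * |t| ^ b x ≤ K := by
    intro x hx t ht
    have hb0' : 0 < b x + 1 := by linarith [hb0 x hx]
    have hb1' := hb1 x hx
    have ht0 : 0 < |t| := by
      rw [abs_pos]
      rintro rfl
      simp at ht; linarith
    rw [abs_spow (hb0 x hx)] at ht
    set r := -(b x) / (b x + 1) with hr
    have hr0 : 0 ≤ r := div_nonneg (by linarith) hb0'.le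
    have hrA : r ≤ A := by
      refine le_trans ?_ (hA x hx)
      rw [hr]
      gcongr
      linarith [hb0 x hx]
    have hε1 : (|t| ^ (b x + 1))⁻¹ ≤ max 1 ε⁻¹ :=
      (inv_anti₀ hε ht.le).trans (le_max_right _ _)
    have e1 : |t| ^ b x = ((|t| ^ (b x + 1))⁻¹) ^ r := by
      rw [← Real.rpow_neg ht0.le, ← Real.rpow_mul ht0.le, hr]
      congr 1
      field_simp
    have h3 : |t| ^ b x ≤ K := by
      rw [e1]
      exact (Real.rpow_le_rpow (by positivity) hε1 hr0).trans
        (Real.rpow_le_rpow_of_exponent_le (le_max_left _ _) hrA)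
    have h4 : 0 ≤ |t| ^ b x := by positivity
    nlinarith
  have hbδ : ∀ k : ℕ, ∀ᵐ x ∂vol Ω, ∀ t, |t| ≤ |v x| →
      |smoothCut ε (1 / ((k : ℝ) + 1)) (spow (b x) t)| ≤ B x ∧
      |((smoothCutDeriv ε (1 / ((k : ℝ) + 1)) (spow (b x) t) * (spow (b x) t * Real.log t)) •
          fderiv ℝ b x) e| +
        |smoothCutDeriv ε (1 / ((k : ℝ) + 1)) (spow (b x) t) * ((b x + 1) * |t| ^ b x) * g x| ≤
          B x := by
    intro k
    have hδ : (0 : ℝ) < 1 / ((k : ℝ) + 1) := by positivity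
    filter_upwards [hmem] with x hx t ht
    have hb0' : 0 < b x + 1 := by linarith [hb0 x hx]
    have hA0 : 0 ≤ A := le_trans (by positivity) (hA x hx)
    have hC0 : 0 ≤ C := (abs_nonneg _).trans (hC x hx)
    have hK0 : 0 ≤ K := by positivity
    have q1 : 0 ≤ C * (A + |v x * Real.log (v x)|) := by positivity
    have q2 : 0 ≤ K * |g x| := by positivity
    constructor
    · have h3 : |smoothCut ε (1 / ((k : ℝ) + 1)) (spow (b x) t)| ≤ |spow (b x) t| :=
        (abs_smoothCut_le_cut hδ _).trans (abs_cut_le hε.le _)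
      have h4 : |spow (b x) t| ≤ 1 + |v x| := by
        rw [abs_spow (hb0 x hx)]
        rcases le_total |t| 1 with h5 | h5
        · linarith [Real.rpow_le_one (abs_nonneg t) h5 hb0'.le, abs_nonneg (v x)]
        · have := Real.rpow_le_rpow_of_exponent_le h5 (by linarith [hb1 x hx] : b x + 1 ≤ 1)
          rw [Real.rpow_one] at this
          linarith
      simp only [hBdef]
      linarith
    · have h3 : |((smoothCutDeriv ε (1 / ((k : ℝ) + 1)) (spow (b x) t) *
          (spow (b x) t * Real.log t)) • fderiv ℝ b x) e| ≤ C * (A + |v x * Real.log (v x)|) := by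
        rw [smul_apply, smul_eq_mul, abs_mul, abs_mul, mul_comm]
        have h4 := abs_smoothCutDeriv_le (ε := ε) hδ (spow (b x) t)
        have h5 := abs_spow_mul_log_le' (hb0 x hx) (hb1 x hx) ht
        refine mul_le_mul (hC x hx) ?_ (by positivity) hC0
        refine (mul_le_of_le_one_left (abs_nonneg _) h4).trans (h5.trans ?_)
        linarith [hA x hx]
      have h4 : |smoothCutDeriv ε (1 / ((k : ℝ) + 1)) (spow (b x) t) *
          ((b x + 1) * |t| ^ b x) * g x| ≤ K * |g x| := by
        rw [abs_mul]
        refine mul_le_mul_of_nonneg_right ?_ (abs_nonneg _)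
        rcases le_or_gt |spow (b x) t| ε with h5 | h5
        · rw [smoothCutDeriv_of_abs_le hδ h5, zero_mul, abs_zero]
          exact hK0
        · rw [abs_mul, abs_of_nonneg (by positivity : 0 ≤ (b x + 1) * |t| ^ b x)]
          exact (mul_le_of_le_one_left (by positivity) (abs_smoothCutDeriv_le hδ _)).trans
            (hpow x hx t h5)
      simp only [hBdef]
      linarith [abs_nonneg (v x)]
  have hk : ∀ k : ℕ, HasWeakDeriv Ω i
      (fun x => smoothCut ε (1 / ((k : ℝ) + 1)) (spow (b x) (v x)))
      (fun x => ((smoothCutDeriv ε (1 / ((k : ℝ) + 1)) (spow (b x) (v x)) *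
        (spow (b x) (v x) * Real.log (v x))) • fderiv ℝ b x) e +
        smoothCutDeriv ε (1 / ((k : ℝ) + 1)) (spow (b x) (v x)) *
          ((b x + 1) * |v x| ^ b x) * g x) := fun k =>
    h.comp hΩ (isC1Param_smoothCut_spow hΩ hb hb0 hε (by positivity)) hB (hbδ k)
  refine hasWeakDeriv_of_dominated hΩ (fun k => (hk k).1.aestronglyMeasurable)
    (fun k => (hk k).2.1.aestronglyMeasurable) hB
    (fun k => (hbδ k).mono fun x hx => (hx _ le_rfl).1)
    (fun k => (hbδ k).mono fun x hx => (abs_add_le _ _).trans (hx _ le_rfl).2)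
    (Filter.Eventually.of_forall fun x => tendsto_smoothCut ε _) ?_ fun k => (hk k).2.2
  refine Filter.Eventually.of_forall fun x => ?_
  rcases le_or_gt |spow (b x) (v x)| ε with h5 | h5
  -- The derivative of the cut-off is zero up to level `ε` and tends to one above it; its limit
  -- produces the indicator in the definition of the truncated derivative.
  · have h6 : ∀ k : ℕ, smoothCutDeriv ε (1 / ((k : ℝ) + 1)) (spow (b x) (v x)) = 0 := fun k =>
      smoothCutDeriv_of_abs_le (by positivity) h5
    rw [indicator_of_notMem (by simpa using h5)]
    simp only [h6, zero_mul, zero_smul, zero_apply, add_zero]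
    exact tendsto_const_nhds
  · have hv0 : v x ≠ 0 := by
      intro h0
      simp [h0] at h5; linarith
    rw [indicator_of_mem (by exact h5), if_neg hv0]
    have l := tendsto_smoothCutDeriv hε.le h5
    have := ((l.mul_const (spow (b x) (v x) * Real.log (v x))).mul_const (fderiv ℝ b x e)).add
      ((l.mul_const ((b x + 1) * |v x| ^ b x)).mul_const (g x))
    simpa only [one_mul, smul_apply, smul_eq_mul] using this

end

section

variable {n : ℕ} {Ω : Set (E n)} {p q f g γ β θ : E n → ℝ} {i : Fin n}

/-! ### Bounded multipliers in the Luxemburg norm -/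

theorem luxNorm_mul_le (hp : ∀ᵐ x ∂vol Ω, 1 ≤ p x) (hf : MemLvar Ω p f) {b : E n → ℝ} {C : ℝ}
    (hC : 0 < C) (hb : ∀ᵐ x ∂vol Ω, |b x| ≤ C) :
    luxNorm Ω p (fun x => b x * f x) ≤ C * luxNorm Ω p f := by
  rw [← div_le_iff₀' hC]
  refine le_of_forall_gt_imp_ge_of_dense fun l hl => ?_
  rw [div_le_iff₀' hC]
  have hl0 : 0 < l := luxNorm_nonneg.trans_lt hl
  refine luxNorm_le (by positivity) ?_
  have h1 := modular_div_le_one_of_luxNorm_lt hp hf.2 hl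
  refine le_trans ?_ h1
  have h2 : modular Ω p (fun x => b x * f x / (C * l)) ≤
      ENNReal.ofReal 1 * modular Ω p (fun x => f x / l) := by
    refine modular_le_mul ?_
    filter_upwards [hp, hb] with x hx hbx
    rw [one_mul]
    refine Real.rpow_le_rpow (abs_nonneg _) ?_ (by linarith)
    rw [mul_div_mul_comm, abs_mul]
    refine mul_le_of_le_one_left (abs_nonneg _) ?_
    rw [abs_div, abs_of_pos hC]
    exact div_le_one_of_le₀ hbx hC.le
  rwa [ENNReal.ofReal_one, one_mul] at h2

/-! ### The structural assumptions -/

theorem IsC1Closure.exists_bound (hb : Bornology.IsBounded Ω) (hf : IsC1Closure Ω f) :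
    ∃ C, 0 ≤ C ∧ ∀ x ∈ Ω, |f x| ≤ C ∧ ‖fderiv ℝ f x‖ ≤ C := by
  obtain ⟨-, ⟨F, hF, hFe⟩, F', hF', hFe'⟩ := hf
  have hc : IsCompact (closure Ω) := hb.isCompact_closure
  obtain ⟨C, hC⟩ := hc.exists_bound_of_continuousOn hF
  obtain ⟨C', hC'⟩ := hc.exists_bound_of_continuousOn hF'
  refine ⟨max (max C C') 0, le_max_right _ _, fun x hx => ⟨?_, ?_⟩⟩
  · rw [← hFe hx]
    exact (hC x (subset_closure hx)).trans ((le_max_left _ _).trans (le_max_left _ _))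
  · rw [← hFe' hx]
    exact (hC' x (subset_closure hx)).trans ((le_max_right _ _).trans (le_max_left _ _))

/-- The consequences of the assumptions on `Ω` and on the exponents which are used to compare the
two spaces. -/
structure Admissible (Ω : Set (E n)) (γ β θ : E n → ℝ) : Prop where
  isOpen : IsOpen Ω
  isBounded : Bornology.IsBounded Ω
  one_le_fst : ∀ x ∈ Ω, 1 ≤ γ x
  one_le_snd : ∀ x ∈ Ω, 1 ≤ β x
  contDiffOn : ContDiffOn ℝ 1 (fun x => γ x / β x) Ω
  exists_bound : ∃ A, ∀ x ∈ Ω, γ x / β x ≤ A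
  exists_fderiv_bound : ∃ C, 0 < C ∧ ∀ i : Fin n, ∀ x ∈ Ω,
    |fderiv ℝ (fun x => γ x / β x) x (EuclideanSpace.single i 1)| ≤ C
  aemeasurable_fst : AEMeasurable γ (vol Ω)
  memM0_snd : MemM0 Ω β
  memM0 : MemM0 Ω θ
  memM0_psi : MemM0 Ω (psi γ β θ)
  add_le : ∀ᵐ x ∂vol Ω, γ x + β x ≤ θ x
  exists_gap : ∃ ε, 0 < ε ∧ ∀ᵐ x ∂vol Ω, β x + ε ≤ psi γ β θ x

theorem admissible (hΩo : IsOpen Ω) (hΩb : Bornology.IsBounded Ω)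
    (hγ : IsC1Closure Ω γ) (hγ1 : ∀ x ∈ Ω, 1 ≤ γ x) (hβ : IsC1Closure Ω β)
    (hβ1 : ∀ x ∈ Ω, 1 ≤ β x) (hθ : MemM0 Ω θ) {ε₀ : ℝ} (hε₀ : 0 < ε₀)
    (hθγβ : ∀ᵐ x ∂(vol Ω), γ x + β x + ε₀ ≤ θ x) : Admissible Ω γ β θ := by
  have hmem : ∀ᵐ x ∂vol Ω, x ∈ Ω := ae_restrict_mem hΩo.measurableSet
  obtain ⟨Γ, hΓ0, hΓ⟩ := hγ.exists_bound hΩb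
  obtain ⟨B, hB0, hB⟩ := hβ.exists_bound hΩb
  have mγ : AEMeasurable γ (vol Ω) := hγ.1.continuousOn.aemeasurable hΩo.measurableSet
  have mβ : AEMeasurable β (vol Ω) := hβ.1.continuousOn.aemeasurable hΩo.measurableSet
  have hβ0 : ∀ x ∈ Ω, β x ≠ 0 := fun x hx => by linarith [hβ1 x hx]
  -- By definition `ψ - β = β (θ - γ - β) / (γ + β)`, which is at least `ε₀ / (γ + β)` because `β ≥
  -- 1`.
  have hgap : ∀ᵐ x ∂vol Ω, β x + ε₀ / (Γ + B + 1) ≤ psi γ β θ x := by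
    filter_upwards [hmem, hθγβ] with x hx h
    have g1 := hγ1 x hx
    have b1 := hβ1 x hx
    have h1 : γ x ≤ Γ := (le_abs_self _).trans (hΓ x hx).1
    have h2 : β x ≤ B := (le_abs_self _).trans (hB x hx).1
    have h3 : ε₀ / (Γ + B + 1) ≤ ε₀ / (γ x + β x) :=
      div_le_div_of_nonneg_left hε₀.le (by linarith) (by linarith)
    have h4 : β x + ε₀ / (γ x + β x) ≤ psi γ β θ x := by
      rw [psi, le_div_iff₀ (by linarith), add_mul, div_mul_cancel₀ _ (by linarith)]
      nlinarith
    linarith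
  refine ⟨hΩo, hΩb, hγ1, hβ1, hγ.1.div hβ.1 hβ0, ⟨Γ, fun x hx => ?_⟩,
    ⟨Γ * B + Γ + 1, by positivity, fun i x hx => ?_⟩, mγ,
    ⟨mβ, hmem.mono fun x hx => hβ1 x hx, B, hmem.mono fun x hx =>
      (le_abs_self _).trans (hB x hx).1⟩, hθ, ?_, hθγβ.mono fun x hx => by linarith,
    ⟨ε₀ / (Γ + B + 1), by positivity, hgap⟩⟩
  · refine (div_le_self (by linarith [hγ1 x hx]) (hβ1 x hx)).trans ?_
    exact (le_abs_self _).trans (hΓ x hx).1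
  · have b1 := hβ1 x hx
    have dγ : HasFDerivAt γ (fderiv ℝ γ x) x :=
      ((hγ.1.differentiableOn one_ne_zero).differentiableAt (hΩo.mem_nhds hx)).hasFDerivAt
    have dβ : HasFDerivAt β (fderiv ℝ β x) x :=
      ((hβ.1.differentiableOn one_ne_zero).differentiableAt (hΩo.mem_nhds hx)).hasFDerivAt
    -- The quotient is differentiated as `γ * β⁻¹`; as `β ≥ 1`, the factors `β⁻¹` and `β⁻²` are at
    -- most one and the derivative is at most `Γ * B + Γ`.
    have d := dγ.mul ((hasDerivAt_inv (hβ0 x hx)).comp_hasFDerivAt x dβ)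
    have hfun : (fun x => γ x / β x) = γ * ((fun y => y⁻¹) ∘ β) := by
      ext y; simp [div_eq_mul_inv]
    rw [hfun, d.fderiv]
    have he : ‖(EuclideanSpace.single i 1 : E n)‖ = 1 := by simp
    have hγe : |fderiv ℝ γ x (EuclideanSpace.single i 1)| ≤ Γ := by
      have := (fderiv ℝ γ x).le_opNorm (EuclideanSpace.single i 1)
      rw [he, mul_one, Real.norm_eq_abs] at this
      exact this.trans (hΓ x hx).2
    have hβe : |fderiv ℝ β x (EuclideanSpace.single i 1)| ≤ B := by
      have := (fderiv ℝ β x).le_opNorm (EuclideanSpace.single i 1)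
      rw [he, mul_one, Real.norm_eq_abs] at this
      exact this.trans (hB x hx).2
    have hinv : |(β x)⁻¹| ≤ 1 := by
      rw [abs_of_nonneg (by positivity)]; exact inv_le_one_of_one_le₀ b1
    have hinv2 : |-(β x ^ 2)⁻¹| ≤ 1 := by
      rw [abs_neg, abs_of_nonneg (by positivity)]
      exact inv_le_one_of_one_le₀ (one_le_pow₀ b1)
    simp only [add_apply, smul_apply, smul_eq_mul, Function.comp_apply]
    refine (abs_add_le _ _).trans ?_
    rw [abs_mul, abs_mul, abs_mul]
    have h1 : |γ x| * (|-(β x ^ 2)⁻¹| * |fderiv ℝ β x (EuclideanSpace.single i 1)|) ≤ Γ * (1 * B) :=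
      mul_le_mul (hΓ x hx).1 (mul_le_mul hinv2 hβe (abs_nonneg _) zero_le_one) (by positivity) hΓ0
    have h2 : |(β x)⁻¹| * |fderiv ℝ γ x (EuclideanSpace.single i 1)| ≤ 1 * Γ :=
      mul_le_mul hinv hγe (abs_nonneg _) zero_le_one
    linarith
  · obtain ⟨mθ, -, M, hM⟩ := hθ
    refine ⟨(mθ.mul mβ).div (mγ.add mβ), ?_, M, ?_⟩
    · filter_upwards [hmem, hgap] with x hx h
      have : 0 < ε₀ / (Γ + B + 1) := by positivity
      linarith [hβ1 x hx]
    · filter_upwards [hmem, hM, hθγβ] with x hx h h'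
      have g1 := hγ1 x hx
      have b1 := hβ1 x hx
      refine le_trans ?_ h
      rw [psi, div_le_iff₀ (by linarith)]
      nlinarith

theorem Admissible.ae_mem (H : Admissible Ω γ β θ) : ∀ᵐ x ∂vol Ω, x ∈ Ω :=
  ae_restrict_mem H.isOpen.measurableSet

theorem Admissible.ratio_pos (H : Admissible Ω γ β θ) {x : E n} (hx : x ∈ Ω) : 0 < γ x / β x :=
  div_pos (by linarith [H.one_le_fst x hx]) (by linarith [H.one_le_snd x hx])

theorem Admissible.aemeasurable_ratio (H : Admissible Ω γ β θ) :
    AEMeasurable (fun x => γ x / β x) (vol Ω) := H.aemeasurable_fst.div H.memM0_snd.1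

/-- The exponent of the inverse of `φ`. -/
noncomputable def invExp (γ β : E n → ℝ) (x : E n) : ℝ := -(γ x / β x / (γ x / β x + 1))

theorem Admissible.invExp_add_one (H : Admissible Ω γ β θ) {x : E n} (hx : x ∈ Ω) :
    (γ x / β x + 1) * (invExp γ β x + 1) = 1 := by
  have := H.ratio_pos hx
  rw [invExp]
  generalize γ x / β x = a at *
  field_simp
  ring

theorem Admissible.neg_one_lt_invExp (H : Admissible Ω γ β θ) {x : E n} (hx : x ∈ Ω) :
    -1 < invExp γ β x := by
  have h := H.invExp_add_one hx
  have := H.ratio_pos hx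
  by_contra h'
  nlinarith

theorem Admissible.invExp_nonpos (H : Admissible Ω γ β θ) {x : E n} (hx : x ∈ Ω) :
    invExp γ β x ≤ 0 := by
  have := H.ratio_pos hx
  rw [invExp, neg_nonpos]
  positivity

theorem Admissible.contDiffOn_invExp (H : Admissible Ω γ β θ) :
    ContDiffOn ℝ 1 (invExp γ β) Ω :=
  (H.contDiffOn.div (H.contDiffOn.add contDiffOn_const) fun x hx => by
    linarith [H.ratio_pos hx]).neg

/-- The exponent is the composition of `γ / β` with `s ↦ -s / (s + 1)`, whose derivative `-1 / (s +
1)²` has modulus at most one for `s > 0`. -/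
theorem Admissible.abs_fderiv_invExp_le (H : Admissible Ω γ β θ) {C : ℝ} {x : E n} (hx : x ∈ Ω)
    (hC : |fderiv ℝ (fun x => γ x / β x) x (EuclideanSpace.single i 1)| ≤ C) :
    |fderiv ℝ (invExp γ β) x (EuclideanSpace.single i 1)| ≤ C := by
  set a : E n → ℝ := fun x => γ x / β x with ha
  have ha0 : 0 < a x := H.ratio_pos hx
  have d : HasFDerivAt a (fderiv ℝ a x) x :=
    ((H.contDiffOn.differentiableOn one_ne_zero).differentiableAt
      (H.isOpen.mem_nhds hx)).hasFDerivAt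
  have h1 : HasDerivAt (fun s : ℝ => -(s / (s + 1))) (-(1 / (a x + 1) ^ 2)) (a x) := by
    refine (((hasDerivAt_id (a x)).div ((hasDerivAt_id (a x)).add_const 1)
      (by simp only [id]; linarith)).neg).congr_deriv ?_
    simp only [id]
    ring
  have h2 := h1.comp_hasFDerivAt x d
  rw [show fderiv ℝ (invExp γ β) x = _ from h2.fderiv, smul_apply, smul_eq_mul, abs_mul]
  refine (mul_le_of_le_one_left (abs_nonneg _) ?_).trans hC
  rw [abs_neg, abs_of_nonneg (by positivity)]
  exact div_le_one_of_le₀ (one_le_pow₀ (by linarith)) (by positivity)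

/-! ### The map `φ` and its inverse between the two spaces -/

theorem Admissible.aestronglyMeasurable_phi (H : Admissible Ω γ β θ) {u : E n → ℝ}
    (hu : AEStronglyMeasurable u (vol Ω)) :
    AEStronglyMeasurable (fun x => phi γ β x (u x)) (vol Ω) :=
  (((continuous_abs.measurable.comp_aemeasurable hu.aemeasurable).pow
    H.aemeasurable_ratio).mul hu.aemeasurable).aestronglyMeasurable

theorem Admissible.aestronglyMeasurable_invExp (H : Admissible Ω γ β θ) {v : E n → ℝ}
    (hv : AEStronglyMeasurable v (vol Ω)) :
    AEStronglyMeasurable (fun x => spow (invExp γ β x) (v x)) (vol Ω) :=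
  (((continuous_abs.measurable.comp_aemeasurable hv.aemeasurable).pow
    (H.contDiffOn_invExp.continuousOn.aemeasurable H.isOpen.measurableSet)).mul
      hv.aemeasurable).aestronglyMeasurable

/-- The identity `(γ / β + 1) ψ = θ` dictates the choice of `ψ`. -/
theorem Admissible.abs_phi_rpow_psi (H : Admissible Ω γ β θ) {x : E n} (hx : x ∈ Ω) (t : ℝ) :
    |phi γ β x t| ^ psi γ β θ x = |t| ^ θ x := by
  have h := H.ratio_pos hx
  have hg := H.one_le_fst x hx
  have hb := H.one_le_snd x hx
  change |spow (γ x / β x) t| ^ psi γ β θ x = |t| ^ θ x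
  rw [abs_spow (by linarith), ← Real.rpow_mul (abs_nonneg t)]
  congr 1
  have h1 : β x ≠ 0 := by linarith
  have h2 : γ x + β x ≠ 0 := by linarith
  rw [psi]
  field_simp

theorem Admissible.modular_phi (H : Admissible Ω γ β θ) (u : E n → ℝ) :
    modular Ω (psi γ β θ) (fun x => phi γ β x (u x)) = modular Ω θ u :=
  lintegral_congr_ae (H.ae_mem.mono fun x hx => by simp only [H.abs_phi_rpow_psi hx])

theorem Admissible.memLvar_phi (H : Admissible Ω γ β θ) {u : E n → ℝ} (hu : MemLvar Ω θ u) :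
    MemLvar Ω (psi γ β θ) (fun x => phi γ β x (u x)) :=
  ⟨H.aestronglyMeasurable_phi hu.1, by rw [H.modular_phi]; exact hu.2⟩

theorem Admissible.phi_invExp (H : Admissible Ω γ β θ) {x : E n} (hx : x ∈ Ω) (t : ℝ) :
    phi γ β x (spow (invExp γ β x) t) = t :=
  spow_spow (H.neg_one_lt_invExp hx) (by rw [mul_comm]; exact H.invExp_add_one hx) t

theorem Admissible.invExp_phi (H : Admissible Ω γ β θ) {x : E n} (hx : x ∈ Ω) (t : ℝ) :
    spow (invExp γ β x) (phi γ β x t) = t :=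
  spow_spow (by linarith [H.ratio_pos hx]) (H.invExp_add_one hx) t

theorem Admissible.memLvar_mul_log (H : Admissible Ω γ β θ) {v : E n → ℝ}
    (hv : MemLvar Ω (psi γ β θ) v) : MemLvar Ω β (fun x => v x * Real.log (v x)) := by
  obtain ⟨ε, hε, hgap⟩ := H.exists_gap
  exact VarExp.memLvar_mul_log H.isBounded hε H.memM0_psi H.memM0_snd.2.1 hgap hv

/-- The coefficient of `v log |v|` in the weak derivative of `v = φ(u)`. -/
noncomputable def logCoeff (γ β : E n → ℝ) (i : Fin n) (x : E n) : ℝ :=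
  fderiv ℝ (fun x => γ x / β x) x (EuclideanSpace.single i 1) / (γ x / β x + 1)

theorem Admissible.aestronglyMeasurable_logCoeff (H : Admissible Ω γ β θ) (i : Fin n) :
    AEStronglyMeasurable (logCoeff γ β i) (vol Ω) :=
  ((measurable_fderiv_coord _ i).aemeasurable.div
    (H.aemeasurable_ratio.add_const 1)).aestronglyMeasurable

theorem Admissible.exists_logCoeff_bound (H : Admissible Ω γ β θ) :
    ∃ C, 0 < C ∧ ∀ i : Fin n, ∀ᵐ x ∂vol Ω, |logCoeff γ β i x| ≤ C := by
  obtain ⟨C, hC0, hC⟩ := H.exists_fderiv_bound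
  refine ⟨C, hC0, fun i => H.ae_mem.mono fun x hx => ?_⟩
  have h := H.ratio_pos hx
  rw [logCoeff, abs_div, abs_of_pos (by linarith : 0 < γ x / β x + 1)]
  exact (div_le_self (abs_nonneg _) (by linarith)).trans (hC i x hx)

theorem phi_mul_log {x : E n} (h : 0 < γ x / β x) (t : ℝ) :
    phi γ β x t * Real.log (phi γ β x t) =
      (γ x / β x + 1) * (spow (γ x / β x) t * Real.log t) := by
  change spow (γ x / β x) t * Real.log (spow (γ x / β x) t) = _
  by_cases ht : t = 0
  · simp [ht]
  · rw [← Real.log_abs (spow _ t), abs_spow (by linarith), Real.log_rpow (abs_pos.2 ht),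
      Real.log_abs]
    ring

/-- The part `φ'_t(u) D_i u` of the weak derivative of `φ(u)`. -/
noncomputable def chainTerm (Ω : Set (E n)) (γ β : E n → ℝ) (i : Fin n) (u : E n → ℝ) (x : E n) :
    ℝ :=
  phiDeriv γ β x (u x) * truncDeriv Ω i u x

/-- The integrand `|u| ^ γ |D_i u| ^ β` is the `β`-th power of `|u| ^ (γ / β) |D_i u|`, and the
remaining factor `γ / β + 1` is bounded. -/
theorem Admissible.memLvar_chainTerm (H : Admissible Ω γ β θ) {u : Fun Ω}
    (hu : MemS Ω γ β u) (i : Fin n) : MemLvar Ω β (chainTerm Ω γ β i u) := by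
  obtain ⟨-, hd, hfin⟩ := hu
  obtain ⟨A, hA⟩ := H.exists_bound
  have ht := truncDeriv_spec (hd i)
  have um : AEMeasurable u (vol Ω) := u.aestronglyMeasurable.aemeasurable
  set f : E n → ℝ := fun x => |u x| ^ (γ x / β x) * truncDeriv Ω i u x
  have hf : MemLvar Ω β f := by
    refine ⟨(((continuous_abs.measurable.comp_aemeasurable um).pow H.aemeasurable_ratio).mul
      ht.1.aemeasurable).aestronglyMeasurable, ?_⟩
    have h1 := (ENNReal.sum_lt_top.1 (ENNReal.add_lt_top.1 hfin).2) i (Finset.mem_univ i)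
    refine lt_of_le_of_lt (le_of_eq (lintegral_congr_ae (H.ae_mem.mono fun x hx => ?_))) h1
    have hb := H.one_le_snd x hx
    have hb0 : β x ≠ 0 := by linarith
    simp only [f]
    rw [abs_mul, abs_of_nonneg (by positivity), Real.mul_rpow (by positivity) (abs_nonneg _),
      ← Real.rpow_mul (abs_nonneg _), div_mul_cancel₀ _ hb0]
  have := hf.bdd_mul H.memM0_snd (b := fun x => γ x / β x + 1) (C := A + 1)
    (H.aemeasurable_ratio.add_const 1).aestronglyMeasurable (H.ae_mem.mono fun x hx => by
      rw [abs_of_pos (by linarith [H.ratio_pos hx])]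
      linarith [hA x hx])
  refine this.congr (Filter.Eventually.of_forall fun x => ?_)
  simp only [f, chainTerm, phiDeriv]
  ring

theorem Admissible.hasWeakDeriv_phi (H : Admissible Ω γ β θ) {u : Fun Ω}
    (hu : MemS Ω γ β u) (huθ : MemLvar Ω θ u) (i : Fin n) :
    HasWeakDeriv Ω i (fun x => phi γ β x (u x)) (fun x =>
      logCoeff γ β i x * (phi γ β x (u x) * Real.log (phi γ β x (u x))) +
        chainTerm Ω γ β i u x) := by
  obtain ⟨C, hC0, hC⟩ := H.exists_fderiv_bound
  have hβ1 := H.memM0_snd.2.1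
  have LI : ∀ {f : E n → ℝ}, Integrable f (vol Ω) → LocallyIntegrableOn f Ω volume := fun hf =>
    IntegrableOn.locallyIntegrableOn hf
  have hφ := H.memLvar_phi huθ
  have i1 := hφ.integrable H.isBounded H.memM0_psi.2.1
  -- The logarithmic term in `u` is `(γ / β + 1)⁻¹` times that in `φ(u)`, because `log |φ(u)| = (γ /
  -- β + 1) log |u|`; the latter lies in `L^β` by the gap between `β` and `ψ`.
  have i2 := ((H.memLvar_mul_log hφ).bdd_mul H.memM0_snd (C := 1)
    (b := fun x => (γ x / β x + 1)⁻¹)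
    (H.aemeasurable_ratio.add_const 1).inv.aestronglyMeasurable (H.ae_mem.mono fun x hx => by
      have := H.ratio_pos hx
      rw [abs_of_pos (by positivity)]
      exact inv_le_one_of_one_le₀ (by linarith))).integrable H.isBounded hβ1
  have i3 := (H.memLvar_chainTerm hu i).integrable H.isBounded hβ1
  have e2 : ∀ x ∈ Ω, (γ x / β x + 1)⁻¹ * (phi γ β x (u x) * Real.log (phi γ β x (u x))) =
      spow (γ x / β x) (u x) * Real.log (u x) := fun x hx => by
    have h := H.ratio_pos hx
    rw [phi_mul_log h, inv_mul_cancel_left₀ (by linarith)]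
  have key := (truncDeriv_spec (hu.2.1 i)).hasWeakDeriv_spow H.isOpen H.contDiffOn
    (fun x hx => H.ratio_pos hx) (hC i) (LI i1)
    (LI (i2.congr (H.ae_mem.mono fun x hx => e2 x hx))) (LI i3)
  refine key.congr (Filter.EventuallyEq.refl _ _) (H.ae_mem.mono fun x hx => ?_)
  have h := H.ratio_pos hx
  simp only [logCoeff, chainTerm, phiDeriv]
  rw [← e2 x hx]
  field_simp

theorem Admissible.memL1_phi (H : Admissible Ω γ β θ) {u : Fun Ω}
    (hu : MemS Ω γ β u) (huθ : MemLvar Ω θ u) {v : Fun Ω}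
    (hv : v =ᵐ[vol Ω] fun x => phi γ β x (u x)) :
    MemL1 Ω β v ∧ MemLvar Ω (psi γ β θ) v := by
  have hφ := H.memLvar_phi huθ
  refine ⟨⟨(hφ.integrable H.isBounded H.memM0_psi.2.1).congr hv.symm, fun i => ?_⟩,
    hφ.congr hv.symm⟩
  have h := (H.hasWeakDeriv_phi hu huθ i).congr hv.symm (Filter.EventuallyEq.refl _ _)
  refine ⟨⟨_, h⟩, MemLvar.congr ?_ (h.weakDeriv_eq H.isOpen).symm⟩
  obtain ⟨C, -, hC⟩ := H.exists_logCoeff_bound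
  exact ((H.memLvar_mul_log hφ).bdd_mul H.memM0_snd (H.aestronglyMeasurable_logCoeff i)
    (hC i)).add H.memM0_snd (H.memLvar_chainTerm hu i)

theorem Admissible.memS_invExp (H : Admissible Ω γ β θ) {v : Fun Ω} (hv : MemL1 Ω β v)
    (hvψ : MemLvar Ω (psi γ β θ) v) {u : Fun Ω}
    (hu : u =ᵐ[vol Ω] fun x => spow (invExp γ β x) (v x)) :
    MemS Ω γ β u ∧ MemLvar Ω θ u := by
  obtain ⟨A, hA⟩ := H.exists_bound
  obtain ⟨C, hC0, hC⟩ := H.exists_fderiv_bound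
  have huθ : MemLvar Ω θ u := by
    refine ⟨u.aestronglyMeasurable, ?_⟩
    rw [← H.modular_phi, modular_congr (g := v)]
    · exact hvψ.2
    · filter_upwards [hu, H.ae_mem] with x h1 hx
      rw [h1, H.phi_invExp hx]
  have hvlog := H.memLvar_mul_log hvψ
  have hβ1 := H.memM0_snd.2.1
  have hg : ∀ i, HasTruncDeriv Ω i u (fun x => if v x = 0 then 0 else
      spow (invExp γ β x) (v x) * Real.log (v x) *
        fderiv ℝ (invExp γ β) x (EuclideanSpace.single i 1) +
        (invExp γ β x + 1) * |v x| ^ invExp γ β x * weakDeriv Ω i v x) := fun i =>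
    ((weakDeriv_spec (hv.2 i).1).hasTruncDeriv_spow H.isOpen H.contDiffOn_invExp (A := A + 1)
      (fun x hx => H.neg_one_lt_invExp hx) (fun x hx => H.invExp_nonpos hx)
      (fun x hx => by
        have h1 := H.invExp_add_one hx
        have h2 := H.neg_one_lt_invExp hx
        rw [one_div, inv_eq_of_mul_eq_one_left h1]
        linarith [hA x hx])
      (fun x hx => H.abs_fderiv_invExp_le hx (hC i x hx))
      (IntegrableOn.locallyIntegrableOn (hvlog.integrable H.isBounded hβ1))).congr hu.symm
  refine ⟨⟨huθ.integrable H.isBounded H.memM0.2.1, fun i => ⟨_, hg i⟩, ?_⟩, huθ⟩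
  refine ENNReal.add_lt_top.2 ⟨?_, ENNReal.sum_lt_top.2 fun i _ => ?_⟩
  · refine (huθ.mono_exponent (p := fun x => γ x + β x) H.isBounded ?_ H.add_le).2
    filter_upwards [H.ae_mem] with x hx
    linarith [H.one_le_fst x hx, H.one_le_snd x hx]
  -- Off `{v = 0}` this function equals `|u| ^ (γ / β) D_i u`: the singular factor `|v| ^ b` of `D_i
  -- u` is cancelled exactly by `|u| ^ (γ / β) = |v| ^ (-b)`, where `b` is the inverse exponent.
  · have hP : MemLvar Ω β (fun x =>
        fderiv ℝ (invExp γ β) x (EuclideanSpace.single i 1) * (v x * Real.log (v x)) +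
          (invExp γ β x + 1) * weakDeriv Ω i v x) := by
      refine (hvlog.bdd_mul H.memM0_snd (C := C)
        (measurable_fderiv_coord _ i).aestronglyMeasurable (H.ae_mem.mono fun x hx =>
          H.abs_fderiv_invExp_le hx (hC i x hx))).add H.memM0_snd
        ((hv.2 i).2.bdd_mul H.memM0_snd (C := 1)
        ((H.contDiffOn_invExp.continuousOn.aemeasurable
          H.isOpen.measurableSet).add_const 1).aestronglyMeasurable (H.ae_mem.mono fun x hx => ?_))
      rw [abs_of_pos (by linarith [H.neg_one_lt_invExp hx])]
      linarith [H.invExp_nonpos hx]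
    refine lt_of_le_of_lt (lintegral_mono_ae ?_) hP.2
    filter_upwards [hu, H.ae_mem, (hg i).truncDeriv_eq H.isOpen] with x h1 hx h2
    refine ENNReal.ofReal_le_ofReal ?_
    have hb := H.one_le_snd x hx
    have hb0 : β x ≠ 0 := by linarith
    by_cases h0 : v x = 0
    · rw [h2, if_pos h0, abs_zero, Real.zero_rpow hb0, mul_zero]
      positivity
    · have hpos : 0 < |v x| := abs_pos.2 h0
      have e1 : |u x| ^ (γ x / β x) * |v x| ^ invExp γ β x = 1 := by
        rw [h1, abs_spow (H.neg_one_lt_invExp hx), ← Real.rpow_mul hpos.le, ← Real.rpow_add hpos]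
        rw [show (invExp γ β x + 1) * (γ x / β x) + invExp γ β x = 0 by
          linarith [H.invExp_add_one hx], Real.rpow_zero]
      rw [h2, if_neg h0]
      have e2 : |u x| ^ γ x = (|u x| ^ (γ x / β x)) ^ β x := by
        rw [← Real.rpow_mul (abs_nonneg _), div_mul_cancel₀ _ hb0]
      rw [e2, ← Real.mul_rpow (by positivity) (abs_nonneg _)]
      refine le_of_eq (congrArg (· ^ β x) ?_)
      rw [← abs_of_nonneg (by positivity : 0 ≤ |u x| ^ (γ x / β x)), ← abs_mul]
      congr 1
      rw [spow]
      linear_combination (v x * Real.log (v x) *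
        fderiv ℝ (invExp γ β) x (EuclideanSpace.single i 1) +
        (invExp γ β x + 1) * weakDeriv Ω i v x) * e1

end

section

variable {n : ℕ} {Ω : Set (E n)} {p q γ β θ : E n → ℝ} {i : Fin n}

/-! ### The two metrics -/

theorem distS_eq (u v : SSpace Ω γ β θ) :
    distS Ω γ β θ u v =
      luxNorm Ω (psi γ β θ) (fun x => phi γ β x (u.1 x) - phi γ β x (v.1 x)) +
        ∑ i, luxNorm Ω β (fun x => chainTerm Ω γ β i u.1 x - chainTerm Ω γ β i v.1 x) := rfl

theorem luxNorm_sub_self (hp : ∀ᵐ x ∂vol Ω, 1 ≤ p x) (f : E n → ℝ) :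
    luxNorm Ω p (fun x => f x - f x) = 0 := by
  simp only [sub_self]
  exact luxNorm_zero hp

/-- The metric `d_{S₁}`. -/
@[reducible] noncomputable def Admissible.metricSpaceS (H : Admissible Ω γ β θ) :
    MetricSpace (SSpace Ω γ β θ) where
  dist := distS Ω γ β θ
  dist_self u := by
    rw [distS_eq, luxNorm_sub_self H.memM0_psi.2.1]
    simp [luxNorm_zero H.memM0_snd.2.1]
  dist_comm u v := by
    rw [distS_eq, distS_eq, luxNorm_sub_comm]
    congr 1
    exact Finset.sum_congr rfl fun i _ => luxNorm_sub_comm _ _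
  dist_triangle u v w := by
    rw [distS_eq, distS_eq, distS_eq, add_add_add_comm, ← Finset.sum_add_distrib]
    exact add_le_add (luxNorm_sub_le H.memM0_psi (H.memLvar_phi u.2.2) (H.memLvar_phi v.2.2)
      (H.memLvar_phi w.2.2)) (Finset.sum_le_sum fun i _ => luxNorm_sub_le H.memM0_snd
      (H.memLvar_chainTerm u.2.1 i) (H.memLvar_chainTerm v.2.1 i) (H.memLvar_chainTerm w.2.1 i))
  eq_of_dist_eq_zero {u v} h := by
    have h : distS Ω γ β θ u v = 0 := h
    rw [distS_eq] at h
    have h0 := (add_eq_zero_iff_of_nonneg luxNorm_nonneg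
      (Finset.sum_nonneg fun i _ => luxNorm_nonneg)).1 h
    -- The first summand of the distance already separates points, since `φ(x, ·)` is injective.
    have h1 := luxNorm_eq_zero H.memM0_psi
      ((H.memLvar_phi u.2.2).sub H.memM0_psi (H.memLvar_phi v.2.2)) h0.1
    refine Subtype.ext (AEEqFun.ext ?_)
    filter_upwards [h1, H.ae_mem] with x hx hxΩ
    rw [← H.invExp_phi hxΩ (u.1 x), ← H.invExp_phi hxΩ (v.1 x), sub_eq_zero.1 hx]

/-- `weakDeriv` is a chosen representative, so its additivity holds almost everywhere only, through
uniqueness; the norm does not see the difference. -/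
theorem normV_sub (hΩ : IsOpen Ω) (v w : VSpace Ω β q) :
    normV Ω β q (v.1 - w.1) = (∫ x in Ω, |v.1 x - w.1 x|) +
      ∑ i, luxNorm Ω β (fun x => weakDeriv Ω i v.1 x - weakDeriv Ω i w.1 x) +
        luxNorm Ω q (fun x => v.1 x - w.1 x) := by
  have h : (v.1 - w.1 : Fun Ω) =ᵐ[vol Ω] fun x => v.1 x - w.1 x := AEEqFun.coeFn_sub v.1 w.1
  rw [normV, luxNorm_congr h, integral_congr_ae (h.mono fun x hx => by simp only [hx] :
    (fun x => |(v.1 - w.1 : Fun Ω) x|) =ᵐ[vol Ω] fun x => |v.1 x - w.1 x|)]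
  congr 2
  refine Finset.sum_congr rfl fun i _ => luxNorm_congr ?_
  exact (((weakDeriv_spec (v.2.1.2 i).1).sub hΩ (weakDeriv_spec (w.2.1.2 i).1)).congr h.symm
    (Filter.EventuallyEq.refl _ _)).weakDeriv_eq hΩ

/-- The metric of the intersection `L^{1,β(x)}(Ω) ∩ L^{q(x)}(Ω)`. -/
@[reducible] noncomputable def metricSpaceV (hΩ : IsOpen Ω) (hβ : MemM0 Ω β) (hq : MemM0 Ω q) :
    MetricSpace (VSpace Ω β q) where
  dist v w := normV Ω β q (v.1 - w.1)
  dist_self v := by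
    rw [normV_sub hΩ, luxNorm_sub_self hq.2.1]
    simp [luxNorm_zero hβ.2.1]
  dist_comm v w := by
    rw [normV_sub hΩ, normV_sub hΩ, luxNorm_sub_comm]
    congr 2
    · simp only [abs_sub_comm]
    · exact Finset.sum_congr rfl fun i _ => luxNorm_sub_comm _ _
  dist_triangle u v w := by
    rw [normV_sub hΩ, normV_sub hΩ, normV_sub hΩ, add_add_add_comm, add_add_add_comm (∫ x in Ω, _),
      ← Finset.sum_add_distrib]
    have i1 := (u.2.1.1.sub v.2.1.1).abs
    have i2 := (v.2.1.1.sub w.2.1.1).abs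
    refine add_le_add (add_le_add ?_ (Finset.sum_le_sum fun i _ => luxNorm_sub_le hβ
      (u.2.1.2 i).2 (v.2.1.2 i).2 (w.2.1.2 i).2)) (luxNorm_sub_le hq u.2.2 v.2.2 w.2.2)
    refine (integral_mono (u.2.1.1.sub w.2.1.1).abs (i1.add i2) fun x => ?_).trans_eq
      (integral_add i1 i2)
    exact abs_sub_le _ _ _
  eq_of_dist_eq_zero {v w} h := by
    have h : normV Ω β q (v.1 - w.1) = 0 := h
    rw [normV_sub hΩ] at h
    have h0 := (add_eq_zero_iff_of_nonneg (add_nonneg (integral_nonneg fun x => abs_nonneg _)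
      (Finset.sum_nonneg fun i _ => luxNorm_nonneg)) luxNorm_nonneg).1 h
    have h1 := luxNorm_eq_zero hq (v.2.2.sub hq w.2.2) h0.2
    exact Subtype.ext (AEEqFun.ext (h1.mono fun x hx => sub_eq_zero.1 hx))

/-! ### The homeomorphism -/

/-- The map `u ↦ φ(u)`. -/
noncomputable def Admissible.toV (H : Admissible Ω γ β θ) (u : SSpace Ω γ β θ) :
    VSpace Ω β (psi γ β θ) :=
  ⟨AEEqFun.mk _ (H.aestronglyMeasurable_phi u.1.aestronglyMeasurable),
    H.memL1_phi u.2.1 u.2.2 (AEEqFun.coeFn_mk _ _)⟩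

/-- The inverse of `u ↦ φ(u)`. -/
noncomputable def Admissible.toS (H : Admissible Ω γ β θ) (v : VSpace Ω β (psi γ β θ)) :
    SSpace Ω γ β θ :=
  ⟨AEEqFun.mk _ (H.aestronglyMeasurable_invExp v.1.aestronglyMeasurable),
    H.memS_invExp v.2.1 v.2.2 (AEEqFun.coeFn_mk _ _)⟩

theorem Admissible.coe_toV (H : Admissible Ω γ β θ) (u : SSpace Ω γ β θ) :
    (H.toV u).1 =ᵐ[vol Ω] fun x => phi γ β x (u.1 x) := AEEqFun.coeFn_mk _ _

theorem Admissible.coe_toS (H : Admissible Ω γ β θ) (v : VSpace Ω β (psi γ β θ)) :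
    (H.toS v).1 =ᵐ[vol Ω] fun x => spow (invExp γ β x) (v.1 x) := AEEqFun.coeFn_mk _ _

/-- The bijection `u ↦ φ(u)`. -/
noncomputable def Admissible.equiv (H : Admissible Ω γ β θ) :
    SSpace Ω γ β θ ≃ VSpace Ω β (psi γ β θ) where
  toFun := H.toV
  invFun := H.toS
  left_inv u := by
    refine Subtype.ext (AEEqFun.ext ?_)
    filter_upwards [H.coe_toS (H.toV u), H.coe_toV u, H.ae_mem] with x h1 h2 hx
    rw [h1, h2, H.invExp_phi hx]
  right_inv v := by
    refine Subtype.ext (AEEqFun.ext ?_)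
    filter_upwards [H.coe_toV (H.toS v), H.coe_toS v, H.ae_mem] with x h1 h2 hx
    rw [h1, h2, H.phi_invExp hx]

theorem Admissible.weakDeriv_toV (H : Admissible Ω γ β θ) (u : SSpace Ω γ β θ) (i : Fin n) :
    weakDeriv Ω i (H.toV u).1 =ᵐ[vol Ω] fun x =>
      logCoeff γ β i x * ((H.toV u).1 x * Real.log ((H.toV u).1 x)) +
        chainTerm Ω γ β i u.1 x := by
  refine (((H.hasWeakDeriv_phi u.2.1 u.2.2 i).congr (H.coe_toV u).symm
    (Filter.EventuallyEq.refl _ _)).weakDeriv_eq H.isOpen).trans ?_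
  filter_upwards [H.coe_toV u] with x hx
  simp only [hx]

/-- The distance of `v log |v|` and `w log |w|` in `L^{β(x)}(Ω)`. -/
noncomputable def logDist (Ω : Set (E n)) (β v w : E n → ℝ) : ℝ :=
  luxNorm Ω β (fun x => v x * Real.log (v x) - w x * Real.log (w x))

theorem Admissible.luxNorm_phi_sub (H : Admissible Ω γ β θ) (u v : SSpace Ω γ β θ) :
    luxNorm Ω (psi γ β θ) (fun x => phi γ β x (u.1 x) - phi γ β x (v.1 x)) =
      luxNorm Ω (psi γ β θ) (fun x => (H.toV u).1 x - (H.toV v).1 x) := by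
  refine luxNorm_congr ?_
  filter_upwards [H.coe_toV u, H.coe_toV v] with x h1 h2
  rw [h1, h2]

theorem Admissible.luxNorm_logCoeff_mul_le (H : Admissible Ω γ β θ) {C : ℝ} (hC0 : 0 < C)
    (hC : ∀ᵐ x ∂vol Ω, |logCoeff γ β i x| ≤ C) (v w : VSpace Ω β (psi γ β θ)) :
    luxNorm Ω β (fun x => logCoeff γ β i x *
      (v.1 x * Real.log (v.1 x) - w.1 x * Real.log (w.1 x))) ≤ C * logDist Ω β v.1 w.1 :=
  luxNorm_mul_le H.memM0_snd.2.1 ((H.memLvar_mul_log v.2.2).sub H.memM0_snd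
    (H.memLvar_mul_log w.2.2)) hC0 hC

/-- By `Admissible.weakDeriv_toV`, the derivatives of the images and the chain terms differ by
`logCoeff` times the logarithmic terms, so each metric controls the other up to `logDist`. In the
constant, `m` pays for the `L¹` norm, which is at most `m` times the `L^ψ` norm, and `n * C` for the
logarithmic terms of the `n` derivatives. -/
theorem Admissible.exists_comparison (H : Admissible Ω γ β θ) :
    ∃ K, 0 < K ∧ ∀ u v : SSpace Ω γ β θ,
      normV Ω β (psi γ β θ) ((H.toV u).1 - (H.toV v).1) ≤
        K * (distS Ω γ β θ u v + logDist Ω β (H.toV u).1 (H.toV v).1) ∧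
      distS Ω γ β θ u v ≤
        K * (normV Ω β (psi γ β θ) ((H.toV u).1 - (H.toV v).1) +
          logDist Ω β (H.toV u).1 (H.toV v).1) := by
  obtain ⟨C, hC0, hC⟩ := H.exists_logCoeff_bound
  set m := (vol Ω univ).toReal + 1
  have hm : 0 < m := by positivity
  refine ⟨m + 1 + n * C, by positivity, fun u v => ?_⟩
  have hβ := H.memM0_snd
  set N := logDist Ω β (H.toV u).1 (H.toV v).1 with hN
  have hN0 : 0 ≤ N := luxNorm_nonneg
  set P := luxNorm Ω (psi γ β θ) (fun x => (H.toV u).1 x - (H.toV v).1 x) with hP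
  have hP0 : 0 ≤ P := luxNorm_nonneg
  set S := ∑ i, luxNorm Ω β (fun x => chainTerm Ω γ β i u.1 x - chainTerm Ω γ β i v.1 x) with hS
  have hS0 : 0 ≤ S := Finset.sum_nonneg fun i _ => luxNorm_nonneg
  set T := ∑ i, luxNorm Ω β
    (fun x => weakDeriv Ω i (H.toV u).1 x - weakDeriv Ω i (H.toV v).1 x) with hT
  have hT0 : 0 ≤ T := Finset.sum_nonneg fun i _ => luxNorm_nonneg
  have hI : ∫ x in Ω, |(H.toV u).1 x - (H.toV v).1 x| ≤ m * P :=
    integral_abs_le_mul_luxNorm H.isBounded H.memM0_psi.2.1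
      ((H.toV u).2.2.sub H.memM0_psi (H.toV v).2.2)
  have hI0 : 0 ≤ ∫ x in Ω, |(H.toV u).1 x - (H.toV v).1 x| :=
    integral_nonneg fun x => abs_nonneg _
  have hlog : MemLvar Ω β (fun x => (H.toV u).1 x * Real.log ((H.toV u).1 x) -
      (H.toV v).1 x * Real.log ((H.toV v).1 x)) :=
    (H.memLvar_mul_log (H.toV u).2.2).sub hβ (H.memLvar_mul_log (H.toV v).2.2)
  have hl : ∀ i, MemLvar Ω β (fun x => logCoeff γ β i x *
      ((H.toV u).1 x * Real.log ((H.toV u).1 x) - (H.toV v).1 x * Real.log ((H.toV v).1 x))) :=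
    fun i => hlog.bdd_mul hβ (H.aestronglyMeasurable_logCoeff i) (hC i)
  have hc : ∀ i, MemLvar Ω β (fun x => chainTerm Ω γ β i u.1 x - chainTerm Ω γ β i v.1 x) :=
    fun i => (H.memLvar_chainTerm u.2.1 i).sub hβ (H.memLvar_chainTerm v.2.1 i)
  have hw : ∀ i, MemLvar Ω β
      (fun x => weakDeriv Ω i (H.toV u).1 x - weakDeriv Ω i (H.toV v).1 x) :=
    fun i => ((H.toV u).2.1.2 i).2.sub hβ ((H.toV v).2.1.2 i).2
  have hTS : T ≤ n * C * N + S := by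
    have h1 : ∀ i, luxNorm Ω β
        (fun x => weakDeriv Ω i (H.toV u).1 x - weakDeriv Ω i (H.toV v).1 x) ≤
        C * N + luxNorm Ω β (fun x => chainTerm Ω γ β i u.1 x - chainTerm Ω γ β i v.1 x) := by
      intro i
      refine le_trans (le_of_eq (luxNorm_congr ?_)) ((luxNorm_add_le hβ (hl i) (hc i)).trans
        (add_le_add (H.luxNorm_logCoeff_mul_le hC0 (hC i) _ _) le_rfl))
      filter_upwards [H.weakDeriv_toV u i, H.weakDeriv_toV v i] with x h1 h2
      rw [h1, h2]
      ring
    refine (Finset.sum_le_sum fun i _ => h1 i).trans_eq ?_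
    rw [Finset.sum_add_distrib]
    simp [mul_assoc, hS]
  have hST : S ≤ n * C * N + T := by
    have h1 : ∀ i, luxNorm Ω β (fun x => chainTerm Ω γ β i u.1 x - chainTerm Ω γ β i v.1 x) ≤
        C * N + luxNorm Ω β
          (fun x => weakDeriv Ω i (H.toV u).1 x - weakDeriv Ω i (H.toV v).1 x) := by
      intro i
      have h0 := luxNorm_add_le hβ (hl i).neg (hw i)
      rw [luxNorm_neg] at h0
      refine le_trans (le_of_eq (luxNorm_congr ?_)) (h0.trans
        (add_le_add (H.luxNorm_logCoeff_mul_le hC0 (hC i) _ _) le_rfl))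
      filter_upwards [H.weakDeriv_toV u i, H.weakDeriv_toV v i] with x h1 h2
      rw [h1, h2]
      ring
    refine (Finset.sum_le_sum fun i _ => h1 i).trans_eq ?_
    rw [Finset.sum_add_distrib]
    simp [mul_assoc, hT]
  have hnC : 0 ≤ n * C := by positivity
  rw [normV_sub H.isOpen, distS_eq, H.luxNorm_phi_sub]
  constructor
  · nlinarith [mul_nonneg hm.le hS0, mul_nonneg hm.le hN0, mul_nonneg hnC hP0, mul_nonneg hnC hS0]
  · nlinarith [mul_nonneg hm.le hT0, mul_nonneg hm.le hN0, mul_nonneg hnC hP0, mul_nonneg hnC hT0,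
      mul_nonneg hm.le hP0, mul_nonneg hm.le hI0, mul_nonneg hnC hI0]

/-- Continuity at `w` of `v ↦ v log |v|` from `L^ψ` to `L^β`; the radius `d` may depend on `w`. -/
theorem Admissible.exists_logDist_le (H : Admissible Ω γ β θ) (w : VSpace Ω β (psi γ β θ)) {e : ℝ}
    (he : 0 < e) : ∃ d, 0 < d ∧ ∀ v : VSpace Ω β (psi γ β θ),
      luxNorm Ω (psi γ β θ) (fun x => v.1 x - w.1 x) < d → logDist Ω β v.1 w.1 ≤ e := by
  obtain ⟨ε, hε, hgap⟩ := H.exists_gap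
  obtain ⟨d, hd, h⟩ := luxNorm_mul_log_sub_le H.isBounded hε H.memM0_psi H.memM0_snd hgap w.2.2 he
  exact ⟨d, hd, fun v hv => h v.1 v.2.2 hv⟩

theorem luxNorm_le_normV (hΩ : IsOpen Ω) (v w : VSpace Ω β q) :
    luxNorm Ω q (fun x => v.1 x - w.1 x) ≤ normV Ω β q (v.1 - w.1) := by
  rw [normV_sub hΩ]
  have h1 : 0 ≤ ∫ x in Ω, |v.1 x - w.1 x| := integral_nonneg fun x => abs_nonneg _
  have h2 : 0 ≤ ∑ i, luxNorm Ω β (fun x => weakDeriv Ω i v.1 x - weakDeriv Ω i w.1 x) :=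
    Finset.sum_nonneg fun i _ => luxNorm_nonneg
  linarith

theorem Admissible.luxNorm_le_distS (H : Admissible Ω γ β θ) (u v : SSpace Ω γ β θ) :
    luxNorm Ω (psi γ β θ) (fun x => (H.toV u).1 x - (H.toV v).1 x) ≤ distS Ω γ β θ u v := by
  rw [distS_eq, H.luxNorm_phi_sub]
  have h2 : 0 ≤ ∑ i, luxNorm Ω β
      (fun x => chainTerm Ω γ β i u.1 x - chainTerm Ω γ β i v.1 x) :=
    Finset.sum_nonneg fun i _ => luxNorm_nonneg
  linarith

/-- The metric on the source dominates the `L^ψ` distance of the images, which makes `logDist`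
small. The distance and `logDist` each receive `e / (2 * K)` in the comparison. -/
theorem Admissible.exists_normV_lt (H : Admissible Ω γ β θ) (v : SSpace Ω γ β θ) {e : ℝ}
    (he : 0 < e) : ∃ d, 0 < d ∧ ∀ u : SSpace Ω γ β θ, distS Ω γ β θ u v < d →
      normV Ω β (psi γ β θ) ((H.toV u).1 - (H.toV v).1) < e := by
  obtain ⟨K, hK, h⟩ := H.exists_comparison
  obtain ⟨d, hd, hlog⟩ := H.exists_logDist_le (H.toV v) (e := e / (2 * K)) (by positivity)
  refine ⟨min d (e / (2 * K)), by positivity, fun u hu => (h u v).1.trans_lt ?_⟩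
  have h1 := hlog (H.toV u) ((H.luxNorm_le_distS u v).trans_lt (hu.trans_le (min_le_left _ _)))
  have h2 := hu.trans_le (min_le_right _ _)
  calc _ < K * (e / (2 * K) + e / (2 * K)) :=
        mul_lt_mul_of_pos_left (add_lt_add_of_lt_of_le h2 h1) hK
    _ = e := by field_simp; ring

theorem Admissible.exists_distS_lt (H : Admissible Ω γ β θ) (v : SSpace Ω γ β θ) {e : ℝ}
    (he : 0 < e) : ∃ d, 0 < d ∧ ∀ u : SSpace Ω γ β θ,
      normV Ω β (psi γ β θ) ((H.toV u).1 - (H.toV v).1) < d → distS Ω γ β θ u v < e := by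
  obtain ⟨K, hK, h⟩ := H.exists_comparison
  obtain ⟨d, hd, hlog⟩ := H.exists_logDist_le (H.toV v) (e := e / (2 * K)) (by positivity)
  refine ⟨min d (e / (2 * K)), by positivity, fun u hu => (h u v).2.trans_lt ?_⟩
  have h1 := hlog (H.toV u)
    ((luxNorm_le_normV H.isOpen _ _).trans_lt (hu.trans_le (min_le_left _ _)))
  have h2 := hu.trans_le (min_le_right _ _)
  calc _ < K * (e / (2 * K) + e / (2 * K)) :=
        mul_lt_mul_of_pos_left (add_lt_add_of_lt_of_le h2 h1) hK
    _ = e := by field_simp; ring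

end

end VarExp

/-- `d_{S₁}` is a metric on `S_{1,γ(x),β(x),θ(x)}(Ω)`, the norm makes `L^{1,β(x)}(Ω) ∩ L^{ψ(x)}(Ω)`
a metric space, and `φ` is a homeomorphism of the first metric space onto the second. -/
theorem corollary3p10 (n : ℕ) (hn : 2 ≤ n) (Ω : Set (VarExp.E n)) (hΩo : IsOpen Ω)
    (hΩc : IsConnected Ω) (hΩb : Bornology.IsBounded Ω) (γ β θ : VarExp.E n → ℝ)
    (hγ : VarExp.IsC1Closure Ω γ) (hγ1 : ∀ x ∈ Ω, 1 ≤ γ x)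
    (hβ : VarExp.IsC1Closure Ω β) (hβ1 : ∀ x ∈ Ω, 1 ≤ β x)
    (hθ : VarExp.MemM0 Ω θ) (ε₀ : ℝ) (hε₀ : 0 < ε₀)
    (hθγβ : ∀ᵐ x ∂(VarExp.vol Ω), γ x + β x + ε₀ ≤ θ x) :
    ∃ (_ : MetricSpace (VarExp.SSpace Ω γ β θ))
      (_ : MetricSpace (VarExp.VSpace Ω β (VarExp.psi γ β θ))),
      (∀ u v : VarExp.SSpace Ω γ β θ, dist u v = VarExp.distS Ω γ β θ u v) ∧
      (∀ v w : VarExp.VSpace Ω β (VarExp.psi γ β θ),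
        dist v w = VarExp.normV Ω β (VarExp.psi γ β θ) (v.1 - w.1)) ∧
      ∃ e : VarExp.SSpace Ω γ β θ ≃ₜ VarExp.VSpace Ω β (VarExp.psi γ β θ),
        ∀ u, (e u).1 =ᵐ[VarExp.vol Ω] fun x => VarExp.phi γ β x (u.1 x) := by
  have H := VarExp.admissible hΩo hΩb hγ hγ1 hβ hβ1 hθ hε₀ hθγβ
  refine ⟨H.metricSpaceS, VarExp.metricSpaceV hΩo H.memM0_snd H.memM0_psi, fun _ _ => rfl,
    fun _ _ => rfl, ?_⟩
  let := H.metricSpaceS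
  let := VarExp.metricSpaceV hΩo H.memM0_snd H.memM0_psi
  refine ⟨⟨H.equiv, Metric.continuous_iff.2 fun v e he => H.exists_normV_lt v he,
    Metric.continuous_iff.2 fun w e he => ?_⟩, H.coe_toV⟩
  -- Continuity of the inverse at `w`: the estimate is centred at the preimage of `w`, and the
  -- images of the preimages are the original points.
  obtain ⟨d, hd, h⟩ := H.exists_distS_lt (H.equiv.symm w) he
  refine ⟨d, hd, fun w' hw' => h (H.equiv.symm w') ?_⟩
  change VarExp.normV Ω β _ ((H.equiv (H.equiv.symm w')).1 - (H.equiv (H.equiv.symm w)).1) < d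
  rw [H.equiv.apply_symm_apply, H.equiv.apply_symm_apply]
  exact hw'
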